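/- Let $R$ be a commutative ring with unit. A dg $R$-module is a $\mathbb Z$-graded $R$-module with a differential of degree $+1$; operads are symmetric operads in the symmetric monoidal category of dg $R$-modules (with the Koszul sign rule), and $\mathcal Com$ denotes the operad with $\mathcal Com(n)=R$ for all $n\ge 0$. A unital augmented operad is an operad $\mathcal O$ with a morphism of operads $\epsilon:\mathcal O\to\mathcal Com$ which is an isomorphism in arities $0$ and $1$; morphisms are morphisms of operads over $\mathcal Com$. A morphism is a weak equivalence (resp. a fibration) if it is a quasi-isomorphism (resp. surjective) in each arity, and $\mathcal O$ is cofibrant if every morphism $\mathcal O\to\mathcal Q$ of unital augmented operads lifts through every morphism $\mathcal P\to\mathcal Q$ which is both a fibration and a weak equivalence. For a dg module $M$ let $\mathcal O(M)=\bigoplus_{p\ge 0}\mathcal O(p)\otimes_{R[\Sigma_p]}M^{\otimes p}$ be the free $\mathcal O$-algebra on $M$. Let $\Omega^{\mathcal O}_n=\mathcal O(x_0,\dots,x_n;dx_0,\dots,dx_n)/I_n$ be the quotient of the free $\mathcal O$-algebra on generators $x_i$ of degree $0$ and $dx_i$ of degree $1$ with $d(x_i)=dx_i$, by the ideal $I_n$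 generated by $\sum x_i-1_0$ and $\sum dx_i$, where $1_0\in\mathcal O(0)$ corresponds to $1\in R$ under $\epsilon$. A monotone map $f:[m]\to[n]$ induces $\Omega^{\mathcal O}_n\to\Omega^{\mathcal O}_m$, $x_i\mapsto\sum_{f(j)=i}x_j$, $dx_i\mapsto\sum_{f(j)=i}dx_j$, so that $\Omega^{\mathcal O}_*$ is simplicial. For a simplicial set $X$ let $\Omega^{\mathcal O}(X)$ be the dg module whose component of degree $q$ is the module $\mathrm{Hom}_{\mathcal S}(X,(\Omega^{\mathcal O}_*)^q)$ of simplicial maps from $X$ to the degree $q$ part of $\Omega^{\mathcal O}_*$. Let $C^*X$ be the complex of normalized cochains of $X$ with coefficients in $R$ and $H^*(X;R)$ its cohomology. **Theorem.** Let $\mathcal O$ be a cofibrant unital augmented operad whose augmentation is surjective in each arity and such that each dg module $\mathcal O(l)$ is bounded above. Then $\Omega^{\mathcal O}(X)$ and $C^*X$ are homotopy equivalent as dg $R$-modules, naturally in the simplicial set $X$: there are natural chain maps $f_X:\Omega^{\mathcal O}(X)\to C^*X$ and $g_X:C^*X\to\Omega^{\mathcal O}(X)$, and chain homotopies $g_Xf_X\simeq\mathrm{id}$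 and $f_Xg_X\simeq\mathrm{id}$ which are natural in $X$. In particular, for every $n\in\mathbb Z$ there is an isomorphism $H^n(\Omega^{\mathcal O}(X))\cong H^n(X;R)$ natural in $X$. -/

import Mathlib

open CategoryTheory Opposite Simplicial
open scoped TensorProduct DirectSum

universe u

namespace GenForms

/-! ### Differential graded modules -/

/-- A `ℤ`-graded differential `R`-module: a module which is the internal direct sum of its
homogeneous components `deg q`, with a differential of degree `+1`. -/
structure DGModule (R : Type u) [CommRing R] where
  carrier : Type u
  [addCommGroup : AddCommGroup carrier]
  [module : Module R carrier]
  deg : ℤ → Submodule R carrier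
  isInternal : DirectSum.IsInternal deg
  d : carrier →ₗ[R] carrier
  d_mem : ∀ (q : ℤ) (x : carrier), x ∈ deg q → d x ∈ deg (q + 1)
  d_d : ∀ x : carrier, d (d x) = 0

attribute [instance] DGModule.addCommGroup DGModule.module

instance (R : Type u) [CommRing R] : CoeSort (DGModule R) (Type u) := ⟨DGModule.carrier⟩

/-- The sign `(-1)^n`, as an element of `R`. -/
def sgn (R : Type u) [CommRing R] (n : ℤ) : R := ((n.negOnePow : ℤ) : R)

section Sgn

variable {R : Type u} [CommRing R]

theorem sgn_add (a b : ℤ) : sgn R (a + b) = sgn R a * sgn R b := by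
  simp [sgn, Int.negOnePow_add]

@[simp] theorem sgn_zero : sgn R 0 = 1 := by simp [sgn]

@[simp] theorem sgn_one : sgn R 1 = -1 := by simp [sgn]

theorem sgn_mul_self (a : ℤ) : sgn R a * sgn R a = 1 := by
  rw [← sgn_add]
  simp [sgn, Int.negOnePow_even _ (Even.add_self a)]

end Sgn

namespace DGModule

variable {R : Type u} [CommRing R]

theorem hom_ext {M : DGModule R} {N : Type*} [AddCommGroup N] [Module R N] {f g : M →ₗ[R] N}
    (h : ∀ (q : ℤ), ∀ x ∈ M.deg q, f x = g x) : f = g := by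
  have htop : (⊤ : Submodule R M) ≤ LinearMap.eqLocus f g := by
    rw [← M.isInternal.submodule_iSup_eq_top]
    exact iSup_le fun q x hx => h q x hx
  ext x
  exact htop (Submodule.mem_top : x ∈ ⊤)

theorem bijective_coe (M : DGModule R) : Function.Bijective (DirectSum.coeLinearMap M.deg) :=
  M.isInternal

/-- The decomposition of a differential graded module into its homogeneous components. -/
noncomputable def decomp (M : DGModule R) : M ≃ₗ[R] ⨁ q, M.deg q :=
  (LinearEquiv.ofBijective (DirectSum.coeLinearMap M.deg) M.bijective_coe).symm

/-- The parity involution `x ↦ (-1)^{|x|} x`. -/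
noncomputable def par (M : DGModule R) : M →ₗ[R] M :=
  (DirectSum.coeLinearMap M.deg) ∘ₗ
    (DirectSum.lmap fun q : ℤ => (sgn R q) • (LinearMap.id : M.deg q →ₗ[R] M.deg q)) ∘ₗ
    (M.decomp : M →ₗ[R] ⨁ q, M.deg q)

theorem decomp_of_mem (M : DGModule R) {q : ℤ} {x : M} (hx : x ∈ M.deg q) :
    M.decomp x = DirectSum.lof R ℤ (fun q => M.deg q) q ⟨x, hx⟩ := by
  rw [decomp, LinearEquiv.symm_apply_eq, LinearEquiv.ofBijective_apply,
    DirectSum.coeLinearMap_lof]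

theorem par_of_mem (M : DGModule R) {q : ℤ} {x : M} (hx : x ∈ M.deg q) :
    M.par x = sgn R q • x := by
  rw [par, LinearMap.comp_apply, LinearMap.comp_apply, LinearEquiv.coe_coe, M.decomp_of_mem hx,
    DirectSum.lmap_lof, DirectSum.coeLinearMap_lof]
  rfl

theorem par_mem (M : DGModule R) {q : ℤ} {x : M} (hx : x ∈ M.deg q) : M.par x ∈ M.deg q := by
  rw [M.par_of_mem hx]
  exact Submodule.smul_mem _ _ hx

theorem par_par (M : DGModule R) (x : M) : M.par (M.par x) = x := by
  have h : M.par ∘ₗ M.par = LinearMap.id := hom_ext fun q x hx => by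
    simp [M.par_of_mem hx, smul_smul, sgn_mul_self]
  exact LinearMap.congr_fun h x

theorem par_d (M : DGModule R) (x : M) : M.par (M.d x) = -M.d (M.par x) := by
  have h : M.par ∘ₗ M.d = -(M.d ∘ₗ M.par) := hom_ext fun q x hx => by
    simp [M.par_of_mem hx, M.par_of_mem (M.d_mem q x hx), sgn_add]
  exact LinearMap.congr_fun h x

/-- Morphisms of differential graded modules. -/
structure Hom (M N : DGModule R) where
  toLin : M →ₗ[R] N
  map_deg : ∀ (q : ℤ) (x : M), x ∈ M.deg q → toLin x ∈ N.deg q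
  map_d : ∀ x : M, toLin (M.d x) = N.d (toLin x)

theorem Hom.map_par {M N : DGModule R} (f : Hom M N) (x : M) :
    f.toLin (M.par x) = N.par (f.toLin x) := by
  have h : f.toLin ∘ₗ M.par = N.par ∘ₗ f.toLin := hom_ext fun q x hx => by
    simp [M.par_of_mem hx, N.par_of_mem (f.map_deg q x hx)]
  exact LinearMap.congr_fun h x

/-- `f` is a quasi-isomorphism: it is injective and surjective on `ker d / im d`. -/
def Hom.IsQuasiIso {M N : DGModule R} (f : Hom M N) : Prop :=
  (∀ x : M, M.d x = 0 → (∃ y : N, f.toLin x = N.d y) → ∃ z : M, x = M.d z) ∧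
    ∀ y : N, N.d y = 0 → ∃ x : M, M.d x = 0 ∧ ∃ z : N, y = f.toLin x + N.d z

/-- The ground ring, concentrated in degree `0`. -/
def unit (R : Type u) [CommRing R] : DGModule R where
  carrier := R
  deg q := if q = 0 then ⊤ else ⊥
  isInternal := by
    refine (DirectSum.isInternal_submodule_iff_iSupIndep_and_iSup_eq_top _).2 ⟨?_, ?_⟩
    · intro i
      by_cases hi : i = 0
      · subst hi
        have : (⨆ (j : ℤ) (_ : j ≠ 0), (if j = 0 then (⊤ : Submodule R R) else ⊥)) = ⊥ := by
          simp only [iSup_eq_bot]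
          intro j hj
          simp [hj]
        rw [this]
        exact disjoint_bot_right
      · simp [hi]
    · exact top_le_iff.1 (le_trans (by simp) (le_iSup _ (0 : ℤ)))
  d := 0
  d_mem := by simp
  d_d := by simp

end DGModule

/-! ### Operads -/

/-- The slot of `a ∘ᵢ b` coming from the slot `t` of `b`. Here `a` has `m` slots, `b` has `n` slots
and `a ∘ᵢ b` has `r = m + n - 1` slots. -/
def innerSlot {m n r : ℕ} (h : m + n = r + 1) (i : Fin m) (t : Fin n) : Fin r :=
  ⟨i + t, by omega⟩

/-- The slot of `a ∘ᵢ b` coming from the slot `k ≠ i` of `a`. -/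
def outerSlot {m n r : ℕ} (h : m + n = r + 1) (i k : Fin m) (hk : k ≠ i) : Fin r :=
  ⟨if k < i then k else k - 1 + n, by
    have h1 := k.isLt
    have h2 := i.isLt
    have h3 : (k : ℕ) ≠ i := fun e => hk (Fin.ext e)
    split_ifs with hlt
    · have : (k : ℕ) < i := hlt
      omega
    · have : ¬ (k : ℕ) < i := hlt
      omega⟩

/-- A (symmetric, unital) operad in the symmetric monoidal category of `ℤ`-graded differential
`R`-modules: right actions of the symmetric groups (slot `j` of `act σ a` is slot `σ j` of `a`),
and partial compositions `comp i a b = a ∘ᵢ b` inserting `b` in the slot `i` of `a`. -/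
structure Operad (R : Type u) [CommRing R] where
  obj : ℕ → DGModule R
  act : ∀ {n : ℕ}, Equiv.Perm (Fin n) → DGModule.Hom (obj n) (obj n)
  act_one : ∀ {n : ℕ} (a : obj n), (act 1).toLin a = a
  act_mul : ∀ {n : ℕ} (σ τ : Equiv.Perm (Fin n)) (a : obj n),
    (act (σ * τ)).toLin a = (act τ).toLin ((act σ).toLin a)
  one : obj 1
  one_mem : one ∈ (obj 1).deg 0
  d_one : (obj 1).d one = 0
  comp : ∀ {m n r : ℕ} (_ : m + n = r + 1) (_ : Fin m), obj m →ₗ[R] obj n →ₗ[R] obj r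
  comp_mem : ∀ {m n r : ℕ} (h : m + n = r + 1) (i : Fin m) (p q : ℤ) (a : obj m) (b : obj n),
    a ∈ (obj m).deg p → b ∈ (obj n).deg q → comp h i a b ∈ (obj r).deg (p + q)
  d_comp : ∀ {m n r : ℕ} (h : m + n = r + 1) (i : Fin m) (p : ℤ) (a : obj m) (b : obj n),
    a ∈ (obj m).deg p →
      (obj r).d (comp h i a b) = comp h i ((obj m).d a) b + sgn R p • comp h i a ((obj n).d b)
  comp_one : ∀ {m : ℕ} (i : Fin m) (a : obj m), comp (n := 1) rfl i a one = a
  one_comp : ∀ {n : ℕ} (h : 1 + n = n + 1) (b : obj n), comp h 0 one b = b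
  comp_comp : ∀ {l m n r s t : ℕ} (h₁ : l + m = r + 1) (h₂ : r + n = s + 1) (h₃ : m + n = t + 1)
    (h₄ : l + t = s + 1) (i : Fin l) (j : Fin m) (a : obj l) (b : obj m) (c : obj n),
    comp h₂ (innerSlot h₁ i j) (comp h₁ i a b) c = comp h₄ i a (comp h₃ j b c)
  comp_comm : ∀ {l m n r s t : ℕ} (h₁ : l + m = r + 1) (h₂ : r + n = s + 1) (h₃ : l + n = t + 1)
    (h₄ : t + m = s + 1) (i k : Fin l) (hik : i ≠ k) (p q : ℤ) (a : obj l) (b : obj m) (c : obj n),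
    b ∈ (obj m).deg p → c ∈ (obj n).deg q →
      comp h₂ (outerSlot h₁ i k hik.symm) (comp h₁ i a b) c
        = sgn R (p * q) • comp h₄ (outerSlot h₃ k i hik) (comp h₃ k a c) b
  comp_act : ∀ {m n r : ℕ} (h : m + n = r + 1) (i : Fin m) (σ : Equiv.Perm (Fin m))
    (τ : Equiv.Perm (Fin n)) (ρ : Equiv.Perm (Fin r)),
    (∀ (k : Fin m) (hk : k ≠ i),
      ρ (outerSlot h i k hk) = outerSlot h (σ i) (σ k) (fun e => hk (σ.injective e))) →
    (∀ t : Fin n, ρ (innerSlot h i t) = innerSlot h (σ i) (τ t)) →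
    ∀ (a : obj m) (b : obj n),
      comp h i ((act σ).toLin a) ((act τ).toLin b) = (act ρ).toLin (comp h (σ i) a b)

/-- Morphisms of operads. -/
structure Operad.Hom {R : Type u} [CommRing R] (O P : Operad R) where
  app : ∀ n : ℕ, DGModule.Hom (O.obj n) (P.obj n)
  map_one : (app 1).toLin O.one = P.one
  map_act : ∀ {n : ℕ} (σ : Equiv.Perm (Fin n)) (a : O.obj n),
    (app n).toLin ((O.act σ).toLin a) = (P.act σ).toLin ((app n).toLin a)
  map_comp : ∀ {m n r : ℕ} (h : m + n = r + 1) (i : Fin m) (a : O.obj m) (b : O.obj n),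
    (app r).toLin (O.comp h i a b) = P.comp h i ((app m).toLin a) ((app n).toLin b)

theorem DGModule.mem_unit_deg {R : Type u} [CommRing R] {q : ℤ} {a : R} :
    (a : DGModule.unit R) ∈ (DGModule.unit R).deg q ↔ (q ≠ 0 → a = 0) := by
  change a ∈ (if q = 0 then (⊤ : Submodule R R) else ⊥) ↔ _
  by_cases h : q = 0 <;> simp [h]

/-- The operad of commutative (unital) algebras: `Com(n) = R` for every `n`, with trivial actions
and with the multiplication of `R` as composition. -/
def Com (R : Type u) [CommRing R] : Operad R where
  obj _ := DGModule.unit R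
  act _ := ⟨LinearMap.id, fun _ _ h => h, fun _ => rfl⟩
  act_one _ := rfl
  act_mul _ _ _ := rfl
  one := (1 : R)
  one_mem := (DGModule.mem_unit_deg (R := R)).2 fun h => absurd rfl h
  d_one := rfl
  comp _ _ := LinearMap.mul R R
  comp_mem {m n r} h i p q a b ha hb := by
    refine (DGModule.mem_unit_deg (R := R)).2 fun hpq => ?_
    let a' : R := a
    let b' : R := b
    change a' * b' = 0
    by_cases hp : p = 0
    · have hb0 : b' = 0 := (DGModule.mem_unit_deg (R := R)).1 hb fun hq => hpq (by simp [hp, hq])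
      rw [hb0, mul_zero]
    · have ha0 : a' = 0 := (DGModule.mem_unit_deg (R := R)).1 ha hp
      rw [ha0, zero_mul]
  d_comp {m n r} h i p a b ha := by
    let a' : R := a
    let b' : R := b
    change (0 : R) = 0 * b' + sgn R p * (a' * 0)
    rw [zero_mul, mul_zero, mul_zero, add_zero]
  comp_one _ a := mul_one (M := R) a
  one_comp _ b := one_mul (M := R) b
  comp_comp _ _ _ _ _ _ a b c := mul_assoc (G := R) a b c
  comp_comm {l m n r s t} h₁ h₂ h₃ h₄ i k hik p q a b c hb hc := by
    let a' : R := a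
    let b' : R := b
    let c' : R := c
    change a' * b' * c' = sgn R (p * q) * (a' * c' * b')
    by_cases hp : p = 0
    · rw [hp, zero_mul, sgn_zero, one_mul]
      exact mul_right_comm a' b' c'
    · have hb0 : b' = 0 := (DGModule.mem_unit_deg (R := R)).1 hb hp
      rw [hb0]
      simp
  comp_act _ _ _ _ _ _ _ _ _ := rfl

/-- A unital augmented operad: an operad over `Com` whose augmentation is an isomorphism in
arities `0` and `1`. -/
structure UAOperad (R : Type u) [CommRing R] extends Operad R where
  aug : Operad.Hom toOperad (Com R)
  aug_zero : Function.Bijective (aug.app 0).toLin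
  aug_one : Function.Bijective (aug.app 1).toLin

namespace UAOperad

variable {R : Type u} [CommRing R]

/-- Morphisms of unital augmented operads: morphisms of operads over `Com` (hence the identity of
`R` in arities `0` and `1`). -/
structure Hom (O P : UAOperad R) extends Operad.Hom O.toOperad P.toOperad where
  aug_app : ∀ (n : ℕ) (a : O.obj n), (P.aug.app n).toLin ((app n).toLin a) = (O.aug.app n).toLin a

/-- A fibration of unital augmented operads is a morphism which is surjective in each arity. -/
def Hom.IsFibration {O P : UAOperad R} (f : Hom O P) : Prop :=
  ∀ n : ℕ, Function.Surjective (f.app n).toLin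

/-- A weak equivalence of unital augmented operads is a quasi-isomorphism in each arity. -/
def Hom.IsWeakEquiv {O P : UAOperad R} (f : Hom O P) : Prop :=
  ∀ n : ℕ, (f.app n).IsQuasiIso

/-- `O` is cofibrant: every morphism out of `O` lifts through every acyclic fibration, i.e. the
morphism from the initial object to `O` has the left lifting property with respect to acyclic
fibrations. -/
def IsCofibrant (O : UAOperad.{u} R) : Prop :=
  ∀ (P Q : UAOperad.{u} R) (p : Hom P Q), p.IsFibration → p.IsWeakEquiv →
    ∀ f : Hom O Q, ∃ g : Hom O P, ∀ (n : ℕ) (a : O.obj n),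
      (p.app n).toLin ((g.app n).toLin a) = (f.app n).toLin a

/-- The element `1₀ ∈ O(0)` corresponding to `1 ∈ R = Com(0)`. -/
noncomputable def unitZero (O : UAOperad R) : O.obj 0 :=
  (LinearEquiv.ofBijective (O.aug.app 0).toLin O.aug_zero).symm (1 : R)

theorem aug_unitZero (O : UAOperad R) : (O.aug.app 0).toLin O.unitZero = (1 : R) :=
  (LinearEquiv.ofBijective (O.aug.app 0).toLin O.aug_zero).apply_symm_apply (1 : R)

theorem d_unitZero (O : UAOperad R) : (O.obj 0).d O.unitZero = 0 := by
  apply O.aug_zero.1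
  rw [(O.aug.app 0).map_d, map_zero]
  rfl

theorem eq_unitZero_of (O : UAOperad R) {x : O.obj 0}
    (h : (O.aug.app 0).toLin x = (1 : R)) : x = O.unitZero :=
  O.aug_zero.1 (h.trans O.aug_unitZero.symm)

theorem unitZero_mem (O : UAOperad R) : O.unitZero ∈ (O.obj 0).deg 0 := by
  have h : (O.aug.app 0).toLin = (O.aug.app 0).toLin ∘ₗ ((O.obj 0).deg 0).subtype ∘ₗ
      (DirectSum.component R ℤ (fun q => (O.obj 0).deg q) 0) ∘ₗ
      ((O.obj 0).decomp : O.obj 0 →ₗ[R] _) := DGModule.hom_ext fun q x hx => by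
    simp only [LinearMap.comp_apply, LinearEquiv.coe_coe, DGModule.decomp_of_mem _ hx]
    by_cases hq : q = 0
    · subst hq
      rw [DirectSum.component.lof_self]
      rfl
    · rw [DirectSum.lof_eq_of, DirectSum.component, DFinsupp.lapply_apply]
      have h1 : (O.aug.app 0).toLin x = (0 : R) :=
        (DGModule.mem_unit_deg (R := R)).1 ((O.aug.app 0).map_deg q x hx) hq
      rw [DirectSum.of_eq_of_ne _ _ _ (Ne.symm hq), map_zero, map_zero]
      exact h1
  have h2 := LinearMap.congr_fun h O.unitZero
  rw [O.aug_unitZero] at h2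
  rw [← O.eq_unitZero_of h2.symm]
  exact Subtype.property _

theorem par_unitZero (O : UAOperad R) : (O.obj 0).par O.unitZero = O.unitZero := by
  rw [DGModule.par_of_mem _ O.unitZero_mem, sgn_zero, one_smul]

theorem comp_par_unitZero (O : UAOperad R) {p : ℕ} (i : Fin (p + 1)) (o : O.obj (p + 1)) :
    O.comp (n := 0) (r := p) rfl i ((O.obj (p + 1)).par o) O.unitZero
      = (O.obj p).par (O.comp (n := 0) (r := p) rfl i o O.unitZero) := by
  have h : (O.comp (n := 0) (r := p) rfl i).flip O.unitZero ∘ₗ (O.obj (p + 1)).par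
      = (O.obj p).par ∘ₗ (O.comp (n := 0) (r := p) rfl i).flip O.unitZero :=
    DGModule.hom_ext fun q x hx => by
      have h0 := O.comp_mem (n := 0) (r := p) rfl i q 0 x O.unitZero hx O.unitZero_mem
      rw [add_zero] at h0
      simp [DGModule.par_of_mem _ hx, DGModule.par_of_mem _ h0]
  exact LinearMap.congr_fun h o

theorem comp_d_unitZero (O : UAOperad R) {p : ℕ} (i : Fin (p + 1)) (o : O.obj (p + 1)) :
    O.comp (n := 0) (r := p) rfl i ((O.obj (p + 1)).d o) O.unitZero
      = (O.obj p).d (O.comp (n := 0) (r := p) rfl i o O.unitZero) := by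
  have h : (O.comp (n := 0) (r := p) rfl i).flip O.unitZero ∘ₗ (O.obj (p + 1)).d
      = (O.obj p).d ∘ₗ (O.comp (n := 0) (r := p) rfl i).flip O.unitZero :=
    DGModule.hom_ext fun q x hx => by
      simp [O.d_comp (n := 0) (r := p) rfl i q x O.unitZero hx, O.d_unitZero]
  exact LinearMap.congr_fun h o

end UAOperad


/-! ### Free algebras over an operad -/

/-- The sign of the permutation of homogeneous factors of degrees `e` by `σ`: each pair whose order
is reversed contributes the sign `(-1)^{e j * e k}`. -/
def koszul (R : Type u) [CommRing R] {p : ℕ} (σ : Equiv.Perm (Fin p)) (e : Fin p → ℤ) : R :=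
  ∏ j : Fin p, ∏ k : Fin p, if j < k ∧ σ k < σ j then sgn R (e j * e k) else 1

theorem koszul_update {R : Type u} [CommRing R] {p : ℕ} (σ : Equiv.Perm (Fin p)) (e : Fin p → ℤ)
    (k : Fin p) :
    (∏ l, if l < k then sgn R (e l) else 1) * koszul R σ (Function.update e k (e k + 1))
      = koszul R σ e * ∏ l, if σ l < σ k then sgn R (e l) else 1 := by
  have h1 : koszul R σ (Function.update e k (e k + 1)) = koszul R σ e *
      ((∏ l, if k < l ∧ σ l < σ k then sgn R (e l) else 1) *
        ∏ l, if l < k ∧ σ k < σ l then sgn R (e l) else 1) := by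
    have h2 : ∀ j l : Fin p,
        (if j < l ∧ σ l < σ j then
          sgn R (Function.update e k (e k + 1) j * Function.update e k (e k + 1) l) else 1)
        = (if j < l ∧ σ l < σ j then sgn R (e j * e l) else 1) *
          ((if j = k then (if k < l ∧ σ l < σ k then sgn R (e l) else 1) else 1) *
          (if l = k then (if j < k ∧ σ k < σ j then sgn R (e j) else 1) else 1)) := by
      intro j l
      by_cases hj : j = k
      · subst hj
        by_cases hl : l = j
        · subst hl
          simp
        · by_cases hc : j < l ∧ σ l < σ j
          · simp [hl, hc, add_mul, sgn_add]
          · simp [hl, hc]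
      · by_cases hl : l = k
        · subst hl
          by_cases hc : j < l ∧ σ l < σ j
          · simp [hj, hc, mul_add, sgn_add]
          · simp [hj, hc]
        · simp [hj, hl]
    simp only [koszul]
    simp_rw [h2, Finset.prod_mul_distrib]
    congr 2
    · rw [Finset.prod_comm]
      simp
    · simp
  rw [h1, mul_left_comm]
  congr 1
  rw [← Finset.prod_mul_distrib, ← Finset.prod_mul_distrib]
  refine Finset.prod_congr rfl fun l _ => ?_
  rcases lt_trichotomy l k with h | h | h
  · have hne : σ l ≠ σ k := fun e => h.ne (σ.injective e)
    rcases lt_or_gt_of_ne hne with h' | h'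
    · simp [h, h', h.not_gt, h'.not_gt]
    · simp [h, h', h.not_gt, h'.not_gt, sgn_mul_self]
  · subst h
    simp
  · simp [h, h.not_gt]

section FreeAlgebra

variable {R : Type u} [CommRing R]

/-- The differential of the tensor power `M^{⊗p}`:
`v₁ ⊗ ⋯ ⊗ v_p ↦ ∑ₖ (-1)^{|v₁| + ⋯ + |v_{k-1}|} v₁ ⊗ ⋯ ⊗ d vₖ ⊗ ⋯ ⊗ v_p`. -/
noncomputable def dPow (M : DGModule R) (p : ℕ) :
    (⨂[R] (_ : Fin p), M) →ₗ[R] (⨂[R] (_ : Fin p), M) :=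
  ∑ k : Fin p, PiTensorProduct.map fun l =>
    if l < k then M.par else if l = k then M.d else LinearMap.id

/-- The family `((-1)^{|v₁|} v₁, …, (-1)^{|v_{k-1}|} v_{k-1}, d vₖ, v_{k+1}, …, v_p)`. -/
noncomputable def dAt (M : DGModule R) {p : ℕ} (k : Fin p) (v : Fin p → M) : Fin p → M := fun l =>
  (if l < k then M.par else if l = k then M.d else LinearMap.id) (v l)

theorem dPow_tprod (M : DGModule R) {p : ℕ} (v : Fin p → M) :
    dPow M p (PiTensorProduct.tprod R v) = ∑ k, PiTensorProduct.tprod R (dAt M k v) := by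
  simp only [dPow, LinearMap.sum_apply, PiTensorProduct.map_tprod]
  rfl

theorem dAt_dAt_self (M : DGModule R) {p : ℕ} (k : Fin p) (v : Fin p → M) :
    PiTensorProduct.tprod R (dAt M k (dAt M k v)) = 0 := by
  refine MultilinearMap.map_coord_zero _ k ?_
  simp [dAt, M.d_d]

theorem dAt_dAt (M : DGModule R) {p : ℕ} {k l : Fin p} (h : k < l) (v : Fin p → M) :
    PiTensorProduct.tprod R (dAt M k (dAt M l v))
      = - PiTensorProduct.tprod R (dAt M l (dAt M k v)) := by
  have h1 : dAt M k (dAt M l v) = Function.update (dAt M l (dAt M k v)) k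
      (-(dAt M l (dAt M k v) k)) := by
    funext j
    rcases lt_trichotomy j k with hj | hj | hj
    · have hjl := hj.trans h
      simp [dAt, hj, hjl, hj.ne, M.par_par]
    · subst hj
      simp [dAt, h, M.par_d]
    · rcases lt_trichotomy j l with hl | hl | hl
      · simp [dAt, hj.not_gt, hj.ne', hl]
      · subst hl
        simp [dAt, hj.not_gt, hj.ne']
      · simp [dAt, hj.not_gt, hj.ne', hl.not_gt, hl.ne']
  rw [h1, MultilinearMap.map_update_neg, Function.update_eq_self]

theorem dPow_dPow (M : DGModule R) (p : ℕ) (x : ⨂[R] (_ : Fin p), M) :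
    dPow M p (dPow M p x) = 0 := by
  have h : dPow M p ∘ₗ dPow M p = 0 := by
    refine PiTensorProduct.ext (MultilinearMap.ext fun v => ?_)
    simp only [LinearMap.compMultilinearMap_apply, LinearMap.comp_apply, dPow_tprod, map_sum,
      LinearMap.zero_apply]
    rw [← Finset.sum_product', Finset.univ_product_univ]
    refine Finset.sum_involution (fun a _ => (a.2, a.1)) ?_ ?_ ?_ ?_
    · rintro ⟨a, b⟩ -
      rcases lt_trichotomy a b with hab | hab | hab
      · simp [dAt_dAt M hab]
      · subst hab
        simp [dAt_dAt_self]
      · simp [dAt_dAt M hab]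
    · rintro ⟨a, b⟩ - hne heq
      simp only [Prod.mk.injEq] at heq
      apply hne
      rw [heq.1]
      exact dAt_dAt_self M _ v
    · simp
    · simp
  exact LinearMap.congr_fun h x

variable (O : UAOperad R) (M : DGModule R)

/-- The module `⨁ₚ O(p) ⊗ M^{⊗p}`. -/
abbrev Cover : Type u := ⨁ p : ℕ, (O.obj p) ⊗[R] (⨂[R] (_ : Fin p), M)

/-- The element `o ⊗ v₁ ⊗ ⋯ ⊗ v_p`. -/
noncomputable def mkCover {p : ℕ} (o : O.obj p) (v : Fin p → M) : Cover O M :=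
  DirectSum.lof R ℕ (fun p => (O.obj p) ⊗[R] (⨂[R] (_ : Fin p), M)) p
    (o ⊗ₜ[R] PiTensorProduct.tprod R v)

/-- The differential of `⨁ₚ O(p) ⊗ M^{⊗p}`: `o ⊗ v ↦ d o ⊗ v + (-1)^{|o|} o ⊗ d v`. -/
noncomputable def dCover : Cover O M →ₗ[R] Cover O M :=
  DirectSum.lmap fun p : ℕ =>
    TensorProduct.map (O.obj p).d LinearMap.id + TensorProduct.map (O.obj p).par (dPow M p)

variable {O M}

theorem dCover_mk {p : ℕ} (o : O.obj p) (v : Fin p → M) :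
    dCover O M (mkCover O M o v)
      = mkCover O M ((O.obj p).d o) v + ∑ k, mkCover O M ((O.obj p).par o) (dAt M k v) := by
  simp only [dCover, mkCover, DirectSum.lmap_lof, LinearMap.add_apply, TensorProduct.map_tmul,
    LinearMap.id_apply, dPow_tprod, TensorProduct.tmul_sum, map_add, map_sum]

theorem dCover_mk_homogeneous {p : ℕ} (o : O.obj p) (v : Fin p → M) (e : Fin p → ℤ)
    (hv : ∀ j, v j ∈ M.deg (e j)) :
    dCover O M (mkCover O M o v) = mkCover O M ((O.obj p).d o) v +
      ∑ k, (∏ l, if l < k then sgn R (e l) else 1) •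
        mkCover O M ((O.obj p).par o) (Function.update v k (M.d (v k))) := by
  rw [dCover_mk]
  congr 1
  refine Finset.sum_congr rfl fun k _ => ?_
  have h : dAt M k v = fun l => (if l < k then sgn R (e l) else 1) •
      Function.update v k (M.d (v k)) l := by
    funext l
    rcases lt_trichotomy l k with hl | hl | hl
    · simp [dAt, hl, hl.ne, M.par_of_mem (hv l)]
    · subst hl
      simp [dAt]
    · simp [dAt, hl.not_gt, hl.ne']
  rw [mkCover, h, MultilinearMap.map_smul_univ, TensorProduct.tmul_smul, map_smul]
  rfl

theorem cover_hom_ext {N : Type*} [AddCommGroup N] [Module R N] {f g : Cover O M →ₗ[R] N}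
    (h : ∀ (p : ℕ) (o : O.obj p) (v : Fin p → M), f (mkCover O M o v) = g (mkCover O M o v)) :
    f = g := by
  refine DirectSum.linearMap_ext _ fun p => TensorProduct.ext' fun o t => ?_
  have h1 : f ∘ₗ DirectSum.lof R ℕ (fun p => (O.obj p) ⊗[R] (⨂[R] (_ : Fin p), M)) p ∘ₗ
        TensorProduct.mk R _ _ o
      = g ∘ₗ DirectSum.lof R ℕ (fun p => (O.obj p) ⊗[R] (⨂[R] (_ : Fin p), M)) p ∘ₗ
        TensorProduct.mk R _ _ o :=
    PiTensorProduct.ext (MultilinearMap.ext fun v => h p o v)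
  exact LinearMap.congr_fun h1 t

theorem dCover_dCover (x : Cover O M) : dCover O M (dCover O M x) = 0 := by
  have h : dCover O M ∘ₗ dCover O M = 0 := by
    refine DirectSum.linearMap_ext _ fun p => TensorProduct.ext' fun o t => ?_
    simp [dCover, DGModule.d_d, DGModule.par_d, dPow_dPow, TensorProduct.neg_tmul]
  exact LinearMap.congr_fun h x

variable (O M)

/-- The relations `(o·σ) ⊗ (v₁ ⊗ ⋯ ⊗ v_p) = o ⊗ σ(v₁ ⊗ ⋯ ⊗ v_p)` defining the tensor product over
`R[Σ_p]`, where `σ` permutes the factors with the Koszul sign. -/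
def coinvariantRelations : Submodule R (Cover O M) :=
  Submodule.span R {z | ∃ (p : ℕ) (o : O.obj p) (σ : Equiv.Perm (Fin p)) (e : Fin p → ℤ)
    (v : Fin p → M), (∀ j, v j ∈ M.deg (e j)) ∧
      z = mkCover O M ((O.act σ).toLin o) v - koszul R σ e • mkCover O M o (v ∘ ⇑σ.symm)}

theorem dCover_mem_coinvariantRelations :
    coinvariantRelations O M ≤ (coinvariantRelations O M).comap (dCover O M) := by
  refine Submodule.span_le.2 ?_
  rintro _ ⟨p, o, σ, e, v, hv, rfl⟩
  have hv' : ∀ j, (v ∘ ⇑σ.symm) j ∈ M.deg ((e ∘ ⇑σ.symm) j) := fun j => hv _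
  have key : ∀ k : Fin p, Function.update (v ∘ ⇑σ.symm) (σ k) (M.d ((v ∘ ⇑σ.symm) (σ k)))
      = Function.update v k (M.d (v k)) ∘ ⇑σ.symm := by
    intro k
    rw [Function.comp_apply, Equiv.symm_apply_apply]
    funext j
    by_cases hj : j = σ k
    · subst hj
      simp
    · have : σ.symm j ≠ k := fun h => hj (by rw [← h, Equiv.apply_symm_apply])
      simp [Function.update_of_ne hj, Function.update_of_ne this]
  have key2 : ∀ k : Fin p, (∏ l, if l < σ k then sgn R ((e ∘ ⇑σ.symm) l) else 1)
      = ∏ l, if σ l < σ k then sgn R (e l) else 1 := by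
    intro k
    rw [← Equiv.prod_comp σ]
    simp
  have e2 := dCover_mk_homogeneous o (v ∘ ⇑σ.symm) _ hv'
  rw [← Equiv.sum_comp σ] at e2
  simp only [key, key2] at e2
  change dCover O M _ ∈ coinvariantRelations O M
  rw [map_sub, map_smul, dCover_mk_homogeneous _ v e hv, e2]
  simp only [← (O.act σ).map_d, ← (O.act σ).map_par]
  have h0 : mkCover O M ((O.act σ).toLin ((O.obj p).d o)) v
      - koszul R σ e • mkCover O M ((O.obj p).d o) (v ∘ ⇑σ.symm) ∈ coinvariantRelations O M :=
    Submodule.subset_span ⟨p, _, σ, e, v, hv, rfl⟩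
  have hk : ∀ k : Fin p, (∏ l, if l < k then sgn R (e l) else 1) •
      (mkCover O M ((O.act σ).toLin ((O.obj p).par o)) (Function.update v k (M.d (v k)))
        - koszul R σ (Function.update e k (e k + 1)) •
          mkCover O M ((O.obj p).par o) (Function.update v k (M.d (v k)) ∘ ⇑σ.symm))
        ∈ coinvariantRelations O M := by
    intro k
    refine Submodule.smul_mem _ _ (Submodule.subset_span ⟨p, _, σ, _, _, ?_, rfl⟩)
    intro j
    by_cases hj : j = k
    · subst hj
      simpa using M.d_mem _ _ (hv j)
    · simpa [hj] using hv j
  convert Submodule.add_mem _ h0 (Submodule.sum_mem _ fun k (_ : k ∈ Finset.univ) => hk k) using 1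
  simp only [smul_sub, smul_smul, koszul_update, Finset.sum_sub_distrib, smul_add, Finset.smul_sum]
  abel

/-- The free `O`-algebra `O(M) = ⨁ₚ O(p) ⊗_{R[Σ_p]} M^{⊗p}` on `M`. -/
abbrev FreeAlg : Type u := Cover O M ⧸ coinvariantRelations O M

/-- The element `o(v₁, …, v_p)` of the free algebra on `M`. -/
noncomputable def FreeAlg.mk {p : ℕ} (o : O.obj p) (v : Fin p → M) : FreeAlg O M :=
  (coinvariantRelations O M).mkQ (mkCover O M o v)

/-- The differential of the free algebra. -/
noncomputable def FreeAlg.d : FreeAlg O M →ₗ[R] FreeAlg O M :=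
  (coinvariantRelations O M).mapQ (coinvariantRelations O M) (dCover O M)
    (dCover_mem_coinvariantRelations O M)

variable {O M}

theorem FreeAlg.d_mk {p : ℕ} (o : O.obj p) (v : Fin p → M) :
    FreeAlg.d O M (FreeAlg.mk O M o v)
      = FreeAlg.mk O M ((O.obj p).d o) v + ∑ k, FreeAlg.mk O M ((O.obj p).par o) (dAt M k v) := by
  simp only [FreeAlg.d, FreeAlg.mk, Submodule.mkQ_apply, Submodule.mapQ_apply, dCover_mk]
  simp only [← Submodule.mkQ_apply, map_add, map_sum]

theorem FreeAlg.hom_ext {N : Type*} [AddCommGroup N] [Module R N] {f g : FreeAlg O M →ₗ[R] N}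
    (h : ∀ (p : ℕ) (o : O.obj p) (v : Fin p → M),
      f (FreeAlg.mk O M o v) = g (FreeAlg.mk O M o v)) : f = g :=
  Submodule.linearMap_qext _ (cover_hom_ext h)

theorem FreeAlg.d_d (x : FreeAlg O M) : FreeAlg.d O M (FreeAlg.d O M x) = 0 := by
  obtain ⟨y, rfl⟩ := Submodule.mkQ_surjective _ x
  simp [FreeAlg.d, dCover_dCover]

variable (O)

/-- The map `o ⊗ v₁ ⊗ ⋯ ⊗ v_p ↦ o ⊗ f v₁ ⊗ ⋯ ⊗ f v_p`. -/
noncomputable def mapCover {N : DGModule R} (f : DGModule.Hom M N) : Cover O M →ₗ[R] Cover O N :=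
  DirectSum.lmap fun p : ℕ =>
    TensorProduct.map LinearMap.id (PiTensorProduct.map fun _ : Fin p => f.toLin)

theorem mapCover_mk {N : DGModule R} (f : DGModule.Hom M N) {p : ℕ} (o : O.obj p)
    (v : Fin p → M) :
    mapCover O f (mkCover O M o v) = mkCover O N o fun j => f.toLin (v j) := by
  simp only [mapCover, mkCover, DirectSum.lmap_lof, TensorProduct.map_tmul,
    PiTensorProduct.map_tprod, LinearMap.id_apply]

theorem mapCover_mem {N : DGModule R} (f : DGModule.Hom M N) :
    coinvariantRelations O M ≤ (coinvariantRelations O N).comap (mapCover O f) := by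
  refine Submodule.span_le.2 ?_
  rintro _ ⟨p, o, σ, e, v, hv, rfl⟩
  refine Submodule.subset_span ⟨p, o, σ, e, fun j => f.toLin (v j),
    fun j => f.map_deg _ _ (hv j), ?_⟩
  rw [map_sub, map_smul, mapCover_mk, mapCover_mk]
  rfl

/-- The map of free algebras `O(f) : O(M) → O(N)`, `o(v₁, …, v_p) ↦ o(f v₁, …, f v_p)`. -/
noncomputable def FreeAlg.map {N : DGModule R} (f : DGModule.Hom M N) :
    FreeAlg O M →ₗ[R] FreeAlg O N :=
  (coinvariantRelations O M).mapQ (coinvariantRelations O N) (mapCover O f) (mapCover_mem O f)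

theorem FreeAlg.map_mk {N : DGModule R} (f : DGModule.Hom M N) {p : ℕ} (o : O.obj p)
    (v : Fin p → M) :
    FreeAlg.map O f (FreeAlg.mk O M o v) = FreeAlg.mk O N o fun j => f.toLin (v j) := by
  simp only [FreeAlg.map, FreeAlg.mk, Submodule.mkQ_apply, Submodule.mapQ_apply, mapCover_mk]

theorem FreeAlg.d_map {N : DGModule R} (f : DGModule.Hom M N) (x : FreeAlg O M) :
    FreeAlg.d O N (FreeAlg.map O f x) = FreeAlg.map O f (FreeAlg.d O M x) := by
  have h : FreeAlg.d O N ∘ₗ FreeAlg.map O f = FreeAlg.map O f ∘ₗ FreeAlg.d O M := by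
    refine FreeAlg.hom_ext fun p o v => ?_
    have h1 : ∀ k : Fin p, dAt N k (fun j => f.toLin (v j)) = fun j => f.toLin (dAt M k v j) := by
      intro k
      funext l
      rcases lt_trichotomy l k with hl | hl | hl
      · simp [dAt, hl, f.map_par]
      · subst hl
        simp [dAt, f.map_d]
      · simp [dAt, hl.not_gt, hl.ne']
    simp only [LinearMap.comp_apply, FreeAlg.map_mk, FreeAlg.d_mk, map_add, map_sum, h1]
  exact LinearMap.congr_fun h x

theorem FreeAlg.mk_insertNth_smul {p : ℕ} (i : Fin (p + 1)) (o : O.obj (p + 1)) (c : R) (s : M)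
    (v : Fin p → M) :
    FreeAlg.mk O M o (i.insertNth (c • s) v : Fin (p + 1) → M)
      = c • FreeAlg.mk O M o (i.insertNth s v : Fin (p + 1) → M) := by
  have h : ∀ t : M, (i.insertNth t v : Fin (p + 1) → M)
      = Function.update (i.insertNth 0 v : Fin (p + 1) → M) i t := fun t => by simp
  rw [h (c • s), h s, FreeAlg.mk, FreeAlg.mk, mkCover, mkCover, MultilinearMap.map_update_smul,
    TensorProduct.tmul_smul, map_smul, map_smul]

theorem dAt_insertNth_self {p : ℕ} (i : Fin (p + 1)) (s : M) (v : Fin p → M) :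
    dAt M i (i.insertNth s v : Fin (p + 1) → M)
      = (i.insertNth (M.d s) (fun l => if i.succAbove l < i then M.par (v l) else v l) :
          Fin (p + 1) → M) := by
  funext l
  rcases Fin.eq_self_or_eq_succAbove i l with rfl | ⟨l, rfl⟩
  · simp [dAt]
  · by_cases h : i.succAbove l < i <;> simp [dAt, h, Fin.succAbove_ne]

theorem dAt_insertNth_succAbove {p : ℕ} (i : Fin (p + 1)) (k : Fin p) (s : M) (v : Fin p → M) :
    dAt M (i.succAbove k) (i.insertNth s v : Fin (p + 1) → M)
      = (i.insertNth (if i < i.succAbove k then M.par s else s) (dAt M k v) :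
          Fin (p + 1) → M) := by
  funext l
  rcases Fin.eq_self_or_eq_succAbove i l with rfl | ⟨l, rfl⟩
  · by_cases h : l < l.succAbove k <;> simp [dAt, h, (Fin.succAbove_ne l k).symm]
  · rcases lt_trichotomy l k with h | h | h
    · simp [dAt, h]
    · subst h
      simp [dAt]
    · simp [dAt, h.not_gt, h.ne']

end FreeAlgebra

/-! ### Generalized differential forms -/

section Forms

variable (R : Type u) [CommRing R]

/-- The component of degree `q` of the free graded module on `x₀, …, x_n` in degree `0` and
`dx₀, …, dx_n` in degree `1`; the pair `(a, b)` stands for `∑ aᵢ xᵢ + ∑ bᵢ dxᵢ`. -/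
def gensDeg (n : ℕ) (q : ℤ) : Submodule R ((Fin (n + 1) → R) × (Fin (n + 1) → R)) where
  carrier := {y | (q ≠ 0 → y.1 = 0) ∧ (q ≠ 1 → y.2 = 0)}
  add_mem' {y z} hy hz :=
    ⟨fun h => by simp [hy.1 h, hz.1 h], fun h => by simp [hy.2 h, hz.2 h]⟩
  zero_mem' := by simp
  smul_mem' c y hy := ⟨fun h => by simp [hy.1 h], fun h => by simp [hy.2 h]⟩

theorem gensDeg_isInternal (n : ℕ) : DirectSum.IsInternal (gensDeg R n) := by
  refine (DirectSum.isInternal_submodule_iff_iSupIndep_and_iSup_eq_top _).2 ⟨?_, ?_⟩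
  · intro i
    let S : Submodule R ((Fin (n + 1) → R) × (Fin (n + 1) → R)) :=
      { carrier := {y | (i = 0 → y.1 = 0) ∧ (i = 1 → y.2 = 0)}
        add_mem' := fun {y z} hy hz =>
          ⟨fun h => by simp [hy.1 h, hz.1 h], fun h => by simp [hy.2 h, hz.2 h]⟩
        zero_mem' := by simp
        smul_mem' := fun c y hy => ⟨fun h => by simp [hy.1 h], fun h => by simp [hy.2 h]⟩ }
    have hS : (⨆ (j : ℤ) (_ : j ≠ i), gensDeg R n j) ≤ S := by
      refine iSup₂_le fun j hj y hy => ⟨fun h => hy.1 ?_, fun h => hy.2 ?_⟩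
      · rintro rfl
        exact hj h.symm
      · rintro rfl
        exact hj h.symm
    refine Disjoint.mono_right hS (Submodule.disjoint_def.2 fun y hy hy' => Prod.ext ?_ ?_)
    · by_cases h : i = 0
      · exact hy'.1 h
      · exact hy.1 h
    · by_cases h : i = 1
      · exact hy'.2 h
      · exact hy.2 h
  · refine top_le_iff.1 fun y _ => ?_
    have h0 : ((y.1, 0) : (Fin (n + 1) → R) × (Fin (n + 1) → R)) ∈ ⨆ q, gensDeg R n q :=
      Submodule.mem_iSup_of_mem 0 ⟨fun h => absurd rfl h, fun _ => rfl⟩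
    have h1 : ((0, y.2) : (Fin (n + 1) → R) × (Fin (n + 1) → R)) ∈ ⨆ q, gensDeg R n q :=
      Submodule.mem_iSup_of_mem 1 ⟨fun _ => rfl, fun h => absurd rfl h⟩
    simpa using Submodule.add_mem _ h0 h1

/-- The free differential graded module on `x₀, …, x_n` in degree `0` and `dx₀, …, dx_n` in
degree `1`, with `d(xᵢ) = dxᵢ`. -/
def gens (n : ℕ) : DGModule R where
  carrier := (Fin (n + 1) → R) × (Fin (n + 1) → R)
  deg := gensDeg R n
  isInternal := gensDeg_isInternal R n
  d := LinearMap.inr R _ _ ∘ₗ LinearMap.fst R _ _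
  d_mem q y hy := by
    refine ⟨fun _ => rfl, fun h => hy.1 fun h0 => h (by rw [h0, zero_add])⟩
  d_d _ := rfl

/-- The generator `xᵢ`. -/
def genX (n : ℕ) (i : Fin (n + 1)) : gens R n :=
  ((Pi.single i 1, 0) : (Fin (n + 1) → R) × (Fin (n + 1) → R))

/-- The generator `dxᵢ`. -/
def genDX (n : ℕ) (i : Fin (n + 1)) : gens R n :=
  ((0, Pi.single i 1) : (Fin (n + 1) → R) × (Fin (n + 1) → R))

theorem sum_genX (n : ℕ) : ∑ i, genX R n i
    = (((fun _ => 1), 0) : (Fin (n + 1) → R) × (Fin (n + 1) → R)) := by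
  have h : ∑ i : Fin (n + 1), ((Pi.single i 1, 0) : (Fin (n + 1) → R) × (Fin (n + 1) → R))
      = ((fun _ => 1), 0) := by
    refine Prod.ext ?_ ?_
    · rw [Prod.fst_sum]
      exact Finset.univ_sum_single (fun _ : Fin (n + 1) => (1 : R))
    · rw [Prod.snd_sum]
      simp
  exact h

theorem sum_genDX (n : ℕ) : ∑ i, genDX R n i
    = ((0, (fun _ => 1)) : (Fin (n + 1) → R) × (Fin (n + 1) → R)) := by
  have h : ∑ i : Fin (n + 1), ((0, Pi.single i 1) : (Fin (n + 1) → R) × (Fin (n + 1) → R))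
      = (0, (fun _ => 1)) := by
    refine Prod.ext ?_ ?_
    · rw [Prod.fst_sum]
      simp
    · rw [Prod.snd_sum]
      exact Finset.univ_sum_single (fun _ : Fin (n + 1) => (1 : R))
  exact h

theorem sum_genX_mem (n : ℕ) : ∑ i, genX R n i ∈ (gens R n).deg 0 := by
  rw [sum_genX]
  exact ⟨fun h => absurd rfl h, fun _ => rfl⟩

theorem sum_genDX_mem (n : ℕ) : ∑ i, genDX R n i ∈ (gens R n).deg 1 := by
  rw [sum_genDX]
  exact ⟨fun _ => rfl, fun h => absurd rfl h⟩

theorem d_sum_genX (n : ℕ) : (gens R n).d (∑ i, genX R n i) = ∑ i, genDX R n i := by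
  rw [sum_genX, sum_genDX]
  rfl

theorem d_sum_genDX (n : ℕ) : (gens R n).d (∑ i, genDX R n i) = 0 := by
  rw [← d_sum_genX, (gens R n).d_d]

/-- The map on generators induced by a map `f : [m] → [n]` of the simplex category,
`xᵢ ↦ ∑_{f j = i} xⱼ` and `dxᵢ ↦ ∑_{f j = i} dxⱼ`: on coefficients, it is the composition with
`f`. -/
def gensMap {m n : SimplexCategory} (f : m ⟶ n) : DGModule.Hom (gens R n.len) (gens R m.len) where
  toLin := LinearMap.prodMap (LinearMap.funLeft R R f.toOrderHom) (LinearMap.funLeft R R f.toOrderHom)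
  map_deg q y hy := by
    constructor
    · intro h
      change LinearMap.funLeft R R f.toOrderHom y.1 = 0
      rw [hy.1 h, map_zero]
    · intro h
      change LinearMap.funLeft R R f.toOrderHom y.2 = 0
      rw [hy.2 h, map_zero]
  map_d y := rfl

theorem gensMap_genX {m n : SimplexCategory} (f : m ⟶ n) (i : Fin (n.len + 1)) :
    (gensMap R f).toLin (genX R n.len i) = ∑ j with f.toOrderHom j = i, genX R m.len j := by
  have h : ((fun j => (Pi.single i 1 : Fin (n.len + 1) → R) (f.toOrderHom j), fun _ => 0) :
        (Fin (m.len + 1) → R) × (Fin (m.len + 1) → R))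
      = ∑ j with f.toOrderHom j = i, (Pi.single j 1, 0) := by
    refine Prod.ext ?_ ?_
    · rw [Prod.fst_sum]
      funext k
      simp [Finset.sum_apply, Pi.single_apply]
    · rw [Prod.snd_sum]
      simp
      rfl
  exact h

theorem gensMap_genDX {m n : SimplexCategory} (f : m ⟶ n) (i : Fin (n.len + 1)) :
    (gensMap R f).toLin (genDX R n.len i) = ∑ j with f.toOrderHom j = i, genDX R m.len j := by
  have h : ((fun _ => 0, fun j => (Pi.single i 1 : Fin (n.len + 1) → R) (f.toOrderHom j)) :
        (Fin (m.len + 1) → R) × (Fin (m.len + 1) → R))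
      = ∑ j with f.toOrderHom j = i, (0, Pi.single j 1) := by
    refine Prod.ext ?_ ?_
    · rw [Prod.fst_sum]
      simp
      rfl
    · rw [Prod.snd_sum]
      funext k
      simp [Finset.sum_apply, Pi.single_apply]
  exact h

theorem gensMap_sum_genX {m n : SimplexCategory} (f : m ⟶ n) :
    (gensMap R f).toLin (∑ i, genX R n.len i) = ∑ i, genX R m.len i := by
  rw [sum_genX, sum_genX]
  rfl

theorem gensMap_sum_genDX {m n : SimplexCategory} (f : m ⟶ n) :
    (gensMap R f).toLin (∑ i, genDX R n.len i) = ∑ i, genDX R m.len i := by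
  rw [sum_genDX, sum_genDX]
  rfl

variable {R} (O : UAOperad R)

/-- The ideal `I_n` of the free algebra `O(x₀, …, x_n; dx₀, …, dx_n)` generated by `∑ xᵢ - 1₀` and
`∑ dxᵢ`. As the algebra is generated by the module of generators, the ideal generated by `s` is
spanned by the elements `o(v₁, …, s, …, v_p)` with the `vⱼ` in this module; moreover,
`o(v₁, …, 1₀, …, v_p) = (o ∘ᵢ 1₀)(v₁, …, v_p)`. -/
def formsIdeal (n : ℕ) : Submodule R (FreeAlg O (gens R n)) :=
  Submodule.span R
    ({z | ∃ (p : ℕ) (i : Fin (p + 1)) (o : O.obj (p + 1)) (v : Fin p → gens R n),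
      z = FreeAlg.mk O (gens R n) o (i.insertNth (∑ j, genX R n j) v : Fin (p + 1) → gens R n)
        - FreeAlg.mk O (gens R n) (O.comp (n := 0) (r := p) rfl i o O.unitZero) v} ∪
    {z | ∃ (p : ℕ) (i : Fin (p + 1)) (o : O.obj (p + 1)) (v : Fin p → gens R n),
      z = FreeAlg.mk O (gens R n) o (i.insertNth (∑ j, genDX R n j) v : Fin (p + 1) → gens R n)})

theorem d_mem_formsIdeal (n : ℕ) :
    formsIdeal O n ≤ (formsIdeal O n).comap (FreeAlg.d O (gens R n)) := by
  have hDX : ∀ (p : ℕ) (i : Fin (p + 1)) (o : O.obj (p + 1)) (v : Fin p → gens R n),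
      FreeAlg.mk O (gens R n) o (i.insertNth (∑ j, genDX R n j) v : Fin (p + 1) → gens R n)
        ∈ formsIdeal O n := fun p i o v => Submodule.subset_span (Or.inr ⟨p, i, o, v, rfl⟩)
  refine Submodule.span_le.2 ?_
  rintro _ (⟨p, i, o, v, rfl⟩ | ⟨p, i, o, v, rfl⟩)
  · have hX : ∀ (o : O.obj (p + 1)) (v : Fin p → gens R n),
        FreeAlg.mk O (gens R n) o (i.insertNth (∑ j, genX R n j) v : Fin (p + 1) → gens R n)
        - FreeAlg.mk O (gens R n) (O.comp (n := 0) (r := p) rfl i o O.unitZero) v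
          ∈ formsIdeal O n := fun o v => Submodule.subset_span (Or.inl ⟨p, i, o, v, rfl⟩)
    have hpar : (gens R n).par (∑ j, genX R n j) = ∑ j, genX R n j := by
      rw [DGModule.par_of_mem _ (sum_genX_mem R n), sgn_zero, one_smul]
    change FreeAlg.d O (gens R n) _ ∈ formsIdeal O n
    rw [map_sub, FreeAlg.d_mk, FreeAlg.d_mk, Fin.sum_univ_succAbove _ i]
    simp only [dAt_insertNth_self, dAt_insertNth_succAbove, hpar, ite_self, d_sum_genX,
      ← O.comp_par_unitZero, ← O.comp_d_unitZero]
    convert Submodule.add_mem _ (hX ((O.obj (p + 1)).d o) v) (Submodule.add_mem _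
      (hDX p i ((O.obj (p + 1)).par o)
        (fun l => if i.succAbove l < i then (gens R n).par (v l) else v l))
      (Submodule.sum_mem _ fun k (_ : k ∈ Finset.univ) =>
        hX ((O.obj (p + 1)).par o) (dAt (gens R n) k v))) using 1
    simp only [Finset.sum_sub_distrib]
    abel
  · change FreeAlg.d O (gens R n) _ ∈ formsIdeal O n
    rw [FreeAlg.d_mk, Fin.sum_univ_succAbove _ i]
    simp only [dAt_insertNth_self, dAt_insertNth_succAbove, d_sum_genDX]
    refine Submodule.add_mem _ (hDX _ _ _ _) (Submodule.add_mem _ ?_ (Submodule.sum_mem _ ?_))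
    · rw [← zero_smul R (∑ j, genDX R n j), FreeAlg.mk_insertNth_smul]
      exact Submodule.smul_mem _ _ (hDX _ _ _ _)
    · intro k _
      split_ifs
      · rw [DGModule.par_of_mem _ (sum_genDX_mem R n), FreeAlg.mk_insertNth_smul]
        exact Submodule.smul_mem _ _ (hDX _ _ _ _)
      · exact hDX _ _ _ _

theorem map_mem_formsIdeal {m n : SimplexCategory} (f : m ⟶ n) :
    formsIdeal O n.len ≤ (formsIdeal O m.len).comap (FreeAlg.map O (gensMap R f)) := by
  have key : ∀ (p : ℕ) (i : Fin (p + 1)) (s : gens R n.len) (v : Fin p → gens R n.len),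
      (fun j => (gensMap R f).toLin ((i.insertNth s v : Fin (p + 1) → gens R n.len) j))
        = (i.insertNth ((gensMap R f).toLin s) (fun j => (gensMap R f).toLin (v j)) :
            Fin (p + 1) → gens R m.len) := by
    intro p i s v
    funext l
    rcases Fin.eq_self_or_eq_succAbove i l with rfl | ⟨l, rfl⟩ <;> simp
  refine Submodule.span_le.2 ?_
  rintro _ (⟨p, i, o, v, rfl⟩ | ⟨p, i, o, v, rfl⟩)
  · refine Submodule.subset_span (Or.inl ⟨p, i, o, fun j => (gensMap R f).toLin (v j), ?_⟩)
    rw [map_sub, FreeAlg.map_mk, FreeAlg.map_mk, key, gensMap_sum_genX]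
  · refine Submodule.subset_span (Or.inr ⟨p, i, o, fun j => (gensMap R f).toLin (v j), ?_⟩)
    rw [FreeAlg.map_mk, key, gensMap_sum_genDX]

/-- The algebra `Ω_n = O(x₀, …, x_n; dx₀, …, dx_n) / I_n`. -/
abbrev Omega (n : ℕ) : Type u := FreeAlg O (gens R n) ⧸ formsIdeal O n

instance (n : ℕ) : AddCommGroup (Omega O n) := Submodule.Quotient.addCommGroup _

instance (n : ℕ) : Module R (Omega O n) := Submodule.Quotient.module _

/-- The element `o(v₁, …, v_p)` of `Ω_n`. -/
noncomputable def Omega.mk {n p : ℕ} (o : O.obj p) (v : Fin p → gens R n) : Omega O n :=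
  (formsIdeal O n).mkQ (FreeAlg.mk O (gens R n) o v)

/-- The differential of `Ω_n`. -/
noncomputable def Omega.d (n : ℕ) : Omega O n →ₗ[R] Omega O n :=
  (formsIdeal O n).mapQ (formsIdeal O n) (FreeAlg.d O (gens R n)) (d_mem_formsIdeal O n)

/-- The simplicial structure of `Ω_*`. -/
noncomputable def Omega.map {m n : SimplexCategory} (f : m ⟶ n) : Omega O n.len →ₗ[R] Omega O m.len :=
  (formsIdeal O n.len).mapQ (formsIdeal O m.len) (FreeAlg.map O (gensMap R f))
    (map_mem_formsIdeal O f)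

/-- The component of degree `q` of `Ω_n`, spanned by the `o(v₁, …, v_p)` with `o, v₁, …, v_p`
homogeneous of total degree `q`. -/
def Omega.deg (n : ℕ) (q : ℤ) : Submodule R (Omega O n) :=
  Submodule.span R {z | ∃ (p : ℕ) (a : ℤ) (e : Fin p → ℤ) (o : O.obj p) (v : Fin p → gens R n),
    o ∈ (O.obj p).deg a ∧ (∀ j, v j ∈ (gens R n).deg (e j)) ∧ a + ∑ j, e j = q ∧
      z = Omega.mk O o v}

theorem Omega.d_d {n : ℕ} (x : Omega O n) : Omega.d O n (Omega.d O n x) = 0 := by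
  obtain ⟨y, rfl⟩ := Submodule.mkQ_surjective _ x
  simp [Omega.d, FreeAlg.d_d]

theorem Omega.d_map {m n : SimplexCategory} (f : m ⟶ n) (x : Omega O n.len) :
    Omega.d O m.len (Omega.map O f x) = Omega.map O f (Omega.d O n.len x) := by
  obtain ⟨y, rfl⟩ := Submodule.mkQ_surjective _ x
  simp [Omega.d, Omega.map, FreeAlg.d_map]

theorem Omega.d_mk {n p : ℕ} (o : O.obj p) (v : Fin p → gens R n) :
    Omega.d O n (Omega.mk O o v)
      = Omega.mk O ((O.obj p).d o) v + ∑ k, Omega.mk O ((O.obj p).par o) (dAt (gens R n) k v) := by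
  simp only [Omega.d, Omega.mk, Submodule.mkQ_apply, Submodule.mapQ_apply, FreeAlg.d_mk]
  simp only [← Submodule.mkQ_apply, map_add, map_sum]

theorem Omega.d_mem {n : ℕ} {q : ℤ} {x : Omega O n} (hx : x ∈ Omega.deg O n q) :
    Omega.d O n x ∈ Omega.deg O n (q + 1) := by
  have h : Omega.deg O n q ≤ (Omega.deg O n (q + 1)).comap (Omega.d O n) := by
    refine Submodule.span_le.2 ?_
    rintro _ ⟨p, a, e, o, v, ho, hv, rfl, rfl⟩
    change Omega.d O n _ ∈ Omega.deg O n _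
    rw [Omega.d_mk]
    refine Submodule.add_mem _ ?_ (Submodule.sum_mem _ fun k _ => ?_)
    · exact Submodule.subset_span ⟨p, a + 1, e, _, v, (O.obj p).d_mem _ _ ho, hv, by ring, rfl⟩
    · refine Submodule.subset_span ⟨p, a, fun j => e j + if j = k then 1 else 0, _, _,
        (O.obj p).par_mem ho, ?_, ?_, rfl⟩
      · intro l
        rcases lt_trichotomy l k with hl | hl | hl
        · simpa [dAt, hl, hl.ne] using (gens R n).par_mem (hv l)
        · subst hl
          simpa [dAt] using (gens R n).d_mem _ _ (hv l)
        · simpa [dAt, hl.not_gt, hl.ne'] using hv l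
      · rw [Finset.sum_add_distrib]
        simp [add_assoc]
  exact h hx

/-- The component of degree `q` of `Ω(X) = Hom(X, Ω_*)`: the simplicial maps from `X` to the
simplicial module `Ω_*^q`. -/
def forms (X : SSet.{u}) (q : ℤ) :
    Submodule R (∀ n : SimplexCategory, X.obj (op n) → Omega O n.len) where
  carrier := {c | (∀ n x, c n x ∈ Omega.deg O n.len q) ∧
    ∀ (m n : SimplexCategory) (f : m ⟶ n) (x : X.obj (op n)),
      c m (X.map f.op x) = Omega.map O f (c n x)}
  add_mem' {c c'} hc hc' :=
    ⟨fun n x => Submodule.add_mem _ (hc.1 n x) (hc'.1 n x), fun m n f x => by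
      simp only [Pi.add_apply, hc.2 m n f x, hc'.2 m n f x, map_add]⟩
  zero_mem' := ⟨fun n x => Submodule.zero_mem _, fun m n f x => by simp⟩
  smul_mem' r c hc :=
    ⟨fun n x => Submodule.smul_mem _ _ (hc.1 n x), fun m n f x => by
      simp only [Pi.smul_apply, hc.2 m n f x, map_smul]⟩

/-- The differential of `Ω(X)`, computed in `Ω_*`. -/
noncomputable def formsD (X : SSet.{u}) (q : ℤ) : forms O X q →ₗ[R] forms O X (q + 1) where
  toFun c := ⟨fun n x => Omega.d O n.len (c.1 n x), fun n x => Omega.d_mem O (c.2.1 n x),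
    fun m n f x => by
      dsimp only
      rw [c.2.2 m n f x, Omega.d_map]⟩
  map_add' c c' := by
    ext n x
    simp
  map_smul' r c := by
    ext n x
    simp

/-- The map `Ω(Y) → Ω(X)` induced by `φ : X ⟶ Y`. -/
def formsMap {X Y : SSet.{u}} (φ : X ⟶ Y) (q : ℤ) : forms O Y q →ₗ[R] forms O X q where
  toFun c := ⟨fun n x => c.1 n (φ.app (op n) x), fun n x => c.2.1 n _, fun m n f x => by
    dsimp only
    rw [← c.2.2 m n f, NatTrans.naturality_apply]⟩
  map_add' _ _ := rfl
  map_smul' _ _ := rfl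

/-- The functor `X ↦ Ω(X)` of generalized differential forms, with values in differential graded
modules. -/
noncomputable def formsFunctor : SSet.{u}ᵒᵖ ⥤ CochainComplex (ModuleCat.{u} R) ℤ where
  obj X := CochainComplex.of (fun q => ModuleCat.of R (forms O X.unop q))
    (fun q => ModuleCat.ofHom (formsD O X.unop q)) (fun q => by
      refine ModuleCat.hom_ext (LinearMap.ext fun c => Subtype.ext ?_)
      funext n x
      exact Omega.d_d O _)
  map φ := CochainComplex.ofHom (fun q => ModuleCat.ofHom (formsMap O φ.unop q)) (fun q => by
    simp only [CochainComplex.of_d]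
    rfl)
  map_id X := rfl
  map_comp φ ψ := rfl

end Forms

/-! ### Normalized cochains -/

section Cochains

variable (R : Type u) [CommRing R]

/-- Normalized cochains of degree `q` (for `q : ℤ`): functions on the simplices of `X` which vanish
on the simplices of dimension different from `q` and on the degenerate simplices. -/
def cochains (X : SSet.{u}) (q : ℤ) : Submodule R (∀ n : ℕ, X _⦋n⦌ → R) where
  carrier := {c | ∀ (n : ℕ) (x : X _⦋n⦌), ((n : ℤ) ≠ q ∨ x ∈ X.degenerate n) → c n x = 0}
  add_mem' {c c'} hc hc' n x h := by simp [hc n x h, hc' n x h]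
  zero_mem' n x h := rfl
  smul_mem' r c hc n x h := by simp [hc n x h]

/-- The coboundary `(δc)(x) = ∑ᵢ (-1)^i c(dᵢ x)`. -/
def coboundary (X : SSet.{u}) : (∀ n : ℕ, X _⦋n⦌ → R) →ₗ[R] (∀ n : ℕ, X _⦋n⦌ → R) where
  toFun c
    | 0, _ => 0
    | n + 1, x => ∑ i : Fin (n + 2), (-1 : R) ^ (i : ℕ) * c n (X.δ i x)
  map_add' c c' := by
    funext n x
    cases n with
    | zero => simp
    | succ n => simp [mul_add, Finset.sum_add_distrib]
  map_smul' r c := by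
    funext n x
    cases n with
    | zero => simp
    | succ n => simp [Finset.mul_sum, mul_left_comm]

theorem coboundary_succ {X : SSet.{u}} (c : ∀ n : ℕ, X _⦋n⦌ → R) (n : ℕ) (x : X _⦋n + 1⦌) :
    coboundary R X c (n + 1) x = ∑ i : Fin (n + 2), (-1 : R) ^ (i : ℕ) * c n (X.δ i x) := rfl

theorem coboundary_coboundary {X : SSet.{u}} (c : ∀ n : ℕ, X _⦋n⦌ → R) :
    coboundary R X (coboundary R X c) = 0 := by
  funext n x
  match n with
  | 0 => rfl
  | 1 =>
    rw [coboundary_succ]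
    exact Finset.sum_eq_zero fun i _ => mul_zero _
  | n + 2 =>
    simp only [coboundary_succ, Finset.mul_sum, Pi.zero_apply]
    rw [← Finset.sum_product', Finset.univ_product_univ]
    refine Finset.sum_involution
      (fun (a : Fin (n + 3) × Fin (n + 2)) _ => if h : a.1 ≤ a.2.castSucc then
        (a.2.succ, a.1.castLT (lt_of_le_of_lt (Fin.le_iff_val_le_val.mp h) a.2.is_lt))
        else (a.2.castSucc, a.1.pred fun h0 => h (h0 ▸ Fin.zero_le _))) ?_ ?_ ?_ ?_
    · rintro ⟨i, j⟩ -
      by_cases h : i ≤ j.castSucc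
      · simp only [h, dite_true]
        rw [SSet.δ_comp_δ''_apply h]
        simp only [Fin.val_succ, Fin.val_castLT, pow_succ]
        ring
      · have h' : j.castSucc < i := not_le.1 h
        have hi : (i : ℕ) = (i.pred h'.ne_zero : ℕ) + 1 := by
          have : 0 < (i : ℕ) := lt_of_le_of_lt (Nat.zero_le _) h'
          simp only [Fin.val_pred]
          omega
        simp only [h, dite_false]
        rw [SSet.δ_comp_δ'_apply h', hi]
        simp only [Fin.val_castSucc, pow_succ]
        ring
    · rintro ⟨i, j⟩ - hne heq
      by_cases h : i ≤ j.castSucc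
      · simp only [h, dite_true, Prod.mk.injEq] at heq
        rw [← heq.1] at h
        exact absurd h (not_le.2 j.castSucc_lt_succ)
      · simp only [h, dite_false, Prod.mk.injEq] at heq
        exact h heq.1.ge
    · simp
    · rintro ⟨i, j⟩ -
      by_cases h : i ≤ j.castSucc
      · simp only [h, dite_true]
        rw [dif_neg]
        · simp
        · rw [Fin.castSucc_castLT]
          exact not_le.2 (lt_of_le_of_lt h j.castSucc_lt_succ)
      · have h' : j.castSucc < i := not_le.1 h
        have h2 : j.castSucc ≤ (i.pred h'.ne_zero).castSucc := by
          rw [Fin.le_def, Fin.val_castSucc, Fin.val_castSucc, Fin.val_pred]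
          have : (j : ℕ) < i := h'
          omega
        simp [h, h2]

theorem δ_σ_mem_degenerate {X : SSet.{u}} {n : ℕ} (i : Fin (n + 2)) (j : Fin (n + 1)) (y : X _⦋n⦌)
    (h1 : i ≠ j.castSucc) (h2 : i ≠ j.succ) : X.δ i (X.σ j y) ∈ X.degenerate n := by
  have h1' : (i : ℕ) ≠ j := fun h => h1 (Fin.ext h)
  have h2' : (i : ℕ) ≠ j + 1 := fun h => h2 (Fin.ext h)
  cases n with
  | zero => omega
  | succ n =>
    by_cases h : (i : ℕ) < j
    · obtain ⟨j, rfl⟩ : ∃ j' : Fin (n + 1), j = j'.succ :=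
        ⟨⟨(j : ℕ) - 1, by omega⟩, Fin.ext (by simp; omega)⟩
      obtain ⟨i, rfl⟩ : ∃ i' : Fin (n + 2), i = i'.castSucc :=
        ⟨⟨(i : ℕ), by omega⟩, Fin.ext (by simp)⟩
      rw [SSet.δ_comp_σ_of_le_apply (by
        rw [Fin.le_def]
        simp only [Fin.val_castSucc, Fin.val_succ] at h ⊢
        omega)]
      exact SSet.σ_mem_degenerate _ _ _
    · rw [SSet.δ_comp_σ_of_gt'_apply (by rw [Fin.lt_def]; simp; omega)]
      exact SSet.σ_mem_degenerate _ _ _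

theorem coboundary_mem {X : SSet.{u}} {q : ℤ} {c : ∀ n : ℕ, X _⦋n⦌ → R}
    (hc : c ∈ cochains R X q) : coboundary R X c ∈ cochains R X (q + 1) := by
  rintro (_ | n) x h
  · rfl
  · rw [coboundary_succ]
    rcases h with h | h
    · refine Finset.sum_eq_zero fun i _ => ?_
      rw [hc n _ (Or.inl fun h' => h (by rw [← h']; push_cast; rfl)), mul_zero]
    · rw [SSet.degenerate_eq_iUnion_range_σ, Set.mem_iUnion] at h
      obtain ⟨j, y, rfl⟩ := h
      rw [Finset.sum_eq_add j.castSucc j.succ j.castSucc_lt_succ.ne]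
      · simp [pow_succ]
      · rintro i - ⟨h1, h2⟩
        rw [hc n _ (Or.inr (δ_σ_mem_degenerate i j y h1 h2)), mul_zero]
      · simp
      · simp

/-- The coboundary of normalized cochains. -/
def cochainsD (X : SSet.{u}) (q : ℤ) : cochains R X q →ₗ[R] cochains R X (q + 1) :=
  (coboundary R X).restrict fun _ hc => coboundary_mem R hc

/-- The map induced on cochains by `φ : X ⟶ Y`. -/
def cochainsMap {X Y : SSet.{u}} (φ : X ⟶ Y) (q : ℤ) : cochains R Y q →ₗ[R] cochains R X q where
  toFun c := ⟨fun n x => c.1 n (φ.app (op ⦋n⦌) x), fun n _ h =>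
    c.2 n _ (h.imp_right fun h' => SSet.degenerate_app_apply h' φ)⟩
  map_add' _ _ := rfl
  map_smul' _ _ := rfl

/-- The functor `X ↦ C^* X` of normalized cochains with coefficients in `R`. -/
def cochainFunctor : SSet.{u}ᵒᵖ ⥤ CochainComplex (ModuleCat.{u} R) ℤ where
  obj X := CochainComplex.of (fun q => ModuleCat.of R (cochains R X.unop q))
    (fun q => ModuleCat.ofHom (cochainsD R X.unop q)) (fun q => by
      refine ModuleCat.hom_ext (LinearMap.ext fun c => Subtype.ext ?_)
      exact coboundary_coboundary R c.1)
  map {X Y} φ := CochainComplex.ofHom (fun q => ModuleCat.ofHom (cochainsMap R φ.unop q)) (fun q => by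
    simp only [CochainComplex.of_d]
    refine ModuleCat.hom_ext (LinearMap.ext fun c => Subtype.ext ?_)
    funext n x
    match n with
    | 0 => rfl
    | n + 1 =>
      change ∑ i : Fin (n + 2), (-1 : R) ^ (i : ℕ) * c.1 n (φ.unop.app _ (Y.unop.δ i x))
        = ∑ i : Fin (n + 2), (-1 : R) ^ (i : ℕ) * c.1 n (X.unop.δ i (φ.unop.app _ x))
      simp only [SSet.δ_naturality_apply])
  map_id X := rfl
  map_comp φ ψ := rfl

/-- The cohomology functor `X ↦ H^n(X; R)`. -/
noncomputable def cohomologyFunctor (n : ℤ) : SSet.{u}ᵒᵖ ⥤ ModuleCat.{u} R :=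
  cochainFunctor R ⋙ HomologicalComplex.homologyFunctor (ModuleCat.{u} R) (ComplexShape.up ℤ) n

end Cochains

end GenForms

/-!
Simplicial maps into a simplicial module `A` form a module which is natural in the simplicial set
and additive in `A`. The forms on `X` are the simplicial maps from `X` to `Ω_*`, and, by the Yoneda
lemma, the normalized cochains on `X` are the simplicial maps from `X` to the cochains of the
standard simplices (`formsIso`, `cochainsIso`). Hence it is enough to find a homotopy equivalence
between two complexes of simplicial modules, `Ω_*` and `C^* Δ[*]`; everything natural in `X` follows
by functoriality (`naturallyHomotopyEquivalent_sections`).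

The two complexes are compared through the constant simplicial module `R`, which maps to both. They
share two properties. In each simplicial degree `n`, the map from `R` is a homotopy equivalence
(`RowEquivalence`), although not compatibly with the simplicial structure. In each cochain degree
`q`, the chain complex of the simplicial module is contractible (`ColumnContractible`). If `U` is a
complex of simplicial modules which is contractible in each simplicial degree, and the columns of
`W` are contractible, then every morphism `U ⟶ W` is homotopic to zero: through the Dold–Kan
correspondence the homotopy is constructed by induction on the simplicial degree, the contractions
of `U` in the simplicial degrees being corrected by the contractions of `W`
(`nonempty_homotopy_zero`). Applied to the mapping cones of the maps from `R`, this shows that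
morphisms from `R` extend uniquely up to homotopy, and so the two complexes are homotopy
equivalent (`RowEquivalence.nonempty_homotopyEquiv`).

The columns are contracted by multiplication by functions on the vertices. For cochains it is
`(φ c)(x) = φ(x₀) c(x)`; for forms it is `x ↦ μ(∑ φᵢ xᵢ, x)` with `μ ∈ O(2)` of degree `0` and
augmentation `1`, which exists since the augmentation is surjective. Multiplying the degeneracies by
the indicator functions of the final segments of vertices gives a simplicial homotopy between `0`
and the identity.

The rows of the cochains are contracted by cones. For `Ω_n` one would like to extend the contraction
`dxᵢ ↦ xᵢ`, `dx₀ ↦ x₀ - ∑ xᵢ` of the generators to `o(v₁, …, v_p)` slot by slot. This requires an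
order of the slots, and averaging over the orders is not possible over a general ring `R`.
Cofibrancy is what replaces it. Linear orders on the slots form an operad of sets, and the
convolution of `O` with it, suitably resolved, is an operad with an acyclic fibration onto `O`
(`resOperad`, `resProj`). A section decomposes each operation as a sum of operations labelled by
orders, compatibly with the actions and the insertions of `1₀`, and with the differentials up to
labelled operations of sum zero (`UAOperad.IsCofibrant.exists_orderDecomposition`). Contracting each
labelled operation in its own order gives a contraction of `Ω_n` up to a locally nilpotent error,
hence a contraction (`Omega.exists_contraction`).
-/

namespace GenForms

/-! ### The operad of linear orders -/

section Slots

variable {m n r : ℕ} (h : m + n = r + 1) (i : Fin m)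

theorem innerSlot_injective : Function.Injective (innerSlot h i : Fin n → Fin r) := by
  intro a b hab
  simp only [innerSlot, Fin.mk.injEq] at hab
  omega

theorem exists_eq_innerSlot_or_outerSlot (x : Fin r) :
    (∃ t : Fin n, x = innerSlot h i t) ∨ ∃ (k : Fin m) (hk : k ≠ i), x = outerSlot h i k hk := by
  have hx := x.2
  have hi := i.2
  by_cases h1 : (x : ℕ) < i
  · refine Or.inr ⟨⟨x, by omega⟩, fun e => ?_, Fin.ext ?_⟩
    · rw [Fin.ext_iff] at e
      simp only at e
      omega
    · simp only [outerSlot, Fin.lt_def, h1, if_true]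
  · by_cases h2 : (x : ℕ) < i + n
    · refine Or.inl ⟨⟨x - i, by omega⟩, Fin.ext ?_⟩
      simp only [innerSlot]
      omega
    · refine Or.inr ⟨⟨x - n + 1, by omega⟩, fun e => ?_, Fin.ext ?_⟩
      · rw [Fin.ext_iff] at e
        simp only at e
        omega
      · have h3 : ¬ (x : ℕ) - n + 1 < i := by omega
        simp only [outerSlot, Fin.lt_def, h3, if_false]
        omega

/-- The slot of `a` from which a slot of `a ∘ᵢ b` comes; the slots of `b` come from `i`. -/
def slotProj (x : Fin r) : Fin m :=
  ⟨if (x : ℕ) < i then x else if (x : ℕ) < i + n then i else x - n + 1, by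
    have := x.2
    have := i.2
    split_ifs <;> omega⟩

@[simp] theorem slotProj_innerSlot (t : Fin n) : slotProj h i (innerSlot h i t) = i := by
  have := t.2
  simp [slotProj, innerSlot]

@[simp] theorem slotProj_outerSlot (k : Fin m) (hk : k ≠ i) :
    slotProj h i (outerSlot h i k hk) = k := by
  have h1 : (k : ℕ) ≠ i := fun e => hk (Fin.ext e)
  refine Fin.ext ?_
  simp only [slotProj, outerSlot, Fin.lt_def]
  split_ifs <;> omega

theorem innerSlot_ne_outerSlot (t : Fin n) (k : Fin m) (hk : k ≠ i) :
    innerSlot h i t ≠ outerSlot h i k hk := fun e => hk (by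
  rw [← slotProj_outerSlot h i k hk, ← e, slotProj_innerSlot])

theorem outerSlot_inj {k l : Fin m} {hk : k ≠ i} {hl : l ≠ i} :
    outerSlot h i k hk = outerSlot h i l hl ↔ k = l := by
  refine ⟨fun e => ?_, fun e => by subst e; rfl⟩
  rw [← slotProj_outerSlot h i k hk, e, slotProj_outerSlot]

end Slots

section SlotIdentities

variable {l m n r s t : ℕ}

theorem innerSlot_innerSlot (h₁ : l + m = r + 1) (h₂ : r + n = s + 1) (h₃ : m + n = t + 1)
    (h₄ : l + t = s + 1) (i : Fin l) (j : Fin m) (c : Fin n) :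
    innerSlot h₂ (innerSlot h₁ i j) c = innerSlot h₄ i (innerSlot h₃ j c) :=
  Fin.ext (Nat.add_assoc _ _ _)

theorem outerSlot_innerSlot_innerSlot (h₁ : l + m = r + 1) (h₂ : r + n = s + 1)
    (h₃ : m + n = t + 1) (h₄ : l + t = s + 1) (i : Fin l) (j b : Fin m) (hb : b ≠ j) :
    outerSlot h₂ (innerSlot h₁ i j) (innerSlot h₁ i b) (fun e => hb (innerSlot_injective h₁ i e))
      = innerSlot h₄ i (outerSlot h₃ j b hb) := by
  have hb' : (b : ℕ) ≠ j := fun e => hb (Fin.ext e)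
  refine Fin.ext ?_
  simp only [innerSlot, outerSlot, Fin.lt_def]
  split_ifs <;> omega

theorem outerSlot_innerSlot_outerSlot (h₁ : l + m = r + 1) (h₂ : r + n = s + 1)
    (h₃ : m + n = t + 1) (h₄ : l + t = s + 1) (i : Fin l) (j : Fin m) (k : Fin l) (hk : k ≠ i) :
    outerSlot h₂ (innerSlot h₁ i j) (outerSlot h₁ i k hk) (innerSlot_ne_outerSlot h₁ i j k hk).symm
      = outerSlot h₄ i k hk := by
  have hk' : (k : ℕ) ≠ i := fun e => hk (Fin.ext e)
  refine Fin.ext ?_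
  simp only [innerSlot, outerSlot, Fin.lt_def]
  split_ifs <;> omega

theorem innerSlot_outerSlot (h₁ : l + m = r + 1) (h₂ : r + n = s + 1) (h₃ : l + n = t + 1)
    (h₄ : t + m = s + 1) (i k : Fin l) (hik : i ≠ k) (c : Fin n) :
    innerSlot h₂ (outerSlot h₁ i k hik.symm) c
      = outerSlot h₄ (outerSlot h₃ k i hik) (innerSlot h₃ k c)
          (innerSlot_ne_outerSlot h₃ k c i hik) := by
  have hik' : (i : ℕ) ≠ k := fun e => hik (Fin.ext e)
  refine Fin.ext ?_
  simp only [innerSlot, outerSlot, Fin.lt_def]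
  split_ifs <;> omega

theorem outerSlot_outerSlot (h₁ : l + m = r + 1) (h₂ : r + n = s + 1) (h₃ : l + n = t + 1)
    (h₄ : t + m = s + 1) (i k j : Fin l) (hik : i ≠ k) (hi : j ≠ i) (hk : j ≠ k) :
    outerSlot h₂ (outerSlot h₁ i k hik.symm) (outerSlot h₁ i j hi)
        (fun e => hk ((outerSlot_inj h₁ i).1 e))
      = outerSlot h₄ (outerSlot h₃ k i hik) (outerSlot h₃ k j hk)
        (fun e => hi ((outerSlot_inj h₃ k).1 e)) := by
  have h1 : (i : ℕ) ≠ k := fun e => hik (Fin.ext e)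
  have h2 : (j : ℕ) ≠ i := fun e => hi (Fin.ext e)
  have h3 : (j : ℕ) ≠ k := fun e => hk (Fin.ext e)
  refine Fin.ext ?_
  simp only [outerSlot, Fin.lt_def]
  split_ifs <;> omega

end SlotIdentities

/-- A strict linear order on the `p` slots of an operation of arity `p`. -/
@[ext]
structure SlotOrder (p : ℕ) where
  lt : Fin p → Fin p → Prop
  irrefl : ∀ x, ¬ lt x x
  trans : ∀ {x y z}, lt x y → lt y z → lt x z
  total : ∀ {x y}, x ≠ y → lt x y ∨ lt y x

namespace SlotOrder

theorem ext_lt {p : ℕ} {s t : SlotOrder p} (h : ∀ x y, s.lt x y ↔ t.lt x y) : s = t :=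
  SlotOrder.ext (funext fun x => funext fun y => propext (h x y))

instance {p : ℕ} : Finite (SlotOrder p) :=
  Finite.of_injective SlotOrder.lt fun _ _ h => SlotOrder.ext h

noncomputable instance {p : ℕ} : Fintype (SlotOrder p) := Fintype.ofFinite _

noncomputable instance {p : ℕ} : DecidableEq (SlotOrder p) := Classical.decEq _

/-- The usual order of the slots. -/
def std (p : ℕ) : SlotOrder p where
  lt x y := x < y
  irrefl x := lt_irrefl x
  trans := lt_trans
  total := lt_or_gt_of_ne

theorem eq_of_subsingleton {p : ℕ} [Subsingleton (Fin p)] (s t : SlotOrder p) : s = t :=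
  ext_lt fun x y => by
    rw [Subsingleton.elim x y]
    exact ⟨fun h => absurd h (s.irrefl y), fun h => absurd h (t.irrefl y)⟩

instance : Subsingleton (SlotOrder 0) := ⟨eq_of_subsingleton⟩
instance : Subsingleton (SlotOrder 1) := ⟨eq_of_subsingleton⟩

/-- The order `s ∘ᵢ t`, in which the slots of `t` are inserted at the place of the slot `i`
of `s`. -/
def comp {m n r : ℕ} (h : m + n = r + 1) (i : Fin m) (s : SlotOrder m) (t : SlotOrder n) :
    SlotOrder r where
  lt x y := s.lt (slotProj h i x) (slotProj h i y) ∨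
    ∃ a b, x = innerSlot h i a ∧ y = innerSlot h i b ∧ t.lt a b
  irrefl x := by
    rintro (h1 | ⟨a, b, rfl, h2, h3⟩)
    · exact s.irrefl _ h1
    · rw [innerSlot_injective h i h2] at h3
      exact t.irrefl _ h3
  trans {x y z} := by
    rintro (h1 | ⟨a, b, rfl, rfl, h1⟩) (h2 | ⟨c, d, h2, rfl, h3⟩)
    · exact Or.inl (s.trans h1 h2)
    · subst h2
      exact Or.inl (by simpa using h1)
    · exact Or.inl (by simpa using h2)
    · obtain rfl := innerSlot_injective h i h2
      exact Or.inr ⟨a, d, rfl, rfl, t.trans h1 h3⟩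
  total {x y} hxy := by
    rcases exists_eq_innerSlot_or_outerSlot h i x with ⟨a, rfl⟩ | ⟨k, hk, rfl⟩ <;>
    rcases exists_eq_innerSlot_or_outerSlot h i y with ⟨b, rfl⟩ | ⟨j, hj, rfl⟩
    · rcases t.total (x := a) (y := b) (fun e => hxy (by rw [e])) with h1 | h1
      · exact Or.inl (Or.inr ⟨a, b, rfl, rfl, h1⟩)
      · exact Or.inr (Or.inr ⟨b, a, rfl, rfl, h1⟩)
    · rcases s.total hj with h1 | h1
      · exact Or.inr (Or.inl (by simpa using h1))
      · exact Or.inl (Or.inl (by simpa using h1))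
    · rcases s.total hk with h1 | h1
      · exact Or.inl (Or.inl (by simpa using h1))
      · exact Or.inr (Or.inl (by simpa using h1))
    · rcases s.total (x := k) (y := j) (fun e => hxy (by subst e; rfl)) with h1 | h1
      · exact Or.inl (Or.inl (by simpa using h1))
      · exact Or.inr (Or.inl (by simpa using h1))

section

variable {m n r : ℕ} (h : m + n = r + 1) (i : Fin m) (s : SlotOrder m) (t : SlotOrder n)

@[simp] theorem comp_lt_inner_inner (a b : Fin n) :
    (comp h i s t).lt (innerSlot h i a) (innerSlot h i b) ↔ t.lt a b := by
  constructor
  · rintro (h1 | ⟨a', b', h1, h2, h3⟩)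
    · simp only [slotProj_innerSlot] at h1
      exact absurd h1 (s.irrefl _)
    · rwa [innerSlot_injective h i h1, innerSlot_injective h i h2]
  · exact fun h1 => Or.inr ⟨a, b, rfl, rfl, h1⟩

@[simp] theorem comp_lt_inner_outer (a : Fin n) (k : Fin m) (hk : k ≠ i) :
    (comp h i s t).lt (innerSlot h i a) (outerSlot h i k hk) ↔ s.lt i k := by
  constructor
  · rintro (h1 | ⟨a', b', h1, h2, h3⟩)
    · simpa using h1
    · exact absurd h2.symm (innerSlot_ne_outerSlot h i _ _ _)
  · exact fun h1 => Or.inl (by simpa using h1)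

@[simp] theorem comp_lt_outer_inner (k : Fin m) (hk : k ≠ i) (a : Fin n) :
    (comp h i s t).lt (outerSlot h i k hk) (innerSlot h i a) ↔ s.lt k i := by
  constructor
  · rintro (h1 | ⟨a', b', h1, h2, h3⟩)
    · simpa using h1
    · exact absurd h1.symm (innerSlot_ne_outerSlot h i _ _ _)
  · exact fun h1 => Or.inl (by simpa using h1)

@[simp] theorem comp_lt_outer_outer (k j : Fin m) (hk : k ≠ i) (hj : j ≠ i) :
    (comp h i s t).lt (outerSlot h i k hk) (outerSlot h i j hj) ↔ s.lt k j := by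
  constructor
  · rintro (h1 | ⟨a', b', h1, h2, h3⟩)
    · simpa using h1
    · exact absurd h1.symm (innerSlot_ne_outerSlot h i _ _ _)
  · exact fun h1 => Or.inl (by simpa using h1)

end

/-- The right action of permutations on orders: `σ` maps `s · σ` to `s`. -/
def act {p : ℕ} (σ : Equiv.Perm (Fin p)) (s : SlotOrder p) : SlotOrder p where
  lt x y := s.lt (σ x) (σ y)
  irrefl _ := s.irrefl _
  trans := s.trans
  total h := s.total fun e => h (σ.injective e)

@[simp] theorem act_lt {p : ℕ} (σ : Equiv.Perm (Fin p)) (s : SlotOrder p) (x y : Fin p) :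
    (s.act σ).lt x y ↔ s.lt (σ x) (σ y) := Iff.rfl

@[simp] theorem act_one {p : ℕ} (s : SlotOrder p) : s.act 1 = s := rfl

theorem act_mul {p : ℕ} (σ τ : Equiv.Perm (Fin p)) (s : SlotOrder p) :
    s.act (σ * τ) = (s.act σ).act τ := rfl

theorem comp_one {m : ℕ} (i : Fin m) (s : SlotOrder m) (t : SlotOrder 1) :
    comp (n := 1) rfl i s t = s := by
  have hin : ∀ a : Fin 1, innerSlot (n := 1) rfl i a = i := fun a => Fin.ext (by simp [innerSlot])
  have hout : ∀ (k : Fin m) (hk : k ≠ i), outerSlot (n := 1) rfl i k hk = k := fun k hk => by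
    have hk' : (k : ℕ) ≠ i := fun e => hk (Fin.ext e)
    refine Fin.ext ?_
    simp only [outerSlot, Fin.lt_def]
    split_ifs <;> omega
  refine ext_lt fun x y => ?_
  have key : ∀ z : Fin m, slotProj (n := 1) rfl i z = z := fun z => by
    rcases exists_eq_innerSlot_or_outerSlot (n := 1) rfl i z with ⟨a, h1⟩ | ⟨k, hk, h1⟩
    · rw [h1, slotProj_innerSlot, hin]
    · rw [h1, slotProj_outerSlot, hout]
  constructor
  · rintro (h1 | ⟨a, b, _, _, h1⟩)
    · rwa [key, key] at h1
    · rw [Subsingleton.elim a b] at h1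
      exact absurd h1 (t.irrefl _)
  · intro h1
    refine Or.inl ?_
    rwa [key, key]

theorem one_comp {n : ℕ} (h : 1 + n = n + 1) (s : SlotOrder 1) (t : SlotOrder n) :
    comp h 0 s t = t := by
  have hin : ∀ a : Fin n, innerSlot h 0 a = a := fun a => Fin.ext (by simp [innerSlot])
  refine ext_lt fun x y => ?_
  have := comp_lt_inner_inner h 0 s t x y
  rwa [hin, hin] at this

theorem comp_comp {l m n r s t : ℕ} (h₁ : l + m = r + 1) (h₂ : r + n = s + 1) (h₃ : m + n = t + 1)
    (h₄ : l + t = s + 1) (i : Fin l) (j : Fin m) (a : SlotOrder l) (b : SlotOrder m)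
    (c : SlotOrder n) :
    comp h₂ (innerSlot h₁ i j) (comp h₁ i a b) c = comp h₄ i a (comp h₃ j b c) := by
  have hs : ∀ x : Fin s, (∃ u, x = innerSlot h₂ (innerSlot h₁ i j) u ∧
        x = innerSlot h₄ i (innerSlot h₃ j u)) ∨
      (∃ (v : Fin m) (hv : v ≠ j), x = outerSlot h₂ (innerSlot h₁ i j) (innerSlot h₁ i v)
          (fun e => hv (innerSlot_injective h₁ i e)) ∧ x = innerSlot h₄ i (outerSlot h₃ j v hv)) ∨
      ∃ (k : Fin l) (hk : k ≠ i), x = outerSlot h₂ (innerSlot h₁ i j) (outerSlot h₁ i k hk)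
        (innerSlot_ne_outerSlot h₁ i j k hk).symm ∧ x = outerSlot h₄ i k hk := by
    intro x
    rcases exists_eq_innerSlot_or_outerSlot h₄ i x with ⟨y, rfl⟩ | ⟨k, hk, rfl⟩
    · rcases exists_eq_innerSlot_or_outerSlot h₃ j y with ⟨u, rfl⟩ | ⟨v, hv, rfl⟩
      · exact Or.inl ⟨u, (innerSlot_innerSlot h₁ h₂ h₃ h₄ i j u).symm, rfl⟩
      · exact Or.inr (Or.inl ⟨v, hv,
          (outerSlot_innerSlot_innerSlot h₁ h₂ h₃ h₄ i j v hv).symm, rfl⟩)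
    · exact Or.inr (Or.inr ⟨k, hk, (outerSlot_innerSlot_outerSlot h₁ h₂ h₃ h₄ i j k hk).symm, rfl⟩)
  refine ext_lt fun x y => ?_
  rcases hs x with ⟨u, hx, hx'⟩ | ⟨u, hu, hx, hx'⟩ | ⟨u, hu, hx, hx'⟩ <;>
  rcases hs y with ⟨v, hy, hy'⟩ | ⟨v, hv, hy, hy'⟩ | ⟨v, hv, hy, hy'⟩ <;>
  · conv_lhs => rw [hx, hy]
    conv_rhs => rw [hx', hy']
    simp

theorem comp_comm {l m n r s t : ℕ} (h₁ : l + m = r + 1) (h₂ : r + n = s + 1) (h₃ : l + n = t + 1)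
    (h₄ : t + m = s + 1) (i k : Fin l) (hik : i ≠ k) (a : SlotOrder l) (b : SlotOrder m)
    (c : SlotOrder n) :
    comp h₂ (outerSlot h₁ i k hik.symm) (comp h₁ i a b) c
      = comp h₄ (outerSlot h₃ k i hik) (comp h₃ k a c) b := by
  have hs : ∀ x : Fin s, (∃ u, x = innerSlot h₂ (outerSlot h₁ i k hik.symm) u ∧
        x = outerSlot h₄ (outerSlot h₃ k i hik) (innerSlot h₃ k u)
          (innerSlot_ne_outerSlot h₃ k u i hik)) ∨
      (∃ v, x = outerSlot h₂ (outerSlot h₁ i k hik.symm) (innerSlot h₁ i v)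
          (innerSlot_ne_outerSlot h₁ i v k hik.symm) ∧
        x = innerSlot h₄ (outerSlot h₃ k i hik) v) ∨
      ∃ (j : Fin l) (hi : j ≠ i) (hk : j ≠ k),
        x = outerSlot h₂ (outerSlot h₁ i k hik.symm) (outerSlot h₁ i j hi)
          (fun e => hk ((outerSlot_inj h₁ i).1 e)) ∧
        x = outerSlot h₄ (outerSlot h₃ k i hik) (outerSlot h₃ k j hk)
          (fun e => hi ((outerSlot_inj h₃ k).1 e)) := by
    intro x
    rcases exists_eq_innerSlot_or_outerSlot h₄ (outerSlot h₃ k i hik) x with ⟨v, rfl⟩ | ⟨y, hy, rfl⟩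
    · exact Or.inr (Or.inl ⟨v, (innerSlot_outerSlot h₃ h₄ h₁ h₂ k i hik.symm v), rfl⟩)
    · rcases exists_eq_innerSlot_or_outerSlot h₃ k y with ⟨u, rfl⟩ | ⟨j, hk, rfl⟩
      · exact Or.inl ⟨u, (innerSlot_outerSlot h₁ h₂ h₃ h₄ i k hik u).symm, rfl⟩
      · have hi : j ≠ i := fun e => hy (by subst e; rfl)
        exact Or.inr (Or.inr ⟨j, hi, hk,
          (outerSlot_outerSlot h₁ h₂ h₃ h₄ i k j hik hi hk).symm, rfl⟩)
  refine ext_lt fun x y => ?_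
  rcases hs x with ⟨u, hx, hx'⟩ | ⟨u, hx, hx'⟩ | ⟨u, hu, hu', hx, hx'⟩ <;>
  rcases hs y with ⟨v, hy, hy'⟩ | ⟨v, hy, hy'⟩ | ⟨v, hv, hv', hy, hy'⟩ <;>
  · conv_lhs => rw [hx, hy]
    conv_rhs => rw [hx', hy']
    simp

theorem comp_act {m n r : ℕ} (h : m + n = r + 1) (i : Fin m) (σ : Equiv.Perm (Fin m))
    (τ : Equiv.Perm (Fin n)) (ρ : Equiv.Perm (Fin r))
    (hout : ∀ (k : Fin m) (hk : k ≠ i),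
      ρ (outerSlot h i k hk) = outerSlot h (σ i) (σ k) (fun e => hk (σ.injective e)))
    (hin : ∀ t : Fin n, ρ (innerSlot h i t) = innerSlot h (σ i) (τ t))
    (a : SlotOrder m) (b : SlotOrder n) :
    comp h i (a.act σ) (b.act τ) = (comp h (σ i) a b).act ρ := by
  refine ext_lt fun x y => ?_
  rcases exists_eq_innerSlot_or_outerSlot h i x with ⟨u, rfl⟩ | ⟨u, hu, rfl⟩ <;>
  rcases exists_eq_innerSlot_or_outerSlot h i y with ⟨v, rfl⟩ | ⟨v, hv, rfl⟩ <;>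
  simp [hout, hin]

end SlotOrder

/-! ### Gradings -/

section Gradings

variable {R : Type u} [CommRing R]

/-- A family of submodules spanning the module is an internal grading as soon as there are
projections onto its members. -/
theorem isInternal_of_proj {M : Type*} [AddCommGroup M] [Module R M] (deg : ℤ → Submodule R M)
    (π : ℤ → M →ₗ[R] M) (h1 : ∀ q, ∀ x ∈ deg q, π q x = x)
    (h2 : ∀ q q', q' ≠ q → ∀ x ∈ deg q', π q x = 0) (h3 : ⨆ q, deg q = ⊤) :
    DirectSum.IsInternal deg := by
  refine (DirectSum.isInternal_submodule_iff_iSupIndep_and_iSup_eq_top _).2 ⟨fun q => ?_, h3⟩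
  refine Submodule.disjoint_def.2 fun x hx hx' => ?_
  have h : (⨆ (j : ℤ) (_ : j ≠ q), deg j) ≤ LinearMap.ker (π q) :=
    iSup₂_le fun j hj y hy => h2 q j hj y hy
  rw [← h1 q x hx]
  exact h hx'

namespace DGModule

/-- The projection of a differential graded module onto its component of degree `q`. -/
noncomputable def proj (M : DGModule R) (q : ℤ) : M →ₗ[R] M :=
  (M.deg q).subtype ∘ₗ DirectSum.component R ℤ (fun q => M.deg q) q ∘ₗ
    (M.decomp : M →ₗ[R] ⨁ q, M.deg q)

theorem proj_of_mem (M : DGModule R) {q : ℤ} {x : M} (hx : x ∈ M.deg q) : M.proj q x = x := by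
  simp only [proj, LinearMap.comp_apply, LinearEquiv.coe_coe, M.decomp_of_mem hx]
  rw [DirectSum.component.lof_self]
  rfl

theorem proj_of_mem_ne (M : DGModule R) {q q' : ℤ} (h : q' ≠ q) {x : M} (hx : x ∈ M.deg q') :
    M.proj q x = 0 := by
  simp only [proj, LinearMap.comp_apply, LinearEquiv.coe_coe, M.decomp_of_mem hx]
  rw [DirectSum.lof_eq_of, DirectSum.component, DFinsupp.lapply_apply,
    DirectSum.of_eq_of_ne _ _ _ h.symm, map_zero]

theorem proj_mem (M : DGModule R) (q : ℤ) (x : M) : M.proj q x ∈ M.deg q := Subtype.property _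

/-- Composition of morphisms of differential graded modules. -/
def Hom.comp {M N P : DGModule R} (g : Hom N P) (f : Hom M N) : Hom M P where
  toLin := g.toLin ∘ₗ f.toLin
  map_deg q x hx := g.map_deg q _ (f.map_deg q x hx)
  map_d x := by simp [f.map_d, g.map_d]

/-- The identity of a differential graded module. -/
def Hom.id (M : DGModule R) : Hom M M := ⟨LinearMap.id, fun _ _ h => h, fun _ => rfl⟩

end DGModule

theorem Operad.comp_par_par (O : Operad R) {m n r : ℕ} (h : m + n = r + 1) (i : Fin m)
    (a : O.obj m) (b : O.obj n) :
    O.comp h i ((O.obj m).par a) ((O.obj n).par b) = (O.obj r).par (O.comp h i a b) := by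
  have h1 : (O.comp h i).compl₁₂ (O.obj m).par (O.obj n).par
      = (O.comp h i).compr₂ (O.obj r).par := by
    refine DGModule.hom_ext fun p a ha => DGModule.hom_ext fun q b hb => ?_
    simp [DGModule.par_of_mem _ ha, DGModule.par_of_mem _ hb,
      DGModule.par_of_mem _ (O.comp_mem h i p q a b ha hb), sgn_add, smul_smul, mul_comm]
  exact LinearMap.congr_fun₂ h1 a b

/-- Composition of morphisms of operads. -/
def Operad.Hom.comp {O P Q : Operad R} (g : Operad.Hom P Q) (f : Operad.Hom O P) :
    Operad.Hom O Q where
  app n := (g.app n).comp (f.app n)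
  map_one := by simp [DGModule.Hom.comp, f.map_one, g.map_one]
  map_act σ a := by simp [DGModule.Hom.comp, f.map_act, g.map_act]
  map_comp h i a b := by simp [DGModule.Hom.comp, f.map_comp, g.map_comp]

end Gradings

/-! ### Convolution along the operad of orders -/

section Convolution

variable {R : Type u} [CommRing R]

/-- The functions on orders with values in the component of degree `q`. -/
def ordDeg (M : DGModule R) (p : ℕ) (q : ℤ) : Submodule R (SlotOrder p →₀ M) where
  carrier := {f | ∀ s, f s ∈ M.deg q}
  add_mem' hf hg s := Submodule.add_mem _ (hf s) (hg s)
  zero_mem' _ := Submodule.zero_mem _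
  smul_mem' c _ hf s := Submodule.smul_mem _ c (hf s)

theorem single_mem_ordDeg {M : DGModule R} {p : ℕ} {q : ℤ} (s : SlotOrder p) {a : M}
    (ha : a ∈ M.deg q) : Finsupp.single s a ∈ ordDeg M p q := fun t => by
  rw [Finsupp.single_apply]
  split_ifs
  · exact ha
  · exact Submodule.zero_mem _

theorem ordDeg_induction {M : DGModule R} {p : ℕ} {q : ℤ} {P : (SlotOrder p →₀ M) → Prop}
    (h0 : P 0) (hadd : ∀ f g, P f → P g → P (f + g))
    (hs : ∀ s, ∀ a ∈ M.deg q, P (Finsupp.single s a)) {f : SlotOrder p →₀ M}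
    (hf : f ∈ ordDeg M p q) : P f := by
  rw [← Finsupp.sum_single f]
  exact Finset.sum_induction _ P hadd h0 fun s _ => hs s _ (hf s)

theorem iSup_ordDeg (M : DGModule R) (p : ℕ) : ⨆ q, ordDeg M p q = ⊤ := by
  refine top_le_iff.1 fun f _ => ?_
  induction f using Finsupp.induction_linear with
  | zero => exact Submodule.zero_mem _
  | add f g hf hg =>
    exact Submodule.add_mem _ (hf Submodule.mem_top) (hg Submodule.mem_top)
  | single s a =>
    have h : ⨆ q, M.deg q ≤ (⨆ q, ordDeg M p q).comap (Finsupp.lsingle s) :=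
      iSup_le fun q a ha => Submodule.mem_iSup_of_mem q (single_mem_ordDeg s ha)
    rw [M.isInternal.submodule_iSup_eq_top] at h
    exact h (Submodule.mem_top (x := a))

/-- The map `f ↦ φ ∘ f`. -/
noncomputable abbrev ordMap {M N : Type u} [AddCommGroup M] [Module R M] [AddCommGroup N]
    [Module R N] (p : ℕ) (φ : M →ₗ[R] N) : (SlotOrder p →₀ M) →ₗ[R] (SlotOrder p →₀ N) :=
  Finsupp.mapRange.linearMap φ

/-- The sum of the values. -/
noncomputable def ordSum (M : Type u) [AddCommGroup M] [Module R M] (p : ℕ) :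
    (SlotOrder p →₀ M) →ₗ[R] M :=
  Finsupp.lsum R fun _ => LinearMap.id

@[simp] theorem ordSum_single {M : Type u} [AddCommGroup M] [Module R M] {p : ℕ} (s : SlotOrder p)
    (a : M) : ordSum (R := R) M p (Finsupp.single s a) = a := by
  simp [ordSum]

theorem ordSum_ordMap {M N : Type u} [AddCommGroup M] [Module R M] [AddCommGroup N]
    [Module R N] {p : ℕ} (φ : M →ₗ[R] N) (f : SlotOrder p →₀ M) :
    ordSum (R := R) N p (ordMap p φ f) = φ (ordSum (R := R) M p f) := by
  induction f using Finsupp.induction_linear with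
  | zero => simp
  | add f g hf hg => rw [map_add, map_add, map_add, map_add, hf, hg]
  | single s a => simp

theorem ordSum_mem {M : DGModule R} {p : ℕ} {q : ℤ} {f : SlotOrder p →₀ M}
    (hf : f ∈ ordDeg M p q) : ordSum (R := R) M p f ∈ M.deg q :=
  ordDeg_induction (P := fun f => ordSum (R := R) M p f ∈ M.deg q) (by simp)
    (fun f g hf hg => by rw [map_add]; exact Submodule.add_mem _ hf hg)
    (fun s a ha => by simpa using ha) hf

theorem ordMap_par_of_mem {M : DGModule R} {p : ℕ} {q : ℤ} {f : SlotOrder p →₀ M}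
    (hf : f ∈ ordDeg M p q) : ordMap p M.par f = sgn R q • f := by
  ext s
  simp [M.par_of_mem (hf s)]

theorem ordMap_par_par {M : DGModule R} {p : ℕ} (f : SlotOrder p →₀ M) :
    ordMap p M.par (ordMap p M.par f) = f := by
  ext s
  simp [M.par_par]

theorem ordMap_par_d {M : DGModule R} {p : ℕ} (f : SlotOrder p →₀ M) :
    ordMap p M.par (ordMap p M.d f) = -ordMap p M.d (ordMap p M.par f) := by
  ext s
  simp [M.par_d]

theorem ordMap_d_d {M : DGModule R} {p : ℕ} (f : SlotOrder p →₀ M) :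
    ordMap p M.d (ordMap p M.d f) = 0 := by
  ext s
  simp [M.d_d]

theorem ordMap_d_mem {M : DGModule R} {p : ℕ} {q : ℤ} {f : SlotOrder p →₀ M}
    (hf : f ∈ ordDeg M p q) : ordMap p M.d f ∈ ordDeg M p (q + 1) := fun s => by
  simpa using M.d_mem _ _ (hf s)

theorem ordMap_par_mem {M : DGModule R} {p : ℕ} {q : ℤ} {f : SlotOrder p →₀ M}
    (hf : f ∈ ordDeg M p q) : ordMap p M.par f ∈ ordDeg M p q := fun s => by
  simpa using M.par_mem (hf s)

variable (O : Operad R)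

/-- The convolution of the composition `∘ᵢ` of `O` with the composition of orders. -/
noncomputable def conv {m n r : ℕ} (h : m + n = r + 1) (i : Fin m) :
    (SlotOrder m →₀ O.obj m) →ₗ[R] (SlotOrder n →₀ O.obj n) →ₗ[R] (SlotOrder r →₀ O.obj r) :=
  Finsupp.lsum R fun s => LinearMap.flip (Finsupp.lsum R fun t =>
    LinearMap.flip ((O.comp h i).compr₂ (Finsupp.lsingle (s.comp h i t))))

@[simp] theorem conv_single {m n r : ℕ} (h : m + n = r + 1) (i : Fin m) (s : SlotOrder m)
    (t : SlotOrder n) (a : O.obj m) (b : O.obj n) :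
    conv O h i (Finsupp.single s a) (Finsupp.single t b)
      = Finsupp.single (s.comp h i t) (O.comp h i a b) := by
  simp [conv]

/-- The action of a permutation on functions on orders. -/
noncomputable def ordAct {n : ℕ} (σ : Equiv.Perm (Fin n)) :
    (SlotOrder n →₀ O.obj n) →ₗ[R] (SlotOrder n →₀ O.obj n) :=
  ordMap n (O.act σ).toLin ∘ₗ Finsupp.lmapDomain (O.obj n) R (SlotOrder.act σ)

@[simp] theorem ordAct_single {n : ℕ} (σ : Equiv.Perm (Fin n)) (s : SlotOrder n) (a : O.obj n) :
    ordAct O σ (Finsupp.single s a) = Finsupp.single (s.act σ) ((O.act σ).toLin a) := by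
  simp [ordAct]

variable {O}

theorem ordSum_conv {m n r : ℕ} (h : m + n = r + 1) (i : Fin m) (f : SlotOrder m →₀ O.obj m)
    (g : SlotOrder n →₀ O.obj n) :
    ordSum (R := R) (O.obj r) r (conv O h i f g)
      = O.comp h i (ordSum (R := R) _ _ f) (ordSum (R := R) _ _ g) := by
  induction f using Finsupp.induction_linear with
  | zero => simp
  | add f f' hf hf' => simp only [map_add, LinearMap.add_apply, hf, hf']
  | single s a =>
    induction g using Finsupp.induction_linear with
    | zero => simp
    | add g g' hg hg' => simp only [map_add, hg, hg']
    | single t b => simp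

theorem ordSum_ordAct {n : ℕ} (σ : Equiv.Perm (Fin n)) (f : SlotOrder n →₀ O.obj n) :
    ordSum (R := R) (O.obj n) n (ordAct O σ f) = (O.act σ).toLin (ordSum (R := R) _ _ f) := by
  induction f using Finsupp.induction_linear with
  | zero => simp
  | add f f' hf hf' => simp only [map_add, hf, hf']
  | single s a => simp

theorem conv_par_par {m n r : ℕ} (h : m + n = r + 1) (i : Fin m) (f : SlotOrder m →₀ O.obj m)
    (g : SlotOrder n →₀ O.obj n) :
    conv O h i (ordMap m (O.obj m).par f) (ordMap n (O.obj n).par g)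
      = ordMap r (O.obj r).par (conv O h i f g) := by
  induction f using Finsupp.induction_linear with
  | zero => simp
  | add f f' hf hf' => simp only [map_add, LinearMap.add_apply, hf, hf']
  | single s a =>
    induction g using Finsupp.induction_linear with
    | zero => simp
    | add g g' hg hg' => simp only [map_add, hg, hg']
    | single t b => simp [O.comp_par_par]

theorem conv_mem {m n r : ℕ} (h : m + n = r + 1) (i : Fin m) {p q : ℤ}
    {f : SlotOrder m →₀ O.obj m} {g : SlotOrder n →₀ O.obj n} (hf : f ∈ ordDeg _ _ p)
    (hg : g ∈ ordDeg _ _ q) : conv O h i f g ∈ ordDeg (O.obj r) r (p + q) := by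
  refine ordDeg_induction (P := fun f => conv O h i f g ∈ ordDeg (O.obj r) r (p + q)) (by simp)
    (fun f f' hf hf' => by
      rw [map_add, LinearMap.add_apply]; exact Submodule.add_mem _ hf hf') (fun s a ha => ?_) hf
  refine ordDeg_induction (P := fun g => conv O h i _ g ∈ ordDeg (O.obj r) r (p + q)) (by simp)
    (fun f f' hf hf' => by
      rw [map_add]; exact Submodule.add_mem _ hf hf') (fun t b hb => ?_) hg
  rw [conv_single]
  exact single_mem_ordDeg _ (O.comp_mem h i p q a b ha hb)

theorem conv_d {m n r : ℕ} (h : m + n = r + 1) (i : Fin m) {p : ℤ}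
    {f : SlotOrder m →₀ O.obj m} (hf : f ∈ ordDeg _ _ p) (g : SlotOrder n →₀ O.obj n) :
    ordMap r (O.obj r).d (conv O h i f g) = conv O h i (ordMap m (O.obj m).d f) g
      + sgn R p • conv O h i f (ordMap n (O.obj n).d g) := by
  refine ordDeg_induction (P := fun f => ordMap r (O.obj r).d (conv O h i f g)
    = conv O h i (ordMap m (O.obj m).d f) g + sgn R p • conv O h i f (ordMap n (O.obj n).d g))
    (by simp) (fun f f' hf hf' => by
      simp only [map_add, LinearMap.add_apply, hf, hf', smul_add]; abel) (fun s a ha => ?_) hf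
  induction g using Finsupp.induction_linear with
  | zero => simp
  | add g g' hg hg' => simp only [map_add, hg, hg', smul_add]; abel
  | single t b => simp [O.d_comp h i p a b ha]

theorem conv_conv {l m n r s t : ℕ} (h₁ : l + m = r + 1) (h₂ : r + n = s + 1)
    (h₃ : m + n = t + 1) (h₄ : l + t = s + 1) (i : Fin l) (j : Fin m) (a : SlotOrder l →₀ O.obj l)
    (b : SlotOrder m →₀ O.obj m) (c : SlotOrder n →₀ O.obj n) :
    conv O h₂ (innerSlot h₁ i j) (conv O h₁ i a b) c = conv O h₄ i a (conv O h₃ j b c) := by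
  induction a using Finsupp.induction_linear with
  | zero => simp
  | add f f' hf hf' => simp only [map_add, LinearMap.add_apply, hf, hf']
  | single x a =>
    induction b using Finsupp.induction_linear with
    | zero => simp
    | add f f' hf hf' => simp only [map_add, LinearMap.add_apply, hf, hf']
    | single y b =>
      induction c using Finsupp.induction_linear with
      | zero => simp
      | add f f' hf hf' => simp only [map_add, hf, hf']
      | single z c =>
        simp only [conv_single]
        rw [O.comp_comp h₁ h₂ h₃ h₄, SlotOrder.comp_comp h₁ h₂ h₃ h₄]

theorem conv_comm {l m n r s t : ℕ} (h₁ : l + m = r + 1) (h₂ : r + n = s + 1)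
    (h₃ : l + n = t + 1) (h₄ : t + m = s + 1) (i k : Fin l) (hik : i ≠ k) {p q : ℤ}
    (a : SlotOrder l →₀ O.obj l) {b : SlotOrder m →₀ O.obj m} {c : SlotOrder n →₀ O.obj n}
    (hb : b ∈ ordDeg _ _ p) (hc : c ∈ ordDeg _ _ q) :
    conv O h₂ (outerSlot h₁ i k hik.symm) (conv O h₁ i a b) c
      = sgn R (p * q) • conv O h₄ (outerSlot h₃ k i hik) (conv O h₃ k a c) b := by
  induction a using Finsupp.induction_linear with
  | zero => simp
  | add f f' hf hf' => simp only [map_add, LinearMap.add_apply, hf, hf', smul_add]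
  | single x a =>
    refine ordDeg_induction (P := fun b => conv O h₂ _ (conv O h₁ i _ b) c
        = sgn R (p * q) • conv O h₄ (outerSlot h₃ k i hik) (conv O h₃ k _ c) b) (by simp)
      (fun f f' hf hf' => by simp only [map_add, LinearMap.add_apply, hf, hf', smul_add])
      (fun y b hb => ?_) hb
    refine ordDeg_induction (P := fun c => conv O h₂ _ (conv O h₁ i _ _) c
        = sgn R (p * q) • conv O h₄ (outerSlot h₃ k i hik) (conv O h₃ k _ c) _) (by simp)
      (fun f f' hf hf' => by simp only [map_add, LinearMap.add_apply, hf, hf', smul_add])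
      (fun z c hc => ?_) hc
    simp only [conv_single, Finsupp.smul_single]
    rw [O.comp_comm h₁ h₂ h₃ h₄ i k hik p q a b c hb hc,
      SlotOrder.comp_comm h₁ h₂ h₃ h₄ i k hik]

theorem conv_act {m n r : ℕ} (h : m + n = r + 1) (i : Fin m) (σ : Equiv.Perm (Fin m))
    (τ : Equiv.Perm (Fin n)) (ρ : Equiv.Perm (Fin r))
    (hout : ∀ (k : Fin m) (hk : k ≠ i),
      ρ (outerSlot h i k hk) = outerSlot h (σ i) (σ k) (fun e => hk (σ.injective e)))
    (hin : ∀ t : Fin n, ρ (innerSlot h i t) = innerSlot h (σ i) (τ t))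
    (a : SlotOrder m →₀ O.obj m) (b : SlotOrder n →₀ O.obj n) :
    conv O h i (ordAct O σ a) (ordAct O τ b) = ordAct O ρ (conv O h (σ i) a b) := by
  induction a using Finsupp.induction_linear with
  | zero => simp
  | add f f' hf hf' => simp only [map_add, LinearMap.add_apply, hf, hf']
  | single x a =>
    induction b using Finsupp.induction_linear with
    | zero => simp
    | add f f' hf hf' => simp only [map_add, hf, hf']
    | single y b =>
      simp only [conv_single, ordAct_single]
      rw [O.comp_act h i σ τ ρ hout hin, SlotOrder.comp_act h i σ τ ρ hout hin]

theorem conv_one {m : ℕ} (i : Fin m) (a : SlotOrder m →₀ O.obj m) (t : SlotOrder 1) :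
    conv O (n := 1) rfl i a (Finsupp.single t O.one) = a := by
  induction a using Finsupp.induction_linear with
  | zero => simp
  | add f f' hf hf' => simp only [map_add, LinearMap.add_apply, hf, hf']
  | single x a => rw [conv_single, O.comp_one, SlotOrder.comp_one]

theorem one_conv {n : ℕ} (h : 1 + n = n + 1) (s : SlotOrder 1) (b : SlotOrder n →₀ O.obj n) :
    conv O h 0 (Finsupp.single s O.one) b = b := by
  induction b using Finsupp.induction_linear with
  | zero => simp
  | add f f' hf hf' => simp only [map_add, hf, hf']
  | single x a => rw [conv_single, O.one_comp, SlotOrder.one_comp]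

theorem ordAct_comm {n : ℕ} (σ : Equiv.Perm (Fin n)) (φ : O.obj n →ₗ[R] O.obj n)
    (hφ : ∀ a, φ ((O.act σ).toLin a) = (O.act σ).toLin (φ a)) (f : SlotOrder n →₀ O.obj n) :
    ordMap n φ (ordAct O σ f) = ordAct O σ (ordMap n φ f) := by
  induction f using Finsupp.induction_linear with
  | zero => simp
  | add f f' hf hf' => simp only [map_add, hf, hf']
  | single x a => simp [hφ]

theorem ordAct_mem {n : ℕ} (σ : Equiv.Perm (Fin n)) {q : ℤ} {f : SlotOrder n →₀ O.obj n}
    (hf : f ∈ ordDeg _ _ q) : ordAct O σ f ∈ ordDeg _ _ q := by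
  refine ordDeg_induction (P := fun f => ordAct O σ f ∈ ordDeg _ _ q) (by simp)
    (fun f f' hf hf' => by rw [map_add]; exact Submodule.add_mem _ hf hf') (fun s a ha => ?_) hf
  rw [ordAct_single]
  exact single_mem_ordDeg _ ((O.act σ).map_deg _ _ ha)

theorem ordAct_one {n : ℕ} (f : SlotOrder n →₀ O.obj n) : ordAct O 1 f = f := by
  induction f using Finsupp.induction_linear with
  | zero => simp
  | add f f' hf hf' => simp only [map_add, hf, hf']
  | single x a => simp [O.act_one]

theorem ordAct_mul {n : ℕ} (σ τ : Equiv.Perm (Fin n)) (f : SlotOrder n →₀ O.obj n) :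
    ordAct O (σ * τ) f = ordAct O τ (ordAct O σ f) := by
  induction f using Finsupp.induction_linear with
  | zero => simp
  | add f f' hf hf' => simp only [map_add, hf, hf']
  | single x a => simp [O.act_mul, SlotOrder.act_mul]

end Convolution

/-! ### The resolution of an operad by orders -/

section Resolution

variable {R : Type u} [CommRing R]

/-- The pairs `(α, β)` of functions on the orders of `p` slots such that the values of `β` have
sum zero. -/
abbrev ResCarrier (M : DGModule R) (p : ℕ) : Type u :=
  LinearMap.ker (ordSum (R := R) M p ∘ₗ
    LinearMap.snd R (SlotOrder p →₀ M) (SlotOrder p →₀ M))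

/-- The function `α` of a pair `(α, β)`. -/
noncomputable def resFst (M : DGModule R) (p : ℕ) : ResCarrier M p →ₗ[R] (SlotOrder p →₀ M) :=
  LinearMap.fst R _ _ ∘ₗ Submodule.subtype _

/-- The function `β` of a pair `(α, β)`. -/
noncomputable def resSnd (M : DGModule R) (p : ℕ) : ResCarrier M p →ₗ[R] (SlotOrder p →₀ M) :=
  LinearMap.snd R _ _ ∘ₗ Submodule.subtype _

/-- The pair `(α, β)`. -/
def resMk {M : DGModule R} {p : ℕ} (f g : SlotOrder p →₀ M) (h : ordSum (R := R) M p g = 0) :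
    ResCarrier M p := ⟨(f, g), h⟩

@[simp] theorem resFst_mk {M : DGModule R} {p : ℕ} (f g : SlotOrder p →₀ M)
    (h : ordSum (R := R) M p g = 0) : resFst M p (resMk f g h) = f := rfl

@[simp] theorem resSnd_mk {M : DGModule R} {p : ℕ} (f g : SlotOrder p →₀ M)
    (h : ordSum (R := R) M p g = 0) : resSnd M p (resMk f g h) = g := rfl

theorem ordSum_resSnd {M : DGModule R} {p : ℕ} (x : ResCarrier M p) :
    ordSum (R := R) M p (resSnd M p x) = 0 := x.2

theorem ResCarrier.ext {M : DGModule R} {p : ℕ} {x y : ResCarrier M p}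
    (h1 : resFst M p x = resFst M p y) (h2 : resSnd M p x = resSnd M p y) : x = y :=
  Subtype.ext (Prod.ext h1 h2)

/-- The component of degree `q`: `β` is shifted by one. -/
noncomputable def resDeg (M : DGModule R) (p : ℕ) (q : ℤ) : Submodule R (ResCarrier M p) :=
  (ordDeg M p q).comap (resFst M p) ⊓ (ordDeg M p (q + 1)).comap (resSnd M p)

theorem mem_resDeg {M : DGModule R} {p : ℕ} {q : ℤ} {x : ResCarrier M p} :
    x ∈ resDeg M p q ↔ resFst M p x ∈ ordDeg M p q ∧ resSnd M p x ∈ ordDeg M p (q + 1) := Iff.rfl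

theorem resDeg_isInternal (M : DGModule R) (p : ℕ) : DirectSum.IsInternal (resDeg M p) := by
  have hπ : ∀ q, ∀ x : ResCarrier M p, LinearMap.prodMap (ordMap p (M.proj q))
      (ordMap p (M.proj (q + 1))) x.1 ∈ LinearMap.ker (ordSum (R := R) M p ∘ₗ
        LinearMap.snd R (SlotOrder p →₀ M) (SlotOrder p →₀ M)) := fun q x => by
    change ordSum (R := R) M p (ordMap p (M.proj (q + 1)) (resSnd _ _ x)) = 0
    rw [ordSum_ordMap, ordSum_resSnd x, map_zero]
  refine isInternal_of_proj (resDeg M p)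
    (fun q => LinearMap.restrict (LinearMap.prodMap (ordMap p (M.proj q))
      (ordMap p (M.proj (q + 1)))) fun x hx => hπ q ⟨x, hx⟩) ?_ ?_ ?_
  · intro q x hx
    refine ResCarrier.ext (Finsupp.ext fun s => ?_) (Finsupp.ext fun s => ?_)
    · exact M.proj_of_mem (hx.1 s)
    · exact M.proj_of_mem (hx.2 s)
  · intro q q' hq x hx
    refine ResCarrier.ext (Finsupp.ext fun s => ?_) (Finsupp.ext fun s => ?_)
    · exact M.proj_of_mem_ne hq (hx.1 s)
    · exact M.proj_of_mem_ne (fun h => hq (by omega)) (hx.2 s)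
  · -- `β` equals its own correction `β - single s₀ (∑ β)`, which is defined for every function
    let A : (SlotOrder p →₀ M) →ₗ[R] ResCarrier M p :=
      LinearMap.codRestrict _ (LinearMap.inl R _ _) fun f => by simp
    let B : (SlotOrder p →₀ M) →ₗ[R] ResCarrier M p :=
      LinearMap.codRestrict _ (LinearMap.inr R _ _ ∘ₗ
        (LinearMap.id - Finsupp.lsingle (SlotOrder.std p) ∘ₗ ordSum (R := R) M p)) fun f => by simp
    have hA : (⊤ : Submodule R (SlotOrder p →₀ M)) ≤ (⨆ q, resDeg M p q).comap A := by
      rw [← iSup_ordDeg]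
      exact iSup_le fun q f hf => Submodule.mem_iSup_of_mem q
        (mem_resDeg.2 ⟨hf, Submodule.zero_mem (ordDeg M p (q + 1))⟩)
    have hB : (⊤ : Submodule R (SlotOrder p →₀ M)) ≤ (⨆ q, resDeg M p q).comap B := by
      rw [← iSup_ordDeg]
      refine iSup_le fun q f hf => Submodule.mem_iSup_of_mem (q - 1)
        (mem_resDeg.2 ⟨Submodule.zero_mem (ordDeg M p (q - 1)), ?_⟩)
      rw [sub_add_cancel]
      exact Submodule.sub_mem _ hf (single_mem_ordDeg _ (ordSum_mem hf))
    refine top_le_iff.1 fun x _ => ?_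
    have hx : x = A (resFst _ _ x) + B (resSnd _ _ x) := by
      refine ResCarrier.ext ?_ ?_
      · change (resFst _ _ x) = (resFst _ _ x) + 0
        rw [add_zero]
      · change (resSnd _ _ x)
          = 0 + ((resSnd _ _ x) - Finsupp.single _ (ordSum (R := R) M p (resSnd _ _ x)))
        rw [ordSum_resSnd x, Finsupp.single_zero, sub_zero, zero_add]
    rw [hx]
    exact Submodule.add_mem _ (hA Submodule.mem_top) (hB Submodule.mem_top)

/-- The differential `(α, β) ↦ (d α ± β, d β)`. -/
noncomputable def resD (M : DGModule R) (p : ℕ) : ResCarrier M p →ₗ[R] ResCarrier M p :=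
  LinearMap.codRestrict _ (LinearMap.prod
    (ordMap p M.d ∘ₗ resFst M p + ordMap p M.par ∘ₗ resSnd M p)
    (ordMap p M.d ∘ₗ resSnd M p)) fun x => by
    change ordSum (R := R) M p (ordMap p M.d (resSnd _ _ x)) = 0
    rw [ordSum_ordMap, ordSum_resSnd x, map_zero]

theorem resD_fst {M : DGModule R} {p : ℕ} (x : ResCarrier M p) :
    resFst M p (resD M p x) = ordMap p M.d (resFst _ _ x) + ordMap p M.par (resSnd _ _ x) := rfl

theorem resD_snd {M : DGModule R} {p : ℕ} (x : ResCarrier M p) :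
    resSnd M p (resD M p x) = ordMap p M.d (resSnd _ _ x) := rfl

/-- The tensor product of `M` with the complex `I → R[S]`, where `S` is the set of orders of `p`
slots and `I` is the kernel of the augmentation of `R[S]`, placed in degree `-1`. -/
noncomputable def resModule (M : DGModule R) (p : ℕ) : DGModule R where
  carrier := ResCarrier M p
  deg := resDeg M p
  isInternal := resDeg_isInternal M p
  d := resD M p
  d_mem q x hx := ⟨Submodule.add_mem _ (ordMap_d_mem hx.1) (ordMap_par_mem hx.2),
    ordMap_d_mem hx.2⟩
  d_d x := by
    refine ResCarrier.ext ?_ ?_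
    · rw [resD_fst, resD_fst, resD_snd, map_add, ordMap_d_d, ordMap_par_d, zero_add,
        add_neg_cancel, map_zero]
    · rw [resD_snd, resD_snd, ordMap_d_d, map_zero]

variable (O : Operad R)

/-- The action of a permutation on pairs of functions. -/
noncomputable def resActLin {n : ℕ} (σ : Equiv.Perm (Fin n)) :
    ResCarrier (O.obj n) n →ₗ[R] ResCarrier (O.obj n) n :=
  LinearMap.codRestrict _ (LinearMap.prod (ordAct O σ ∘ₗ resFst _ _) (ordAct O σ ∘ₗ resSnd _ _))
    fun x => by
      change ordSum (R := R) _ _ (ordAct O σ (resSnd _ _ x)) = 0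
      rw [ordSum_ordAct, ordSum_resSnd, map_zero]

theorem resActLin_resD {n : ℕ} (σ : Equiv.Perm (Fin n)) (x : ResCarrier (O.obj n) n) :
    resActLin O σ (resD _ n x) = resD _ n (resActLin O σ x) := by
  refine ResCarrier.ext ?_ ?_
  · change ordAct O σ (ordMap n (O.obj n).d (resFst _ _ x) + ordMap n (O.obj n).par (resSnd _ _ x))
      = ordMap n (O.obj n).d (ordAct O σ (resFst _ _ x))
        + ordMap n (O.obj n).par (ordAct O σ (resSnd _ _ x))
    rw [map_add, ordAct_comm σ _ fun a => ((O.act σ).map_d a).symm,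
      ordAct_comm σ _ fun a => ((O.act σ).map_par a).symm]
  · exact (ordAct_comm σ _ (fun a => ((O.act σ).map_d a).symm) _).symm

/-- The action of a permutation on the resolution. -/
noncomputable def resAct {n : ℕ} (σ : Equiv.Perm (Fin n)) :
    DGModule.Hom (resModule (O.obj n) n) (resModule (O.obj n) n) where
  toLin := resActLin O σ
  map_deg _ _ hx := ⟨ordAct_mem σ hx.1, ordAct_mem σ hx.2⟩
  map_d x := resActLin_resD O σ x

/-- The partial composition
`(α, β) ∘ᵢ (α', β') = (α * α', α * β' ± β * α')` of the resolution. -/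
noncomputable def resComp {m n r : ℕ} (h : m + n = r + 1) (i : Fin m) :
    ResCarrier (O.obj m) m →ₗ[R] ResCarrier (O.obj n) n →ₗ[R] ResCarrier (O.obj r) r :=
  LinearMap.mk₂ R (fun x y => resMk (conv O h i (resFst _ _ x) (resFst _ _ y))
      (conv O h i (resFst _ _ x) (resSnd _ _ y)
        + conv O h i (resSnd _ _ x) (ordMap n (O.obj n).par (resFst _ _ y))) (by
      rw [map_add, ordSum_conv, ordSum_conv, ordSum_resSnd x, ordSum_resSnd y]
      simp))
    (fun x x' y => ResCarrier.ext (by simp) (by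
      simp only [resSnd_mk, map_add, LinearMap.add_apply]
      abel))
    (fun c x y => ResCarrier.ext (by simp) (by
      simp only [resSnd_mk, map_smul, LinearMap.smul_apply, smul_add]))
    (fun x y y' => ResCarrier.ext (by simp) (by
      simp only [resSnd_mk, map_add]
      abel))
    (fun c x y => ResCarrier.ext (by simp) (by
      simp only [resSnd_mk, map_smul, smul_add]))

variable {O}

theorem resComp_mem {m n r : ℕ} (h : m + n = r + 1) (i : Fin m) (p q : ℤ)
    (x : ResCarrier (O.obj m) m) (y : ResCarrier (O.obj n) n) (hx : x ∈ resDeg _ _ p)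
    (hy : y ∈ resDeg _ _ q) : resComp O h i x y ∈ resDeg _ _ (p + q) := by
  refine ⟨conv_mem h i hx.1 hy.1, Submodule.add_mem (ordDeg _ _ (p + q + 1)) ?_ ?_⟩
  · rw [add_assoc]
    exact conv_mem h i hx.1 hy.2
  · rw [add_right_comm]
    exact conv_mem h i hx.2 (ordMap_par_mem hy.1)

theorem resD_resComp {m n r : ℕ} (h : m + n = r + 1) (i : Fin m) (p : ℤ)
    (x : ResCarrier (O.obj m) m) (y : ResCarrier (O.obj n) n) (hx : x ∈ resDeg _ _ p) :
    resD _ r (resComp O h i x y)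
      = resComp O h i (resD _ m x) y + sgn R p • resComp O h i x (resD _ n y) := by
  have hpar1 := ordMap_par_of_mem hx.1
  have hpar2 := ordMap_par_of_mem hx.2
  refine ResCarrier.ext ?_ ?_
  · change ordMap r (O.obj r).d (conv O h i (resFst _ _ x) (resFst _ _ y)) + ordMap r (O.obj r).par
        (conv O h i (resFst _ _ x) (resSnd _ _ y)
          + conv O h i (resSnd _ _ x) (ordMap n (O.obj n).par (resFst _ _ y)))
      = conv O h i (ordMap m (O.obj m).d (resFst _ _ x) + ordMap m (O.obj m).par (resSnd _ _ x))
          (resFst _ _ y)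
        + sgn R p • conv O h i (resFst _ _ x)
          (ordMap n (O.obj n).d (resFst _ _ y) + ordMap n (O.obj n).par (resSnd _ _ y))
    rw [conv_d h i hx.1, map_add, ← conv_par_par, ← conv_par_par, ordMap_par_par, hpar1]
    simp only [map_add, map_smul, LinearMap.add_apply, LinearMap.smul_apply, smul_add]
    abel
  · change ordMap r (O.obj r).d (conv O h i (resFst _ _ x) (resSnd _ _ y)
          + conv O h i (resSnd _ _ x) (ordMap n (O.obj n).par (resFst _ _ y)))
      = conv O h i (ordMap m (O.obj m).d (resFst _ _ x) + ordMap m (O.obj m).par (resSnd _ _ x))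
            (resSnd _ _ y)
          + conv O h i (ordMap m (O.obj m).d (resSnd _ _ x)) (ordMap n (O.obj n).par (resFst _ _ y))
        + sgn R p • (conv O h i (resFst _ _ x) (ordMap n (O.obj n).d (resSnd _ _ y))
          + conv O h i (resSnd _ _ x) (ordMap n (O.obj n).par
              (ordMap n (O.obj n).d (resFst _ _ y) + ordMap n (O.obj n).par (resSnd _ _ y))))
    rw [map_add, conv_d h i hx.1, conv_d h i hx.2, hpar2]
    simp only [map_add, map_smul, LinearMap.add_apply, LinearMap.smul_apply]
    simp only [smul_add,
      ordMap_par_par, ordMap_par_d, map_neg, sgn_add, sgn_one, mul_neg, mul_one, neg_smul, smul_neg]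
    abel

theorem resComp_comm {l m n r s t : ℕ} (h₁ : l + m = r + 1) (h₂ : r + n = s + 1)
    (h₃ : l + n = t + 1) (h₄ : t + m = s + 1) (i k : Fin l) (hik : i ≠ k) (p q : ℤ)
    (a : ResCarrier (O.obj l) l) (b : ResCarrier (O.obj m) m) (c : ResCarrier (O.obj n) n)
    (hb : b ∈ resDeg _ _ p) (hc : c ∈ resDeg _ _ q) :
    resComp O h₂ (outerSlot h₁ i k hik.symm) (resComp O h₁ i a b) c
      = sgn R (p * q) • resComp O h₄ (outerSlot h₃ k i hik) (resComp O h₃ k a c) b := by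
  have hq : sgn R (p * (q + 1)) = sgn R (p * q) * sgn R p := by rw [mul_add, mul_one, sgn_add]
  have hp : sgn R q * sgn R ((p + 1) * q) = sgn R (p * q) := by
    rw [← sgn_add, show q + (p + 1) * q = p * q + (q + q) by ring, sgn_add, sgn_add, sgn_mul_self,
      mul_one]
  refine ResCarrier.ext ?_ ?_
  · exact conv_comm h₁ h₂ h₃ h₄ i k hik _ hb.1 hc.1
  · have e1 := conv_comm h₁ h₂ h₃ h₄ i k hik (resFst _ _ a) hb.1 hc.2
    have e2 := conv_comm h₁ h₂ h₃ h₄ i k hik (resFst _ _ a) hb.2 hc.1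
    have e3 := conv_comm h₁ h₂ h₃ h₄ i k hik (resSnd _ _ a) hb.1 hc.1
    change conv O h₂ _ (conv O h₁ i (resFst _ _ a) (resFst _ _ b)) (resSnd _ _ c)
        + conv O h₂ _ (conv O h₁ i (resFst _ _ a) (resSnd _ _ b)
            + conv O h₁ i (resSnd _ _ a) (ordMap m (O.obj m).par (resFst _ _ b)))
          (ordMap n (O.obj n).par (resFst _ _ c))
      = sgn R (p * q) • (conv O h₄ _ (conv O h₃ k (resFst _ _ a) (resFst _ _ c)) (resSnd _ _ b)
        + conv O h₄ _ (conv O h₃ k (resFst _ _ a) (resSnd _ _ c)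
            + conv O h₃ k (resSnd _ _ a) (ordMap n (O.obj n).par (resFst _ _ c)))
          (ordMap m (O.obj m).par (resFst _ _ b)))
    rw [ordMap_par_of_mem hb.1, ordMap_par_of_mem hc.1]
    simp only [map_add, map_smul, LinearMap.add_apply, LinearMap.smul_apply, smul_add, e1, e2, e3,
      smul_smul, hq, hp]
    rw [show sgn R q * (sgn R p * sgn R (p * q)) = sgn R (p * q) * (sgn R p * sgn R q) by ring]
    abel

variable (O)

/-- The operad `O ⊗ E`, where `E(p)` is the complex `I → R[S]` of `resModule`. The augmentation of
`E` is a homotopy equivalence in each arity, and `E` is zero in degree `-1` in the arities `0`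
and `1`. -/
noncomputable def resOperad : Operad R where
  obj n := resModule (O.obj n) n
  act σ := resAct O σ
  act_one x := ResCarrier.ext (ordAct_one _) (ordAct_one _)
  act_mul σ τ x := ResCarrier.ext (ordAct_mul σ τ _) (ordAct_mul σ τ _)
  one := resMk (M := O.obj 1) (Finsupp.single (SlotOrder.std 1) O.one) 0 (map_zero _)
  one_mem := ⟨single_mem_ordDeg _ O.one_mem, Submodule.zero_mem (ordDeg _ _ (0 + 1))⟩
  d_one := by
    refine ResCarrier.ext (M := O.obj 1) ?_ ?_
    · change ordMap 1 (O.obj 1).d (Finsupp.single _ _) + ordMap 1 (O.obj 1).par 0 = 0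
      simp [O.d_one]
    · exact map_zero (ordMap 1 (O.obj 1).d)
  comp h i := resComp O h i
  comp_mem h i p q a b ha hb := resComp_mem h i p q a b ha hb
  d_comp h i p a b ha := resD_resComp h i p a b ha
  comp_one {m} i a := by
    refine ResCarrier.ext (conv_one i _ _) ?_
    change conv O _ i (resFst _ _ a) 0
      + conv O _ i (resSnd _ _ a) (ordMap 1 (O.obj 1).par (Finsupp.single _ _)) = _
    simp only [Finsupp.mapRange.linearMap_apply, Finsupp.mapRange_single,
      (O.obj 1).par_of_mem O.one_mem, sgn_zero, one_smul, map_zero, zero_add]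
    exact conv_one i _ _
  one_comp {n} h b := by
    refine ResCarrier.ext (one_conv h _ _) ?_
    change conv O _ 0 _ _ + conv O _ 0 0 _ = _
    rw [map_zero, LinearMap.zero_apply, add_zero]
    exact one_conv h _ _
  comp_comp {l m n r s t} h₁ h₂ h₃ h₄ i j a b c := by
    refine ResCarrier.ext (conv_conv h₁ h₂ h₃ h₄ i j _ _ _) ?_
    change conv O h₂ _ (conv O h₁ i (resFst _ _ a) (resFst _ _ b)) (resSnd _ _ c)
        + conv O h₂ _ (conv O h₁ i (resFst _ _ a) (resSnd _ _ b)
            + conv O h₁ i (resSnd _ _ a) (ordMap m (O.obj m).par (resFst _ _ b)))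
          (ordMap n (O.obj n).par (resFst _ _ c))
      = conv O h₄ i (resFst _ _ a) (conv O h₃ j (resFst _ _ b) (resSnd _ _ c)
          + conv O h₃ j (resSnd _ _ b) (ordMap n (O.obj n).par (resFst _ _ c)))
        + conv O h₄ i (resSnd _ _ a)
          (ordMap t (O.obj t).par (conv O h₃ j (resFst _ _ b) (resFst _ _ c)))
    simp only [map_add, LinearMap.add_apply, ← conv_par_par, conv_conv h₁ h₂ h₃ h₄]
    abel
  comp_comm h₁ h₂ h₃ h₄ i k hik p q a b c hb hc :=
    resComp_comm h₁ h₂ h₃ h₄ i k hik p q a b c hb hc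
  comp_act {m n r} h i σ τ ρ hout hin a b := by
    refine ResCarrier.ext (conv_act h i σ τ ρ hout hin _ _) ?_
    change conv O h i (ordAct O σ (resFst _ _ a)) (ordAct O τ (resSnd _ _ b))
        + conv O h i (ordAct O σ (resSnd _ _ a))
          (ordMap n (O.obj n).par (ordAct O τ (resFst _ _ b)))
      = ordAct O ρ (conv O h (σ i) (resFst _ _ a) (resSnd _ _ b)
          + conv O h (σ i) (resSnd _ _ a) (ordMap n (O.obj n).par (resFst _ _ b)))
    rw [ordAct_comm τ _ fun a => ((O.act τ).map_par a).symm, conv_act h i σ τ ρ hout hin,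
      conv_act h i σ τ ρ hout hin, map_add]

theorem ordSum_resFst_resD {M : DGModule R} {p : ℕ} (x : ResCarrier M p) :
    ordSum (R := R) M p (resFst M p (resD M p x)) = M.d (ordSum (R := R) M p (resFst M p x)) := by
  rw [resD_fst, map_add, ordSum_ordMap, ordSum_ordMap, ordSum_resSnd, map_zero, add_zero]

/-- The projection of the resolution, `(α, β) ↦ ∑ α`. -/
noncomputable def resProj : Operad.Hom (resOperad O) O where
  app n :=
    { toLin := ordSum (R := R) (O.obj n) n ∘ₗ resFst (O.obj n) n
      map_deg := fun _ _ hx => ordSum_mem (mem_resDeg.1 hx).1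
      map_d := fun x => ordSum_resFst_resD x }
  map_one := ordSum_single _ _
  map_act σ _ := ordSum_ordAct σ _
  map_comp h i _ _ := ordSum_conv h i _ _

theorem resProj_surjective (n : ℕ) : Function.Surjective ((resProj O).app n).toLin := fun a =>
  ⟨resMk (M := O.obj n) (Finsupp.single (SlotOrder.std n) a) 0 (map_zero _), ordSum_single _ _⟩

variable {O}

/-- Subtracting a boundary makes the sum of `α` zero, and then `(α, β) = d (0, ± α)`. -/
theorem exists_eq_resD {M : DGModule R} {p : ℕ} {x : ResCarrier M p} (hx : resD M p x = 0) {y : M}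
    (hy : ordSum (R := R) M p (resFst M p x) = M.d y) : ∃ z, x = resD M p z := by
  have hx1 : ordMap p M.d (resFst M p x) + ordMap p M.par (resSnd M p x) = 0 := by
    rw [← resD_fst, hx, map_zero]
  refine ⟨resMk (Finsupp.single (SlotOrder.std p) y) (ordMap p M.par
    (resFst M p x - Finsupp.single (SlotOrder.std p) (M.d y))) ?_, ResCarrier.ext ?_ ?_⟩
  · rw [ordSum_ordMap, map_sub, ordSum_single, hy, sub_self, map_zero]
  · rw [resD_fst, resFst_mk, resSnd_mk, ordMap_par_par]
    simp
  · have h2 : ordMap p M.d (Finsupp.single (SlotOrder.std p) (M.d y)) = 0 := by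
      simp [DGModule.d_d]
    rw [resD_snd, resSnd_mk, ← neg_neg (ordMap p M.d _), ← ordMap_par_d, map_sub, h2, sub_zero,
      eq_neg_of_add_eq_zero_left hx1, map_neg, neg_neg, ordMap_par_par]

theorem resD_single {M : DGModule R} {p : ℕ} {y : M} (hy : M.d y = 0) (s : SlotOrder p) :
    resD M p (resMk (Finsupp.single s y) 0 (map_zero _)) = 0 := by
  refine ResCarrier.ext ?_ ?_
  · rw [resD_fst, resFst_mk, resSnd_mk]
    simp [hy]
  · rw [resD_snd, resSnd_mk, map_zero, map_zero]

theorem resProj_isQuasiIso (n : ℕ) : ((resProj O).app n).IsQuasiIso := by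
  refine ⟨fun x hx hy => hy.elim fun y hy => exists_eq_resD hx hy, fun y hy =>
    ⟨resMk (M := O.obj n) (Finsupp.single (SlotOrder.std n) y) 0 (map_zero _),
      resD_single hy _, 0, ?_⟩⟩
  rw [map_zero, add_zero]
  exact (ordSum_single _ _).symm

theorem eq_single_ordSum {M : DGModule R} {n : ℕ} [Subsingleton (SlotOrder n)]
    (f : SlotOrder n →₀ M) :
    f = Finsupp.single (SlotOrder.std n) (ordSum (R := R) M n f) := by
  induction f using Finsupp.induction_linear with
  | zero => simp
  | add f f' hf hf' => rw [map_add, Finsupp.single_add, ← hf, ← hf']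
  | single x a => rw [ordSum_single, Subsingleton.elim x (SlotOrder.std n)]

theorem ordSum_resFst_injective {M : DGModule R} {n : ℕ} [Subsingleton (SlotOrder n)] :
    Function.Injective (ordSum (R := R) M n ∘ₗ resFst M n) := by
  intro x y hxy
  refine ResCarrier.ext ?_ ?_
  · rw [eq_single_ordSum (resFst M n x), eq_single_ordSum (resFst M n y)]
    exact congrArg _ hxy
  · rw [eq_single_ordSum (resSnd M n x), eq_single_ordSum (resSnd M n y), ordSum_resSnd,
      ordSum_resSnd]

theorem resProj_injective {n : ℕ} [Subsingleton (SlotOrder n)] :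
    Function.Injective ((resProj O).app n).toLin := ordSum_resFst_injective

theorem ordSum_eq_sum {M : DGModule R} {n : ℕ} (f : SlotOrder n →₀ M) :
    ordSum (R := R) M n f = ∑ s, f s := by
  unfold ordSum
  rw [Finsupp.lsum_apply, Finsupp.sum_fintype _ _ fun _ => map_zero _]
  rfl

theorem ordAct_apply {n : ℕ} (σ : Equiv.Perm (Fin n)) (f : SlotOrder n →₀ O.obj n)
    (s : SlotOrder n) : ordAct O σ f (s.act σ) = (O.act σ).toLin (f s) := by
  have hinj : Function.Injective (SlotOrder.act σ) := fun s t hst => by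
    have h2 := congrArg (SlotOrder.act σ⁻¹) hst
    rwa [← SlotOrder.act_mul, ← SlotOrder.act_mul, mul_inv_cancel] at h2
  simp only [ordAct, LinearMap.comp_apply, Finsupp.mapRange.linearMap_apply,
    Finsupp.mapRange_apply, Finsupp.lmapDomain_apply, Finsupp.mapDomain_apply hinj]

theorem conv_single_apply {m n r : ℕ} (h : m + n = r + 1) (i : Fin m)
    (f : SlotOrder m →₀ O.obj m) (t : SlotOrder n) (b : O.obj n) (s : SlotOrder r) :
    conv O h i f (Finsupp.single t b) s
      = ∑ x, if x.comp h i t = s then O.comp h i (f x) b else 0 := by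
  induction f using Finsupp.induction_linear with
  | zero => simp
  | add f f' hf hf' =>
    rw [map_add, LinearMap.add_apply, Finsupp.add_apply, hf, hf', ← Finset.sum_add_distrib]
    refine Finset.sum_congr rfl fun t _ => ?_
    split_ifs <;> simp
  | single x a =>
    rw [conv_single, Finsupp.single_apply, Finset.sum_eq_single x]
    · simp
    · intro t _ ht
      rw [Finsupp.single_eq_of_ne ht]
      simp
    · simp

end Resolution

namespace UAOperad

variable {R : Type u} [CommRing R] (O : UAOperad.{u} R)

/-- The resolution by orders of a unital augmented operad. -/
noncomputable def res : UAOperad.{u} R where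
  toOperad := resOperad O.toOperad
  aug := O.aug.comp (resProj O.toOperad)
  aug_zero := O.aug_zero.comp ⟨resProj_injective, resProj_surjective _ 0⟩
  aug_one := O.aug_one.comp ⟨resProj_injective, resProj_surjective _ 1⟩

/-- The data extracted from a section `O → O ⊗ E` of the resolution by orders:
a decomposition of each operation `o` as a sum of operations `o_s` indexed by the orders `s` of its
slots, compatible with permutations and with the insertion of `1₀`. The differential commutes with
the decomposition up to an error term. -/
structure OrderDecomposition where
  part : ∀ {p : ℕ}, SlotOrder p → O.obj p →ₗ[R] O.obj p
  err : ∀ {p : ℕ}, SlotOrder p → O.obj p →ₗ[R] O.obj p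
  part_mem : ∀ {p : ℕ} (s : SlotOrder p) (q : ℤ) (o : O.obj p), o ∈ (O.obj p).deg q →
    part s o ∈ (O.obj p).deg q
  sum_part : ∀ {p : ℕ} (o : O.obj p), ∑ s, part s o = o
  part_d : ∀ {p : ℕ} (s : SlotOrder p) (o : O.obj p),
    part s ((O.obj p).d o) = (O.obj p).d (part s o) + (O.obj p).par (err s o)
  part_act : ∀ {p : ℕ} (s : SlotOrder p) (σ : Equiv.Perm (Fin p)) (o : O.obj p),
    part (s.act σ) ((O.act σ).toLin o) = (O.act σ).toLin (part s o)
  part_comp_unitZero : ∀ {p : ℕ} (s : SlotOrder p) (i : Fin (p + 1)) (o : O.obj (p + 1)),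
    part s (O.comp (n := 0) (r := p) rfl i o O.unitZero)
      = ∑ t, if t.comp (n := 0) (r := p) rfl i (SlotOrder.std 0) = s then
          O.comp (n := 0) (r := p) rfl i (part t o) O.unitZero else 0

/-- A cofibrant operad is a retract of its resolution by orders, whence a decomposition. -/
theorem IsCofibrant.exists_orderDecomposition {O : UAOperad.{u} R} (hO : O.IsCofibrant) :
    Nonempty O.OrderDecomposition := by
  let P := O.res
  let π : UAOperad.Hom P O := { toHom := resProj O.toOperad, aug_app := fun n a => rfl }
  let f : UAOperad.Hom O O :=
    { app := fun n => DGModule.Hom.id _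
      map_one := rfl
      map_act := fun _ _ => rfl
      map_comp := fun _ _ _ _ => rfl
      aug_app := fun _ _ => rfl }
  obtain ⟨g, hg⟩ := hO P O π (fun n => resProj_surjective _ n) (fun n => resProj_isQuasiIso n) f
  have hg' : ∀ (n : ℕ) (o : O.obj n),
      ordSum (R := R) _ _ (resFst (O.obj n) n ((g.app n).toLin o)) = o := hg
  refine ⟨{
    part := fun {p} s => Finsupp.lapply s ∘ₗ resFst (O.obj p) p ∘ₗ (g.app p).toLin
    err := fun {p} s => Finsupp.lapply s ∘ₗ resSnd (O.obj p) p ∘ₗ (g.app p).toLin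
    part_mem := fun {p} s q o ho => (mem_resDeg.1 ((g.app p).map_deg q o ho)).1 s
    sum_part := fun {p} o => ?_
    part_d := fun {p} s o => ?_
    part_act := fun {p} s σ o => ?_
    part_comp_unitZero := fun {p} s i o => ?_ }⟩
  · exact (ordSum_eq_sum _).symm.trans (hg' p o)
  · exact congrArg (fun w : ResCarrier (O.obj p) p => resFst _ _ w s) ((g.app p).map_d o)
  · exact (congrArg (fun w : ResCarrier (O.obj p) p => resFst _ _ w (s.act σ))
      (g.map_act σ o)).trans (ordAct_apply σ _ s)
  · have h0 : resFst (O.obj 0) 0 ((g.app 0).toLin O.unitZero)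
        = Finsupp.single (SlotOrder.std 0) O.unitZero :=
      (eq_single_ordSum _).trans (congrArg _ (hg' 0 O.unitZero))
    refine (congrArg (fun w : ResCarrier (O.obj p) p => resFst _ _ w s)
      (g.map_comp (n := 0) (r := p) rfl i o O.unitZero)).trans ?_
    refine Eq.trans ?_ (conv_single_apply (O := O.toOperad) (n := 0) (r := p) rfl i _ _ _ s)
    exact congrArg (fun w => conv O.toOperad (n := 0) (r := p) rfl i _ w s) h0

end UAOperad

/-! ### Linear maps out of `Ω_n` -/

section Lift

variable {R : Type u} [CommRing R] (O : UAOperad R) (n : ℕ)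

/-- The element `o(v₁, …, v_p)` of `Ω_n` as a multilinear function. -/
noncomputable def Omega.mkMul (p : ℕ) :
    O.obj p →ₗ[R] MultilinearMap R (fun _ : Fin p => gens R n) (Omega O n) where
  toFun o := (((formsIdeal O n).mkQ ∘ₗ (coinvariantRelations O (gens R n)).mkQ) ∘ₗ
    DirectSum.lof R ℕ (fun p => (O.obj p) ⊗[R] (⨂[R] (_ : Fin p), gens R n)) p ∘ₗ
      TensorProduct.mk R _ _ o).compMultilinearMap (PiTensorProduct.tprod R)
  map_add' o o' := by
    ext v
    simp
  map_smul' r o := by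
    ext v
    simp only [LinearMap.compMultilinearMap_apply, LinearMap.comp_apply, map_smul,
      LinearMap.smul_apply, smul_apply, RingHom.id_apply]

variable {O n}

theorem Omega.mkMul_apply {p : ℕ} (o : O.obj p) (v : Fin p → gens R n) :
    Omega.mkMul O n p o v = Omega.mk O o v := rfl

theorem Omega.hom_ext {N : Type*} [AddCommGroup N] [Module R N] {f g : Omega O n →ₗ[R] N}
    (h : ∀ (p : ℕ) (o : O.obj p) (v : Fin p → gens R n),
      f (Omega.mk O o v) = g (Omega.mk O o v)) : f = g :=
  Submodule.linearMap_qext _ (FreeAlg.hom_ext h)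

theorem Omega.mk_act {p : ℕ} (σ : Equiv.Perm (Fin p)) (o : O.obj p) (e : Fin p → ℤ)
    (v : Fin p → gens R n) (hv : ∀ j, v j ∈ (gens R n).deg (e j)) :
    Omega.mk O ((O.act σ).toLin o) v = koszul R σ e • Omega.mk O o (v ∘ ⇑σ.symm) := by
  rw [Omega.mk, Omega.mk, FreeAlg.mk, FreeAlg.mk, ← map_smul, ← map_smul, ← sub_eq_zero, ← map_sub,
    ← map_sub]
  have h : (coinvariantRelations O (gens R n)).mkQ (mkCover O (gens R n) ((O.act σ).toLin o) v -
      koszul R σ e • mkCover O (gens R n) o (v ∘ ⇑σ.symm)) = 0 := by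
    rw [Submodule.mkQ_apply, Submodule.Quotient.mk_eq_zero]
    exact Submodule.subset_span ⟨p, o, σ, e, v, hv, rfl⟩
  rw [h, map_zero]

theorem Omega.mk_insertNth_genX {p : ℕ} (i : Fin (p + 1)) (o : O.obj (p + 1))
    (v : Fin p → gens R n) :
    Omega.mk O o (i.insertNth (∑ j, genX R n j) v : Fin (p + 1) → gens R n)
      = Omega.mk O (O.comp (n := 0) (r := p) rfl i o O.unitZero) v := by
  rw [Omega.mk, Omega.mk, ← sub_eq_zero, ← map_sub, Submodule.mkQ_apply,
    Submodule.Quotient.mk_eq_zero]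
  exact Submodule.subset_span (Or.inl ⟨p, i, o, v, rfl⟩)

theorem Omega.mk_insertNth_genDX {p : ℕ} (i : Fin (p + 1)) (o : O.obj (p + 1))
    (v : Fin p → gens R n) :
    Omega.mk O o (i.insertNth (∑ j, genDX R n j) v : Fin (p + 1) → gens R n) = 0 := by
  rw [Omega.mk, Submodule.mkQ_apply, Submodule.Quotient.mk_eq_zero]
  exact Submodule.subset_span (Or.inr ⟨p, i, o, v, rfl⟩)

/-- The map `⨁ₚ O(p) ⊗ M^{⊗p} → N` given by multilinear maps. -/
noncomputable def coverLift {M : DGModule R} {N : Type*} [AddCommGroup N] [Module R N]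
    (F : ∀ p, O.obj p →ₗ[R] MultilinearMap R (fun _ : Fin p => M) N) : Cover O M →ₗ[R] N :=
  DirectSum.toModule R ℕ N fun p =>
    TensorProduct.lift ((PiTensorProduct.lift (R := R) (s := fun _ : Fin p => (M : Type u))
      (E := N)).toLinearMap ∘ₗ F p)

theorem coverLift_mk {M : DGModule R} {N : Type*} [AddCommGroup N] [Module R N]
    (F : ∀ p, O.obj p →ₗ[R] MultilinearMap R (fun _ : Fin p => M) N) {p : ℕ} (o : O.obj p)
    (v : Fin p → M) : coverLift F (mkCover O M o v) = F p o v := by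
  simp [coverLift, mkCover, DirectSum.toModule_lof]

/-- The linear map out of `Ω_n` given by multilinear maps which are equivariant and respect the
two families of generators of the ideal `I_n`. -/
noncomputable def Omega.lift {N : Type*} [AddCommGroup N] [Module R N]
    (F : ∀ p, O.obj p →ₗ[R] MultilinearMap R (fun _ : Fin p => gens R n) N)
    (hact : ∀ (p : ℕ) (o : O.obj p) (σ : Equiv.Perm (Fin p)) (e : Fin p → ℤ) (v : Fin p → gens R n),
      (∀ j, v j ∈ (gens R n).deg (e j)) →
        F p ((O.act σ).toLin o) v = koszul R σ e • F p o (v ∘ ⇑σ.symm))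
    (hX : ∀ (p : ℕ) (i : Fin (p + 1)) (o : O.obj (p + 1)) (v : Fin p → gens R n),
      F (p + 1) o (i.insertNth (∑ j, genX R n j) v : Fin (p + 1) → gens R n)
        = F p (O.comp (n := 0) (r := p) rfl i o O.unitZero) v)
    (hDX : ∀ (p : ℕ) (i : Fin (p + 1)) (o : O.obj (p + 1)) (v : Fin p → gens R n),
      F (p + 1) o (i.insertNth (∑ j, genDX R n j) v : Fin (p + 1) → gens R n) = 0) :
    Omega O n →ₗ[R] N :=
  have h1 : coinvariantRelations O (gens R n) ≤ LinearMap.ker (coverLift F) := by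
    refine Submodule.span_le.2 ?_
    rintro _ ⟨p, o, σ, e, v, hv, rfl⟩
    change coverLift F _ = 0
    rw [map_sub, map_smul, coverLift_mk, coverLift_mk, hact p o σ e v hv, sub_self]
  have hmk : ∀ {p : ℕ} (o : O.obj p) (v : Fin p → gens R n),
      (coinvariantRelations O (gens R n)).liftQ (coverLift F) h1 (FreeAlg.mk O (gens R n) o v)
        = F p o v := fun {p} o v =>
    (Submodule.liftQ_apply _ _ _).trans (coverLift_mk F o v)
  (formsIdeal O n).liftQ ((coinvariantRelations O (gens R n)).liftQ (coverLift F) h1) (by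
    refine Submodule.span_le.2 ?_
    rintro _ (⟨p, i, o, v, rfl⟩ | ⟨p, i, o, v, rfl⟩)
    · change Submodule.liftQ _ _ _ _ = 0
      rw [map_sub, hmk, hmk, hX, sub_self]
    · change Submodule.liftQ _ _ _ _ = 0
      rw [hmk, hDX])

theorem Omega.lift_mk {N : Type*} [AddCommGroup N] [Module R N]
    (F : ∀ p, O.obj p →ₗ[R] MultilinearMap R (fun _ : Fin p => gens R n) N) (hact hX hDX)
    {p : ℕ} (o : O.obj p) (v : Fin p → gens R n) :
    Omega.lift F hact hX hDX (Omega.mk O o v) = F p o v :=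
  (Submodule.liftQ_apply _ _ _).trans ((Submodule.liftQ_apply _ _ _).trans (coverLift_mk F o v))

theorem Omega.map_mk {m n : SimplexCategory} (f : m ⟶ n) {p : ℕ} (o : O.obj p)
    (v : Fin p → gens R n.len) :
    Omega.map O f (Omega.mk O o v) = Omega.mk O o fun j => (gensMap R f).toLin (v j) := by
  simp only [Omega.map, Omega.mk, Submodule.mkQ_apply, Submodule.mapQ_apply, FreeAlg.map_mk]

theorem Omega.mk_mem {p : ℕ} {a : ℤ} {e : Fin p → ℤ} {o : O.obj p} {v : Fin p → gens R n}
    (ho : o ∈ (O.obj p).deg a) (hv : ∀ j, v j ∈ (gens R n).deg (e j)) {q : ℤ}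
    (hq : a + ∑ j, e j = q) : Omega.mk O o v ∈ Omega.deg O n q :=
  Submodule.subset_span ⟨p, a, e, o, v, ho, hv, hq, rfl⟩

theorem Omega.map_mem {m n : SimplexCategory} (f : m ⟶ n) {q : ℤ} {x : Omega O n.len}
    (hx : x ∈ Omega.deg O n.len q) : Omega.map O f x ∈ Omega.deg O m.len q := by
  have h : Omega.deg O n.len q ≤ (Omega.deg O m.len q).comap (Omega.map O f) := by
    refine Submodule.span_le.2 ?_
    rintro _ ⟨p, a, e, o, v, ho, hv, hq, rfl⟩
    change Omega.map O f _ ∈ Omega.deg O m.len _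
    rw [Omega.map_mk]
    exact Omega.mk_mem ho (fun j => (gensMap R f).map_deg _ _ (hv j)) hq
  exact h hx

end Lift

/-! ### The contraction of the module of generators -/

section Gens

variable (R : Type u) [CommRing R] (n : ℕ)

theorem gens_par (y : gens R n) :
    (gens R n).par y = ((y.1, -y.2) : (Fin (n + 1) → R) × (Fin (n + 1) → R)) := by
  let f : gens R n →ₗ[R] gens R n :=
    (LinearMap.id.prodMap (-LinearMap.id) :
      (Fin (n + 1) → R) × (Fin (n + 1) → R) →ₗ[R] (Fin (n + 1) → R) × (Fin (n + 1) → R))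
  have h : (gens R n).par = f := DGModule.hom_ext fun q x hx => by
    rw [DGModule.par_of_mem _ hx]
    by_cases h0 : q = 0
    · subst h0
      have h2 : x.2 = 0 := hx.2 (by decide)
      rw [sgn_zero, one_smul]
      exact Prod.ext rfl (by change x.2 = -x.2; rw [h2, neg_zero])
    · have h1 : x.1 = 0 := hx.1 h0
      by_cases h2 : q = 1
      · subst h2
        rw [sgn_one, neg_smul, one_smul]
        exact Prod.ext (by change -x.1 = x.1; rw [h1, neg_zero]) rfl
      · have h3 : x.2 = 0 := hx.2 h2
        have h4 : x = 0 := Prod.ext h1 h3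
        rw [h4, smul_zero, map_zero]
  exact LinearMap.congr_fun h y

/-- The map of generators induced by the constant map at the vertex `0`. -/
noncomputable def gensBase : DGModule.Hom (gens R n) (gens R n) :=
  gensMap R (SimplexCategory.const ⦋n⦌ ⦋n⦌ 0)

theorem gensBase_apply (y : gens R n) : (gensBase R n).toLin y
    = ((fun _ => y.1 0, fun _ => y.2 0) : (Fin (n + 1) → R) × (Fin (n + 1) → R)) := rfl

/-- The contraction `dxᵢ ↦ xᵢ` (`i ≠ 0`), `dx₀ ↦ x₀ - ∑ xᵢ` of the generators onto the submodule
spanned by `∑ xᵢ` and `∑ dxᵢ`. -/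
def gensHtpy : gens R n →ₗ[R] gens R n where
  toFun y := ((fun i => y.2 i - y.2 0, 0) : (Fin (n + 1) → R) × (Fin (n + 1) → R))
  map_add' y z := by
    refine Prod.ext (funext fun i => ?_) (add_zero 0).symm
    change y.2 i + z.2 i - (y.2 0 + z.2 0) = (y.2 i - y.2 0) + (z.2 i - z.2 0)
    abel
  map_smul' r y := by
    refine Prod.ext (funext fun i => ?_) (smul_zero r).symm
    change r * y.2 i - r * y.2 0 = r * (y.2 i - y.2 0)
    ring

theorem gensHtpy_mem {q : ℤ} {y : gens R n} (hy : y ∈ (gens R n).deg q) :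
    gensHtpy R n y ∈ (gens R n).deg (q - 1) := by
  refine ⟨fun h => funext fun i => ?_, fun _ => rfl⟩
  have h2 : y.2 = 0 := hy.2 fun e => h (by rw [e, sub_self])
  change y.2 i - y.2 0 = 0
  rw [h2]
  exact sub_self (0 : R)

theorem gens_d_gensHtpy_add (y : gens R n) :
    (gens R n).d (gensHtpy R n y) + gensHtpy R n ((gens R n).d y) = y - (gensBase R n).toLin y := by
  refine Prod.ext ?_ ?_
  · exact zero_add _
  · exact add_zero _

theorem gensHtpy_par (y : gens R n) :
    gensHtpy R n ((gens R n).par y) = - (gens R n).par (gensHtpy R n y) := by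
  rw [gens_par, gens_par]
  refine Prod.ext (funext fun i => ?_) ?_
  · change -y.2 i - -y.2 0 = -(y.2 i - y.2 0)
    ring
  · change (0 : Fin (n + 1) → R) = - - 0
    simp

theorem gensBase_gensHtpy (y : gens R n) : (gensBase R n).toLin (gensHtpy R n y) = 0 := by
  refine Prod.ext (funext fun i => ?_) rfl
  change y.2 0 - y.2 0 = 0
  exact sub_self _

theorem gensHtpy_sum_genX : gensHtpy R n (∑ i, genX R n i) = 0 := by
  rw [sum_genX]
  refine Prod.ext (funext fun i => ?_) rfl
  change (0 : R) - 0 = 0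
  exact sub_self _

theorem gensHtpy_sum_genDX : gensHtpy R n (∑ i, genDX R n i) = 0 := by
  rw [sum_genDX]
  refine Prod.ext (funext fun i => ?_) rfl
  change (1 : R) - 1 = 0
  exact sub_self _

theorem gensBase_sum_genX : (gensBase R n).toLin (∑ i, genX R n i) = ∑ i, genX R n i :=
  gensMap_sum_genX R _

theorem gensBase_sum_genDX : (gensBase R n).toLin (∑ i, genDX R n i) = ∑ i, genDX R n i :=
  gensMap_sum_genDX R _

theorem gensBase_eq (y : gens R n) : (gensBase R n).toLin y
    = y.1 0 • (∑ i, genX R n i) + y.2 0 • (∑ i, genDX R n i) := by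
  rw [sum_genX, sum_genDX]
  refine Prod.ext (funext fun i => ?_) (funext fun i => ?_)
  · change y.1 0 = y.1 0 * 1 + y.2 0 * 0
    ring
  · change y.2 0 = y.1 0 * 0 + y.2 0 * 1
    ring

end Gens

/-! ### The augmentation of `Ω_n` -/

section Aug

variable {R : Type u} [CommRing R] (O : UAOperad R) (n : ℕ)

/-- The value of the augmentation of an operad, as an element of `R`. -/
def UAOperad.augR {p : ℕ} : O.obj p →ₗ[R] R := (O.aug.app p).toLin

variable {O} in
theorem UAOperad.augR_of_mem {p : ℕ} {q : ℤ} (hq : q ≠ 0) {o : O.obj p} (ho : o ∈ (O.obj p).deg q) :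
    O.augR o = 0 :=
  (DGModule.mem_unit_deg (R := R)).1 ((O.aug.app p).map_deg q o ho) hq

theorem UAOperad.augR_unitZero : O.augR O.unitZero = 1 := O.aug_unitZero

variable {O} in
theorem UAOperad.eq_augR_smul (o : O.obj 0) : o = O.augR o • O.unitZero := by
  refine O.aug_zero.1 ?_
  change O.augR o = O.augR (O.augR o • O.unitZero)
  rw [map_smul, O.augR_unitZero, smul_eq_mul, mul_one]

theorem UAOperad.augR_comp_unitZero {p : ℕ} (i : Fin (p + 1)) (o : O.obj (p + 1)) :
    O.augR (O.comp (n := 0) (r := p) rfl i o O.unitZero) = O.augR o :=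
  (O.aug.map_comp (n := 0) (r := p) rfl i o O.unitZero).trans
    ((congrArg (fun r : R => O.augR o * r) O.augR_unitZero).trans (mul_one _))

/-- The value at the vertex `0` of the coefficient of degree `0` of a generator. -/
def gensEval : gens R n →ₗ[R] R where
  toFun y := y.1 0
  map_add' _ _ := rfl
  map_smul' _ _ := rfl

theorem gensEval_of_mem {q : ℤ} (hq : q ≠ 0) {y : gens R n} (hy : y ∈ (gens R n).deg q) :
    gensEval n y = 0 := congrFun (hy.1 hq) 0

/-- The augmentation `Ω_n → R` at the vertex `0`. -/
noncomputable def Omega.eval : Omega O n →ₗ[R] R :=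
  Omega.lift (fun p => LinearMap.toSpanSingleton R
      (MultilinearMap R (fun _ : Fin p => gens R n) R)
        ((MultilinearMap.mkPiAlgebra R (Fin p) R).compLinearMap fun _ => gensEval n) ∘ₗ O.augR)
    (by
      intro p o σ e v hv
      simp only [LinearMap.comp_apply, LinearMap.toSpanSingleton_apply, smul_apply,
        MultilinearMap.compLinearMap_apply, MultilinearMap.mkPiAlgebra_apply]
      have h1 : O.augR ((O.act σ).toLin o) = O.augR o := O.aug.map_act σ o
      rw [h1, Function.comp_def, Equiv.prod_comp σ.symm (fun j => gensEval n (v j))]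
      by_cases he : ∀ j, e j = 0
      · simp [koszul, he]
      · obtain ⟨j, hj⟩ := not_forall.1 he
        rw [Finset.prod_eq_zero (Finset.mem_univ j) (gensEval_of_mem n hj (hv j))]
        simp)
    (by
      intro p i o v
      simp only [LinearMap.comp_apply, LinearMap.toSpanSingleton_apply, smul_apply,
        MultilinearMap.compLinearMap_apply, MultilinearMap.mkPiAlgebra_apply]
      rw [O.augR_comp_unitZero, Fin.prod_univ_succAbove _ i]
      simp only [Fin.insertNth_apply_same, Fin.insertNth_apply_succAbove]
      have h : gensEval n (∑ j, genX R n j) = 1 := by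
        rw [sum_genX]
        rfl
      rw [h, one_mul])
    (by
      intro p i o v
      simp only [LinearMap.comp_apply, LinearMap.toSpanSingleton_apply, smul_apply,
        MultilinearMap.compLinearMap_apply, MultilinearMap.mkPiAlgebra_apply]
      rw [Fin.prod_univ_succAbove _ i]
      simp only [Fin.insertNth_apply_same]
      have h : gensEval n (∑ j, genDX R n j) = 0 := by
        rw [sum_genDX]
        rfl
      rw [h, zero_mul, smul_zero])

theorem Omega.eval_mk {p : ℕ} (o : O.obj p) (v : Fin p → gens R n) :
    Omega.eval O n (Omega.mk O o v) = O.augR o * ∏ j, gensEval n (v j) :=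
  Omega.lift_mk _ _ _ _ o v

theorem Omega.eval_of_mem {q : ℤ} (hq : q ≠ 0) {x : Omega O n} (hx : x ∈ Omega.deg O n q) :
    Omega.eval O n x = 0 := by
  have h : Omega.deg O n q ≤ LinearMap.ker (Omega.eval O n) := by
    refine Submodule.span_le.2 ?_
    rintro _ ⟨p, a, e, o, v, ho, hv, h, rfl⟩
    change Omega.eval O n _ = 0
    rw [Omega.eval_mk]
    by_cases he : ∀ j, e j = 0
    · rw [UAOperad.augR_of_mem (fun ha => hq ?_) ho, zero_mul]
      simpa [he, ha] using h.symm
    · obtain ⟨j, hj⟩ := not_forall.1 he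
      rw [Finset.prod_eq_zero (Finset.mem_univ j) (gensEval_of_mem n hj (hv j)), mul_zero]
  exact h hx

/-- The unit of the algebra `Ω_n`. -/
noncomputable def Omega.one : Omega O n := Omega.mk O O.unitZero (fun j : Fin 0 => j.elim0)

theorem Omega.eval_one : Omega.eval O n (Omega.one O n) = 1 := by
  rw [Omega.one, Omega.eval_mk, O.augR_unitZero]
  simp

theorem Omega.one_mem : Omega.one O n ∈ Omega.deg O n 0 :=
  Omega.mk_mem (e := fun _ => 0) O.unitZero_mem (fun j => j.elim0) (by simp)

theorem Omega.map_one {m n : SimplexCategory} (f : m ⟶ n) :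
    Omega.map O f (Omega.one O n.len) = Omega.one O m.len := by
  rw [Omega.one, Omega.map_mk, Omega.one]
  congr 1
  funext j
  exact j.elim0

theorem Omega.d_one : Omega.d O n (Omega.one O n) = 0 := by
  rw [Omega.one, Omega.d_mk, O.d_unitZero, ← Omega.mkMul_apply, map_zero]
  simp

/-- The map `Ω_n → Ω_n` induced by the constant map at the vertex `0`. -/
noncomputable def Omega.base : Omega O n →ₗ[R] Omega O n :=
  Omega.map O (SimplexCategory.const ⦋n⦌ ⦋n⦌ 0)

theorem Omega.base_mk {p : ℕ} (o : O.obj p) (v : Fin p → gens R n) :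
    Omega.base O n (Omega.mk O o v) = Omega.mk O o fun j => (gensBase R n).toLin (v j) :=
  Omega.map_mk _ o v

theorem Omega.d_base (x : Omega O n) :
    Omega.d O n (Omega.base O n x) = Omega.base O n (Omega.d O n x) := Omega.d_map O _ x

theorem Omega.mk_gensBase {p : ℕ} (o : O.obj p) (v : Fin p → gens R n) :
    Omega.mk O o (fun j => (gensBase R n).toLin (v j))
      = (O.augR o * ∏ j, gensEval n (v j)) • Omega.one O n := by
  induction p with
  | zero =>
    have hv : (fun j => (gensBase R n).toLin (v j)) = (fun j : Fin 0 => j.elim0) :=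
      funext fun j => j.elim0
    rw [Fin.prod_univ_zero, mul_one, hv]
    conv_lhs => rw [UAOperad.eq_augR_smul o, ← Omega.mkMul_apply, map_smul]
    rfl
  | succ p ih =>
    have hv : (fun j => (gensBase R n).toLin (v j))
        = Function.update ((0 : Fin (p + 1)).insertNth (0 : gens R n)
            (fun j => (gensBase R n).toLin (v j.succ)) : Fin (p + 1) → gens R n) 0
              ((gensBase R n).toLin (v 0)) := by
      funext j
      refine Fin.cases ?_ (fun j => ?_) j <;> simp
    rw [hv, gensBase_eq, ← Omega.mkMul_apply, MultilinearMap.map_update_add,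
      MultilinearMap.map_update_smul, MultilinearMap.map_update_smul, Omega.mkMul_apply,
      Omega.mkMul_apply, Fin.update_insertNth, Fin.update_insertNth, Omega.mk_insertNth_genX,
      Omega.mk_insertNth_genDX, ih, O.augR_comp_unitZero, smul_zero, add_zero,
      Fin.prod_univ_succ, smul_smul]
    congr 1
    change gensEval n (v 0) * _ = _
    ring

/-- The map induced by the constant map at the vertex `0` factors through the augmentation. -/
theorem Omega.base_eq (x : Omega O n) :
    Omega.base O n x = Omega.eval O n x • Omega.one O n := by
  have h : Omega.base O n = LinearMap.toSpanSingleton R _ (Omega.one O n) ∘ₗ Omega.eval O n :=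
    Omega.hom_ext fun p o v => by
      rw [Omega.base_mk, Omega.mk_gensBase, LinearMap.comp_apply, Omega.eval_mk]
      rfl
  exact LinearMap.congr_fun h x

theorem Omega.eval_d (x : Omega O n) : Omega.eval O n (Omega.d O n x) = 0 := by
  have h := Omega.d_base O n x
  rw [Omega.base_eq, Omega.base_eq, map_smul, Omega.d_one, smul_zero] at h
  simpa [Omega.eval_one] using congrArg (Omega.eval O n) h.symm

end Aug

/-! ### The contraction of `Ω_n` -/

namespace SlotOrder

theorem slotProj_zero {p : ℕ} (i : Fin (p + 1)) (x : Fin p) :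
    slotProj (n := 0) (r := p) rfl i x = i.succAbove x := by
  refine Fin.ext ?_
  simp only [slotProj, Fin.succAbove, Fin.lt_def, Fin.val_castSucc]
  split_ifs
  · rfl
  · omega
  · simp

/-- Inserting the operation `1₀` in the slot `i` restricts the order to the other slots. -/
theorem comp_zero_lt {p : ℕ} (i : Fin (p + 1)) (s : SlotOrder (p + 1)) (t : SlotOrder 0)
    (x y : Fin p) :
    (s.comp (n := 0) (r := p) rfl i t).lt x y ↔ s.lt (i.succAbove x) (i.succAbove y) := by
  rw [← slotProj_zero, ← slotProj_zero]
  refine ⟨?_, Or.inl⟩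
  rintro (h | ⟨a, -⟩)
  · exact h
  · exact a.elim0

/-- The right action of a permutation as a bijection of the set of orders. -/
def actEquiv {p : ℕ} (σ : Equiv.Perm (Fin p)) : SlotOrder p ≃ SlotOrder p where
  toFun := act σ
  invFun := act σ⁻¹
  left_inv s := by rw [← act_mul, mul_inv_cancel, act_one]
  right_inv s := by rw [← act_mul, inv_mul_cancel, act_one]

noncomputable instance {p : ℕ} (s : SlotOrder p) (x y : Fin p) : Decidable (s.lt x y) :=
  Classical.dec _

/-- Summing the differences between consecutive initial segments of an order. -/
theorem sum_initialSegments {p : ℕ} (s : SlotOrder p) {N : Type*} [AddCommGroup N]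
    (G : Finset (Fin p) → N) :
    ∑ j, (G (Finset.univ.filter fun l => s.lt l j)
      - G (Finset.univ.filter fun l => s.lt l j ∨ l = j)) = G ∅ - G Finset.univ := by
  have : IsStrictTotalOrder (Fin p) s.lt :=
    { irrefl := s.irrefl
      trans := fun _ _ _ => s.trans
      trichotomous := fun x y h1 h2 => by
        by_contra h
        exact (s.total h).elim h1 h2 }
  let _ : LinearOrder (Fin p) := linearOrderOfSTO s.lt
  have key : ∀ S : Finset (Fin p),
      ∑ j ∈ S, (G (S.filter fun l => s.lt l j) - G (S.filter fun l => s.lt l j ∨ l = j))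
        = G ∅ - G S := by
    intro S
    induction S using Finset.induction_on_max with
    | empty => simp
    | insert a S ha ih =>
      have haS : a ∉ S := fun h => s.irrefl a (ha a h)
      have e1 : ∀ j ∈ S, (insert a S).filter (fun l => s.lt l j) = S.filter fun l => s.lt l j := by
        intro j hj
        rw [Finset.filter_insert, if_neg fun h => s.irrefl a (s.trans h (ha j hj))]
      have e2 : ∀ j ∈ S, (insert a S).filter (fun l => s.lt l j ∨ l = j)
          = S.filter fun l => s.lt l j ∨ l = j := by
        intro j hj
        rw [Finset.filter_insert, if_neg]
        rintro (h | rfl)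
        · exact s.irrefl a (s.trans h (ha j hj))
        · exact haS hj
      have e3 : (insert a S).filter (fun l => s.lt l a) = S := by
        rw [Finset.filter_insert, if_neg (s.irrefl a), Finset.filter_true_of_mem]
        exact fun x hx => ha x hx
      have e4 : (insert a S).filter (fun l => s.lt l a ∨ l = a) = insert a S := by
        rw [Finset.filter_insert, if_pos (Or.inr rfl), Finset.filter_true_of_mem]
        exact fun x hx => Or.inl (ha x hx)
      rw [Finset.sum_insert haS, e3, e4, Finset.sum_congr rfl fun j hj => by rw [e1 j hj, e2 j hj],
        ih]
      abel
  exact key Finset.univ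

end SlotOrder

section Slotwise

variable (R : Type u) [CommRing R] (n : ℕ)

/-- The maps applied to the slots in the term of the contraction indexed by an order `s` and a
slot `j`: the contraction in the slot `j`, the projection in the slots preceding `j` for `s`, and
the Koszul sign in the slots preceding `j` for the usual order. -/
noncomputable def slotMap {p : ℕ} (s : SlotOrder p) (j l : Fin p) : gens R n →ₗ[R] gens R n :=
  if l = j then gensHtpy R n else
    (if l < j then (gens R n).par else LinearMap.id) ∘ₗ
      (if s.lt l j then (gensBase R n).toLin else LinearMap.id)

variable {R n}

/-- The family obtained from `v` by applying `slotMap` to the slots. -/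
noncomputable def htpyAt {p : ℕ} (s : SlotOrder p) (j : Fin p) (v : Fin p → gens R n) :
    Fin p → gens R n := fun l => slotMap R n s j l (v l)

/-- The variant without signs of `htpyAt`. -/
noncomputable def htpyAt' {p : ℕ} (s : SlotOrder p) (j : Fin p) (v : Fin p → gens R n) :
    Fin p → gens R n := fun l =>
  if l = j then gensHtpy R n (v l) else if s.lt l j then (gensBase R n).toLin (v l) else v l

theorem htpyAt'_mem {p : ℕ} (s : SlotOrder p) (j : Fin p) {v : Fin p → gens R n} {e : Fin p → ℤ}
    (hv : ∀ l, v l ∈ (gens R n).deg (e l)) (l : Fin p) :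
    htpyAt' s j v l ∈ (gens R n).deg (Function.update e j (e j - 1) l) := by
  by_cases hl : l = j
  · subst hl
    simpa [htpyAt'] using gensHtpy_mem R n (hv l)
  · by_cases h : s.lt l j
    · simpa [htpyAt', hl, h] using (gensBase R n).map_deg _ _ (hv l)
    · simpa [htpyAt', hl, h] using hv l

theorem htpyAt_eq {p : ℕ} (s : SlotOrder p) (j : Fin p) {v : Fin p → gens R n} {e : Fin p → ℤ}
    (hv : ∀ l, v l ∈ (gens R n).deg (e l)) :
    htpyAt s j v = fun l => (if l < j then sgn R (e l) else 1) • htpyAt' s j v l := by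
  funext l
  rcases lt_trichotomy l j with hl | hl | hl
  · by_cases h : s.lt l j
    · simp [htpyAt, htpyAt', slotMap, hl, hl.ne, h,
        DGModule.par_of_mem _ ((gensBase R n).map_deg _ _ (hv l))]
    · simp [htpyAt, htpyAt', slotMap, hl, hl.ne, h, DGModule.par_of_mem _ (hv l)]
  · subst hl
    simp [htpyAt, htpyAt', slotMap]
  · by_cases h : s.lt l j <;> simp [htpyAt, htpyAt', slotMap, hl.not_gt, hl.ne', h]

theorem htpyAt'_act {p : ℕ} (s : SlotOrder p) (σ : Equiv.Perm (Fin p)) (j : Fin p)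
    (v : Fin p → gens R n) :
    htpyAt' (s.act σ) j v ∘ ⇑σ.symm = htpyAt' s (σ j) (v ∘ ⇑σ.symm) := by
  funext l
  have h : (s.act σ).lt (σ.symm l) j ↔ s.lt l (σ j) := by simp
  simp only [htpyAt', Function.comp_apply, Equiv.symm_apply_eq]
  rw [if_congr h rfl rfl]

theorem koszul_update_sub_one {p : ℕ} (σ : Equiv.Perm (Fin p)) (e : Fin p → ℤ) (k : Fin p) :
    (∏ l, if l < k then sgn R (e l) else 1) * koszul R σ (Function.update e k (e k - 1))
      = koszul R σ e * ∏ l, if σ l < σ k then sgn R (e l) else 1 := by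
  have h := koszul_update (R := R) σ (Function.update e k (e k - 1)) k
  rw [Function.update_self, Function.update_idem, sub_add_cancel, Function.update_eq_self] at h
  have h1 : (∏ l, if l < k then sgn R (Function.update e k (e k - 1) l) else 1)
      = ∏ l, if l < k then sgn R (e l) else 1 :=
    Finset.prod_congr rfl fun l _ => by
      split_ifs with hl
      · rw [Function.update_of_ne hl.ne]
      · rfl
  have h2 : (∏ l, if σ l < σ k then sgn R (Function.update e k (e k - 1) l) else 1)
      = ∏ l, if σ l < σ k then sgn R (e l) else 1 :=
    Finset.prod_congr rfl fun l _ => by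
      split_ifs with hl
      · rw [Function.update_of_ne fun h => hl.ne (by rw [h])]
      · rfl
  rw [h1, h2] at h
  have h3 : ∀ P : Fin p → Prop, ∀ [DecidablePred P],
      (∏ l, if P l then sgn R (e l) else 1) * (∏ l, if P l then sgn R (e l) else 1) = 1 := by
    intro P _
    rw [← Finset.prod_mul_distrib]
    refine Finset.prod_eq_one fun l _ => ?_
    split_ifs
    · exact sgn_mul_self _
    · exact one_mul 1
  have h4 := h3 fun l => l < k
  have h5 := h3 fun l => σ l < σ k
  calc _ = (∏ l, if l < k then sgn R (e l) else 1) * (koszul R σ (Function.update e k (e k - 1)) *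
        ∏ l, if σ l < σ k then sgn R (e l) else 1) * ∏ l, if σ l < σ k then sgn R (e l) else 1 := by
        rw [mul_assoc, mul_assoc, h5, mul_one]
    _ = _ := by rw [← h, ← mul_assoc, h4, one_mul]

theorem gens_par_sum_genX : (gens R n).par (∑ i, genX R n i) = ∑ i, genX R n i := by
  rw [DGModule.par_of_mem _ (sum_genX_mem R n), sgn_zero, one_smul]

theorem gens_par_sum_genDX : (gens R n).par (∑ i, genDX R n i) = (-1 : R) • ∑ i, genDX R n i := by
  rw [DGModule.par_of_mem _ (sum_genDX_mem R n), sgn_one]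

theorem htpyAt_insertNth {p : ℕ} (s : SlotOrder (p + 1)) (t : SlotOrder 0) (i : Fin (p + 1))
    (j : Fin p) (y : gens R n) (v : Fin p → gens R n) :
    htpyAt s (i.succAbove j) (i.insertNth y v : Fin (p + 1) → gens R n)
      = i.insertNth (slotMap R n s (i.succAbove j) i y)
          (htpyAt (s.comp (n := 0) (r := p) rfl i t) j v) := by
  funext l
  rcases Fin.eq_self_or_eq_succAbove i l with rfl | ⟨l, rfl⟩
  · simp [htpyAt]
  · simp only [htpyAt, Fin.insertNth_apply_succAbove, slotMap, Fin.succAbove_right_inj,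
      Fin.succAbove_lt_succAbove_iff]
    rw [if_congr (SlotOrder.comp_zero_lt i s t l j) rfl rfl]

theorem slotMap_sum_genX {p : ℕ} (s : SlotOrder p) {j l : Fin p} (h : l ≠ j) :
    slotMap R n s j l (∑ i, genX R n i) = ∑ i, genX R n i := by
  by_cases h1 : l < j <;> by_cases h2 : s.lt l j <;>
    simp [slotMap, h, h1, h2, gensBase_sum_genX, gens_par_sum_genX, -map_sum]

theorem slotMap_sum_genDX {p : ℕ} (s : SlotOrder p) {j l : Fin p} (h : l ≠ j) :
    ∃ c : R, slotMap R n s j l (∑ i, genDX R n i) = c • ∑ i, genDX R n i := by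
  by_cases h1 : l < j
  · refine ⟨-1, ?_⟩
    by_cases h2 : s.lt l j <;>
      simp only [slotMap, h, h1, h2, gensBase_sum_genDX, gens_par_sum_genDX, LinearMap.comp_apply,
        if_true, if_false, LinearMap.id_apply]
  · refine ⟨1, ?_⟩
    by_cases h2 : s.lt l j <;>
      simp only [slotMap, h, h1, h2, gensBase_sum_genDX, LinearMap.comp_apply,
        if_true, if_false, LinearMap.id_apply, one_smul]

end Slotwise

section Contraction

variable {R : Type u} [CommRing R] {O : UAOperad R} {n : ℕ}

theorem Omega.mk_htpyAt {p : ℕ} (o : O.obj p) (s : SlotOrder p) (j : Fin p) {v : Fin p → gens R n}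
    {e : Fin p → ℤ} (hv : ∀ l, v l ∈ (gens R n).deg (e l)) :
    Omega.mk O o (htpyAt s j v)
      = (∏ l, if l < j then sgn R (e l) else 1) • Omega.mk O o (htpyAt' s j v) := by
  rw [htpyAt_eq s j hv, ← Omega.mkMul_apply, MultilinearMap.map_smul_univ, Omega.mkMul_apply]

theorem Omega.mk_act_htpyAt {p : ℕ} (o : O.obj p) (s : SlotOrder p) (σ : Equiv.Perm (Fin p))
    (j : Fin p) {v : Fin p → gens R n} {e : Fin p → ℤ} (hv : ∀ l, v l ∈ (gens R n).deg (e l)) :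
    Omega.mk O ((O.act σ).toLin o) (htpyAt (s.act σ) j v)
      = koszul R σ e • Omega.mk O o (htpyAt s (σ j) (v ∘ ⇑σ.symm)) := by
  have hv' : ∀ l, (v ∘ ⇑σ.symm) l ∈ (gens R n).deg ((e ∘ ⇑σ.symm) l) := fun l => hv _
  rw [Omega.mk_htpyAt _ _ _ hv, Omega.mk_act σ o _ _ (htpyAt'_mem _ j hv), htpyAt'_act,
    Omega.mk_htpyAt _ _ _ hv', smul_smul, smul_smul, koszul_update_sub_one,
    ← Equiv.prod_comp σ fun l => if l < σ j then sgn R ((e ∘ ⇑σ.symm) l) else 1]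
  simp

theorem Omega.mk_eq_zero {p : ℕ} (o : O.obj p) {v : Fin p → gens R n} (j : Fin p) (h : v j = 0) :
    Omega.mk O o v = 0 :=
  MultilinearMap.map_coord_zero (Omega.mkMul O n p o) j h

theorem Omega.mk_update_neg {p : ℕ} (o : O.obj p) (v : Fin p → gens R n) (j : Fin p)
    (y : gens R n) :
    Omega.mk O o (Function.update v j (-y)) = - Omega.mk O o (Function.update v j y) :=
  MultilinearMap.map_update_neg (Omega.mkMul O n p o) v j y

theorem Omega.mk_htpyAt_self {p : ℕ} (o : O.obj p) (s : SlotOrder p) (j : Fin p)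
    (v : Fin p → gens R n) (h : gensHtpy R n (v j) = 0) : Omega.mk O o (htpyAt s j v) = 0 :=
  Omega.mk_eq_zero o j (by simpa [htpyAt, slotMap] using h)

theorem Omega.mk_insertNth_smul_genDX {p : ℕ} (i : Fin (p + 1)) (o : O.obj (p + 1)) (c : R)
    (v : Fin p → gens R n) :
    Omega.mk O o (i.insertNth (c • ∑ j, genDX R n j) v : Fin (p + 1) → gens R n) = 0 := by
  rw [Omega.mk, FreeAlg.mk_insertNth_smul, map_smul]
  exact (congrArg (c • ·) (Omega.mk_insertNth_genDX i o v)).trans (smul_zero c)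

variable (D : O.OrderDecomposition)

/-- The contraction of `Ω_n` up to an error term:
`o(v₁, …, v_p) ↦ ∑ₛ ∑ⱼ ± oₛ(w₁, …, k vⱼ, …, w_p)`, where `o_s` is the component of `o` indexed by
the order `s` and `w_l` is the projection of `v_l` if `l` precedes `j` for `s`, and `v_l`
otherwise. -/
noncomputable def Omega.preHtpy (n : ℕ) : Omega O n →ₗ[R] Omega O n :=
  Omega.lift (fun p => ∑ s, ∑ j, MultilinearMap.compLinearMapₗ (slotMap R n s j) ∘ₗ
      Omega.mkMul O n p ∘ₗ (O.obj p).par ∘ₗ D.part s)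
    (by
      intro p o σ e v hv
      simp only [LinearMap.sum_apply, LinearMap.comp_apply, sum_apply,
        MultilinearMap.compLinearMapₗ_apply, MultilinearMap.compLinearMap_apply,
        Omega.mkMul_apply, Finset.smul_sum]
      rw [← Equiv.sum_comp (SlotOrder.actEquiv σ)]
      refine Finset.sum_congr rfl fun s _ => ?_
      refine Eq.trans (Finset.sum_congr rfl fun j _ => ?_) (Equiv.sum_comp σ _)
      change Omega.mk O ((O.obj p).par (D.part (s.act σ) _)) (htpyAt (s.act σ) j v) = _
      rw [D.part_act, ← (O.act σ).map_par, Omega.mk_act_htpyAt _ _ _ _ hv]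
      rfl)
    (by
      intro p i o v
      simp only [LinearMap.sum_apply, LinearMap.comp_apply, sum_apply,
        MultilinearMap.compLinearMapₗ_apply, MultilinearMap.compLinearMap_apply,
        Omega.mkMul_apply, D.part_comp_unitZero]
      change ∑ s, ∑ j, Omega.mk O _ (htpyAt s j _) = ∑ s, ∑ j, Omega.mk O _ (htpyAt s j v)
      have h1 : ∀ s : SlotOrder (p + 1), ∑ j, Omega.mk O ((O.obj (p + 1)).par (D.part s o))
          (htpyAt s j (i.insertNth (∑ j, genX R n j) v : Fin (p + 1) → gens R n))
          = ∑ j, Omega.mk O ((O.obj p).par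
              (O.comp (n := 0) (r := p) rfl i (D.part s o) O.unitZero))
                (htpyAt (s.comp (n := 0) (r := p) rfl i (SlotOrder.std 0)) j v) := by
        intro s
        rw [Fin.sum_univ_succAbove _ i, Omega.mk_htpyAt_self _ _ _ _ (by
          rw [Fin.insertNth_apply_same]
          exact gensHtpy_sum_genX R n), zero_add]
        refine Finset.sum_congr rfl fun j _ => ?_
        rw [htpyAt_insertNth s (SlotOrder.std 0), slotMap_sum_genX s (Fin.succAbove_ne i j).symm,
          Omega.mk_insertNth_genX, O.comp_par_unitZero]
      rw [Finset.sum_congr rfl fun s _ => h1 s]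
      have h2 : ∀ (s : SlotOrder p) (j : Fin p), Omega.mk O ((O.obj p).par
            (∑ t, if t.comp (n := 0) (r := p) rfl i (SlotOrder.std 0) = s then
              O.comp (n := 0) (r := p) rfl i (D.part t o) O.unitZero else 0)) (htpyAt s j v)
          = ∑ t : SlotOrder (p + 1), if t.comp (n := 0) (r := p) rfl i (SlotOrder.std 0) = s then
              Omega.mk O ((O.obj p).par
                (O.comp (n := 0) (r := p) rfl i (D.part t o) O.unitZero)) (htpyAt s j v)
            else 0 := by
        intro s j
        rw [← Omega.mkMul_apply, map_sum, map_sum, sum_apply]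
        refine Finset.sum_congr rfl fun t _ => ?_
        split_ifs
        · rfl
        · rw [map_zero, map_zero]
          rfl
      simp only [h2]
      refine Eq.symm ((Finset.sum_congr rfl fun s _ => Finset.sum_comm).trans
        (Finset.sum_comm.trans ?_))
      refine Finset.sum_congr rfl fun t _ => ?_
      rw [Finset.sum_comm]
      refine Finset.sum_congr rfl fun j _ => ?_
      rw [Finset.sum_ite_eq, if_pos (Finset.mem_univ _)])
    (by
      intro p i o v
      simp only [LinearMap.sum_apply, LinearMap.comp_apply, sum_apply,
        MultilinearMap.compLinearMapₗ_apply, MultilinearMap.compLinearMap_apply,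
        Omega.mkMul_apply]
      refine Finset.sum_eq_zero fun s _ => ?_
      change ∑ j, Omega.mk O _ (htpyAt s j _) = 0
      rw [Fin.sum_univ_succAbove _ i, Omega.mk_htpyAt_self _ _ _ _ (by
          rw [Fin.insertNth_apply_same]
          exact gensHtpy_sum_genDX R n), zero_add]
      refine Finset.sum_eq_zero fun j _ => ?_
      obtain ⟨c, hc⟩ := slotMap_sum_genDX (R := R) (n := n) s (Fin.succAbove_ne i j).symm
      rw [htpyAt_insertNth s (SlotOrder.std 0), hc, Omega.mk_insertNth_smul_genDX])

theorem Omega.preHtpy_mk {p : ℕ} (o : O.obj p) (v : Fin p → gens R n) :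
    Omega.preHtpy D n (Omega.mk O o v)
      = ∑ s, ∑ j, Omega.mk O ((O.obj p).par (D.part s o)) (htpyAt s j v) := by
  rw [Omega.preHtpy, Omega.lift_mk]
  simp only [LinearMap.sum_apply, LinearMap.comp_apply, sum_apply,
    MultilinearMap.compLinearMapₗ_apply, MultilinearMap.compLinearMap_apply, Omega.mkMul_apply]
  rfl

theorem mk_dAt_htpyAt_of_ne {p : ℕ} (o : O.obj p) (s : SlotOrder p) {j m : Fin p} (h : m ≠ j)
    (v : Fin p → gens R n) :
    Omega.mk O o (dAt (gens R n) m (htpyAt s j v))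
      = - Omega.mk O o (htpyAt s j (dAt (gens R n) m v)) := by
  -- the two families differ by a sign in the last of the two slots `m` and `j`
  have key : ∃ x, dAt (gens R n) m (htpyAt s j v) = Function.update
      (htpyAt s j (dAt (gens R n) m v)) x (-(htpyAt s j (dAt (gens R n) m v) x)) := by
    rcases lt_or_gt_of_ne h with hmj | hmj
    · refine ⟨m, funext fun l => ?_⟩
      by_cases hlm : l = m
      · subst hlm
        by_cases hs : s.lt l j <;>
          simp [dAt, htpyAt, slotMap, hmj, hmj.ne, hs, (gensBase R n).map_d, DGModule.par_d]
      · by_cases hlj : l = j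
        · subst hlj
          simp [dAt, htpyAt, slotMap, hmj.not_gt, hmj.ne']
        · by_cases hs : s.lt l j <;> by_cases h1 : l < m <;> by_cases h2 : l < j <;>
            simp [dAt, htpyAt, slotMap, hlm, hlj, hs, h1, h2, (gensBase R n).map_par]
    · refine ⟨j, funext fun l => ?_⟩
      by_cases hlj : l = j
      · subst hlj
        simp [dAt, htpyAt, slotMap, hmj, gensHtpy_par]
      · by_cases hlm : l = m
        · subst hlm
          by_cases hs : s.lt l j <;>
            simp [dAt, htpyAt, slotMap, hmj.not_gt, hlj, hs, (gensBase R n).map_d]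
        · by_cases hs : s.lt l j <;> by_cases h1 : l < m <;> by_cases h2 : l < j <;>
            simp [dAt, htpyAt, slotMap, hlm, hlj, hs, h1, h2, (gensBase R n).map_par]
  obtain ⟨x, hx⟩ := key
  rw [hx, Omega.mk_update_neg, Function.update_eq_self]

/-- The family obtained from `v` by projecting the entries in a set of slots. -/
noncomputable def projOn {p : ℕ} (A : Finset (Fin p)) (v : Fin p → gens R n) : Fin p → gens R n :=
  fun l => if l ∈ A then (gensBase R n).toLin (v l) else v l

theorem mk_dAt_htpyAt_self {p : ℕ} (o : O.obj p) (s : SlotOrder p) (j : Fin p)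
    (v : Fin p → gens R n) :
    Omega.mk O o (dAt (gens R n) j (htpyAt s j v)) + Omega.mk O o (htpyAt s j (dAt (gens R n) j v))
      = Omega.mk O o (projOn (Finset.univ.filter fun l => s.lt l j) v)
        - Omega.mk O o (projOn (Finset.univ.filter fun l => s.lt l j ∨ l = j) v) := by
  have h1 : dAt (gens R n) j (htpyAt s j v) = Function.update
      (projOn (Finset.univ.filter fun l => s.lt l j) v) j
        ((gens R n).d (gensHtpy R n (v j))) := by
    funext l
    by_cases hl : l = j
    · subst hl
      simp [dAt, htpyAt, slotMap]
    · by_cases hs : s.lt l j <;> by_cases h1 : l < j <;>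
        simp [dAt, htpyAt, slotMap, projOn, hl, hs, h1, DGModule.par_par]
  have h2 : htpyAt s j (dAt (gens R n) j v) = Function.update
      (projOn (Finset.univ.filter fun l => s.lt l j) v) j
        (gensHtpy R n ((gens R n).d (v j))) := by
    funext l
    by_cases hl : l = j
    · subst hl
      simp [dAt, htpyAt, slotMap]
    · by_cases hs : s.lt l j <;> by_cases h1 : l < j <;>
        simp [dAt, htpyAt, slotMap, projOn, hl, hs, h1, DGModule.par_par, (gensBase R n).map_par]
  have h3 : projOn (Finset.univ.filter fun l => s.lt l j) v = Function.update
      (projOn (Finset.univ.filter fun l => s.lt l j) v) j (v j) := by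
    funext l
    by_cases hl : l = j
    · subst hl
      simp [projOn, s.irrefl]
    · simp [hl]
  have h4 : projOn (Finset.univ.filter fun l => s.lt l j ∨ l = j) v = Function.update
      (projOn (Finset.univ.filter fun l => s.lt l j) v) j ((gensBase R n).toLin (v j)) := by
    funext l
    by_cases hl : l = j
    · subst hl
      simp [projOn]
    · simp [projOn, hl]
  rw [h1, h2, h4]
  conv_rhs => rw [h3]
  simp only [← Omega.mkMul_apply]
  rw [← MultilinearMap.map_update_add, gens_d_gensHtpy_add, Function.update_idem,
    MultilinearMap.map_update_sub]

/-- For a fixed order, the homotopy relation is a telescoping sum: the terms indexed by distinct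
slots cancel, and the others are differences between the projections of consecutive initial
segments. -/
theorem sum_mk_dAt_htpyAt {p : ℕ} (o : O.obj p) (s : SlotOrder p) (v : Fin p → gens R n) :
    ∑ j, ∑ m, Omega.mk O o (dAt (gens R n) m (htpyAt s j v))
      + ∑ m, ∑ j, Omega.mk O o (htpyAt s j (dAt (gens R n) m v))
      = Omega.mk O o v - Omega.mk O o fun l => (gensBase R n).toLin (v l) := by
  rw [Finset.sum_comm (f := fun m j => Omega.mk O o (htpyAt s j (dAt (gens R n) m v))),
    ← Finset.sum_add_distrib]
  have h1 : ∀ j, ∑ m, Omega.mk O o (dAt (gens R n) m (htpyAt s j v))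
      + ∑ m, Omega.mk O o (htpyAt s j (dAt (gens R n) m v))
      = Omega.mk O o (projOn (Finset.univ.filter fun l => s.lt l j) v)
        - Omega.mk O o (projOn (Finset.univ.filter fun l => s.lt l j ∨ l = j) v) := by
    intro j
    rw [← Finset.sum_add_distrib, Finset.sum_eq_single j]
    · exact mk_dAt_htpyAt_self o s j v
    · intro m _ hm
      rw [mk_dAt_htpyAt_of_ne o s hm, neg_add_cancel]
    · simp
  rw [Finset.sum_congr rfl fun j _ => h1 j,
    s.sum_initialSegments fun A => Omega.mk O o (projOn A v)]
  have e1 : projOn ∅ v = v := funext fun l => by simp [projOn]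
  have e2 : projOn Finset.univ v = fun l => (gensBase R n).toLin (v l) :=
    funext fun l => by simp [projOn]
  rw [e1, e2]

/-- The error in the homotopy relation for `preHtpy`. -/
noncomputable def Omega.htpyErr (n : ℕ) : Omega O n →ₗ[R] Omega O n :=
  Omega.d O n ∘ₗ Omega.preHtpy D n + Omega.preHtpy D n ∘ₗ Omega.d O n
    - LinearMap.id + Omega.base O n

/-- The error comes from the failure of the decomposition of operations to commute with the
differential. -/
theorem Omega.htpyErr_mk {p : ℕ} (o : O.obj p) (v : Fin p → gens R n) :
    Omega.htpyErr D n (Omega.mk O o v) = ∑ s, ∑ j, Omega.mk O (D.err s o) (htpyAt s j v) := by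
  have hpar : ∀ s : SlotOrder p, D.part s ((O.obj p).par o) = (O.obj p).par (D.part s o) := by
    intro s
    have h : D.part s ∘ₗ (O.obj p).par = (O.obj p).par ∘ₗ D.part s :=
      DGModule.hom_ext fun q x hx => by
        simp [DGModule.par_of_mem _ hx, DGModule.par_of_mem _ (D.part_mem s q x hx)]
    exact LinearMap.congr_fun h o
  have hd : ∀ s : SlotOrder p, (O.obj p).par (D.part s ((O.obj p).d o))
      = D.err s o - (O.obj p).d ((O.obj p).par (D.part s o)) := by
    intro s
    rw [D.part_d, map_add, DGModule.par_par, DGModule.par_d]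
    abel
  have hadd : ∀ (a b : O.obj p) (w : Fin p → gens R n),
      Omega.mk O (a - b) w = Omega.mk O a w - Omega.mk O b w := by
    intro a b w
    rw [← Omega.mkMul_apply, map_sub]
    rfl
  have h1 : Omega.d O n (Omega.preHtpy D n (Omega.mk O o v))
      = ∑ s, ∑ j, Omega.mk O ((O.obj p).d ((O.obj p).par (D.part s o))) (htpyAt s j v)
        + ∑ s, ∑ j, ∑ m, Omega.mk O (D.part s o) (dAt (gens R n) m (htpyAt s j v)) := by
    simp only [Omega.preHtpy_mk, map_sum, Omega.d_mk, DGModule.par_par, Finset.sum_add_distrib]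
  have h2 : Omega.preHtpy D n (Omega.d O n (Omega.mk O o v))
      = ∑ s, ∑ j, Omega.mk O (D.err s o) (htpyAt s j v)
        - ∑ s, ∑ j, Omega.mk O ((O.obj p).d ((O.obj p).par (D.part s o))) (htpyAt s j v)
        + ∑ s, ∑ m, ∑ j, Omega.mk O (D.part s o) (htpyAt s j (dAt (gens R n) m v)) := by
    simp only [Omega.d_mk, map_add, map_sum, Omega.preHtpy_mk, hpar, DGModule.par_par, hd, hadd,
      Finset.sum_sub_distrib]
    rw [Finset.sum_comm (f := fun m s => ∑ j,
      Omega.mk O (D.part s o) (htpyAt s j (dAt (gens R n) m v)))]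
  have h3 : ∑ s, ∑ j, ∑ m, Omega.mk O (D.part s o) (dAt (gens R n) m (htpyAt s j v))
      + ∑ s, ∑ m, ∑ j, Omega.mk O (D.part s o) (htpyAt s j (dAt (gens R n) m v))
      = Omega.mk O o v - Omega.base O n (Omega.mk O o v) := by
    have hsum : ∀ w : Fin p → gens R n, ∑ s, Omega.mk O (D.part s o) w = Omega.mk O o w := by
      intro w
      simp only [← Omega.mkMul_apply]
      rw [← sum_apply, ← map_sum, D.sum_part]
    rw [← Finset.sum_add_distrib, Finset.sum_congr rfl fun s _ => sum_mk_dAt_htpyAt _ s v,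
      Finset.sum_sub_distrib, hsum, hsum, Omega.base_mk]
  simp only [Omega.htpyErr, LinearMap.add_apply, LinearMap.sub_apply, LinearMap.comp_apply,
    LinearMap.id_apply]
  rw [h1, h2, sub_add, ← h3]
  abel

theorem Omega.mem_of_forall_mk (S : Submodule R (Omega O n))
    (h : ∀ (p : ℕ) (o : O.obj p) (v : Fin p → gens R n), Omega.mk O o v ∈ S) (x : Omega O n) :
    x ∈ S := by
  have h1 : S.mkQ = 0 := Omega.hom_ext fun p o v => by
    rw [Submodule.mkQ_apply, (Submodule.Quotient.mk_eq_zero S).2 (h p o v), LinearMap.zero_apply]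
  rw [← Submodule.Quotient.mk_eq_zero S, ← Submodule.mkQ_apply, h1, LinearMap.zero_apply]

/-- The span of the `o(v₁, …, v_p)` in which at most `r` of the `v_j` involve the `dxᵢ`. -/
def Omega.dxFiltration (O : UAOperad R) (n r : ℕ) : Submodule R (Omega O n) :=
  Submodule.span R {z | ∃ (p : ℕ) (o : O.obj p) (v : Fin p → gens R n) (A : Finset (Fin p)),
    A.card ≤ r ∧ (∀ l ∉ A, (v l).2 = 0) ∧ z = Omega.mk O o v}

theorem Omega.exists_mem_dxFiltration (x : Omega O n) : ∃ r, x ∈ Omega.dxFiltration O n r := by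
  have hmono : Monotone (Omega.dxFiltration O n) := by
    intro r r' hr
    refine Submodule.span_mono ?_
    rintro _ ⟨p, o, v, A, hA, hv, rfl⟩
    exact ⟨p, o, v, A, hA.trans hr, hv, rfl⟩
  have h := Omega.mem_of_forall_mk (⨆ r, Omega.dxFiltration O n r) (fun p o v =>
    Submodule.mem_iSup_of_mem p (Submodule.subset_span ⟨p, o, v, Finset.univ, by simp, by simp,
      rfl⟩)) x
  exact (Submodule.mem_iSup_of_directed _ hmono.directed_le).1 h

theorem gensHtpy_eq_zero {y : gens R n} (h : y.2 = 0) : gensHtpy R n y = 0 := by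
  refine Prod.ext (funext fun i => ?_) rfl
  change y.2 i - y.2 0 = 0
  rw [h]
  exact sub_self (0 : R)

theorem htpyAt_snd {p : ℕ} (s : SlotOrder p) (j l : Fin p) {v : Fin p → gens R n}
    (h : l = j ∨ (v l).2 = 0) : (htpyAt s j v l).2 = 0 := by
  by_cases hl : l = j
  · subst hl
    simp only [htpyAt, slotMap, if_true]
    rfl
  · have h0 := h.resolve_left hl
    have h1 : ((gensBase R n).toLin (v l)).2 = 0 := by
      rw [gensBase_apply]
      exact funext fun i => congrFun h0 0
    have hpar : ∀ y : gens R n, y.2 = 0 → ((gens R n).par y).2 = 0 := by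
      intro y hy
      rw [gens_par]
      exact neg_eq_zero.2 hy
    by_cases h2 : l < j <;> by_cases h3 : s.lt l j <;>
      simp only [htpyAt, slotMap, hl, h2, h3, if_true, if_false, LinearMap.comp_apply,
        LinearMap.id_apply, h0, h1, hpar]

/-- The error term is locally nilpotent: it turns one of the `v_j` which involve the `dxᵢ` into a
combination of the `xᵢ`, and creates no others. -/
theorem Omega.htpyErr_pow_eq_zero (r : ℕ) (x : Omega O n) (hx : x ∈ Omega.dxFiltration O n r) :
    (Omega.htpyErr D n ^ (r + 1)) x = 0 := by
  induction r generalizing x with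
  | zero =>
    have h : Omega.dxFiltration O n 0 ≤ LinearMap.ker (Omega.htpyErr D n) := by
      refine Submodule.span_le.2 ?_
      rintro _ ⟨p, o, v, A, hA, hv, rfl⟩
      change Omega.htpyErr D n _ = 0
      rw [Omega.htpyErr_mk]
      refine Finset.sum_eq_zero fun s _ => Finset.sum_eq_zero fun j _ =>
        Omega.mk_htpyAt_self _ _ _ _ (gensHtpy_eq_zero (hv j ?_))
      rw [Finset.card_eq_zero.1 (Nat.le_zero.1 hA)]
      simp
    rw [zero_add, pow_one]
    exact h hx
  | succ r ih =>
    have h : Omega.dxFiltration O n (r + 1)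
        ≤ (Omega.dxFiltration O n r).comap (Omega.htpyErr D n) := by
      refine Submodule.span_le.2 ?_
      rintro _ ⟨p, o, v, A, hA, hv, rfl⟩
      change Omega.htpyErr D n _ ∈ Omega.dxFiltration O n r
      rw [Omega.htpyErr_mk]
      refine Submodule.sum_mem _ fun s _ => Submodule.sum_mem _ fun j _ => ?_
      by_cases hj : j ∈ A
      · refine Submodule.subset_span ⟨p, _, _, A.erase j, ?_, fun l hl => ?_, rfl⟩
        · rw [Finset.card_erase_of_mem hj]
          omega
        · refine htpyAt_snd s j l ?_
          by_cases h : l = j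
          · exact Or.inl h
          · exact Or.inr (hv l fun hA => hl (Finset.mem_erase.2 ⟨h, hA⟩))
      · rw [Omega.mk_htpyAt_self _ _ _ _ (gensHtpy_eq_zero (hv j hj))]
        exact Submodule.zero_mem _
    rw [pow_succ]
    exact ih _ (h hx)

theorem Omega.base_preHtpy (x : Omega O n) : Omega.base O n (Omega.preHtpy D n x) = 0 := by
  have h : Omega.base O n ∘ₗ Omega.preHtpy D n = 0 := Omega.hom_ext fun p o v => by
    rw [LinearMap.comp_apply, Omega.preHtpy_mk, map_sum, LinearMap.zero_apply]
    refine Finset.sum_eq_zero fun s _ => ?_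
    rw [map_sum]
    refine Finset.sum_eq_zero fun j _ => ?_
    rw [Omega.base_mk]
    refine Omega.mk_eq_zero _ j ?_
    simp [htpyAt, slotMap, gensBase_gensHtpy]
  exact LinearMap.congr_fun h x

theorem Omega.preHtpy_mem {q : ℤ} {x : Omega O n} (hx : x ∈ Omega.deg O n q) :
    Omega.preHtpy D n x ∈ Omega.deg O n (q - 1) := by
  have h : Omega.deg O n q ≤ (Omega.deg O n (q - 1)).comap (Omega.preHtpy D n) := by
    refine Submodule.span_le.2 ?_
    rintro _ ⟨p, a, e, o, v, ho, hv, rfl, rfl⟩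
    change Omega.preHtpy D n _ ∈ Omega.deg O n _
    rw [Omega.preHtpy_mk]
    refine Submodule.sum_mem _ fun s _ => Submodule.sum_mem _ fun j _ => ?_
    rw [Omega.mk_htpyAt _ _ _ hv]
    refine Submodule.smul_mem _ _ (Omega.mk_mem (DGModule.par_mem _ (D.part_mem s a o ho))
      (htpyAt'_mem s j hv) ?_)
    rw [Finset.sum_update_of_mem (Finset.mem_univ j),
      ← Finset.add_sum_erase _ e (Finset.mem_univ j), Finset.sdiff_singleton_eq_erase]
    ring
  exact h hx

/-- Correcting a homotopy by a locally nilpotent error: if `d S + S d = 1 - ρ + ν` with `ρ` an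
idempotent chain map such that `ρ S = 0`, then `S (1 + ν)⁻¹` is a homotopy between `1` and `ρ`. -/
theorem exists_homotopy_of_locally_nilpotent {E : Type*} [AddCommGroup E] [Module R E]
    (F : ℤ → Submodule R E) (d S ρ ν : E →ₗ[R] E) (hd : ∀ x, d (d x) = 0)
    (hdF : ∀ q, ∀ x ∈ F q, d x ∈ F (q + 1)) (hSF : ∀ q, ∀ x ∈ F q, S x ∈ F (q - 1))
    (hρF : ∀ q, ∀ x ∈ F q, ρ x ∈ F q) (hdρ : ∀ x, d (ρ x) = ρ (d x)) (hρρ : ∀ x, ρ (ρ x) = ρ x)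
    (hρS : ∀ x, ρ (S x) = 0) (hν : ∀ x, d (S x) + S (d x) = x - ρ x + ν x)
    (hnil : ∀ x, ∃ r, (ν ^ r) x = 0) :
    ∃ s : E →ₗ[R] E, (∀ q, ∀ x ∈ F q, s x ∈ F (q - 1)) ∧
      ∀ x, d (s x) + s (d x) = x - ρ x := by
  have hν' : ∀ x, ν x = d (S x) + S (d x) - x + ρ x := fun x => by
    rw [hν]
    abel
  have hνF : ∀ q, ∀ x ∈ F q, ν x ∈ F q := by
    intro q x hx
    rw [hν']
    have h1 := hdF _ _ (hSF q x hx)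
    have h2 := hSF _ _ (hdF q x hx)
    rw [sub_add_cancel] at h1
    rw [add_sub_cancel_right] at h2
    exact add_mem (sub_mem (add_mem h1 h2) hx) (hρF q x hx)
  have hdν : ∀ x, d (ν x) = ν (d x) := fun x => by
    simp only [hν', map_add, map_sub, hd, hdρ, map_zero]
    abel
  have hρν : ∀ x, ρ (ν x) = 0 := fun x => by
    rw [hν', map_add, map_sub, map_add, ← hdρ, hρS, hρS, hρρ, map_zero]
    abel
  let U : E →ₗ[R] E := LinearMap.id + ν
  have hU : ∀ x, U x = x + ν x := fun _ => rfl
  have hinj : ∀ x, U x = 0 → x = 0 := by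
    intro x hx
    have h1 : ν x = -x := by
      rw [hU] at hx
      exact (neg_eq_of_add_eq_zero_right hx).symm
    obtain ⟨r, hr⟩ := hnil x
    induction r with
    | zero => simpa using hr
    | succ r ih =>
      rw [pow_succ, Module.End.mul_apply, h1, map_neg, neg_eq_zero] at hr
      exact ih hr
  have hsurj : ∀ x, ∃ y, U y = x ∧ ∀ q, x ∈ F q → y ∈ F q := by
    intro x
    obtain ⟨r, hr⟩ := hnil x
    induction r generalizing x with
    | zero => exact ⟨0, by simpa using hr.symm, fun q _ => zero_mem _⟩
    | succ r ih =>
      rw [pow_succ, Module.End.mul_apply] at hr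
      obtain ⟨y, hy, hyF⟩ := ih (ν x) hr
      refine ⟨x - y, ?_, fun q hx => sub_mem hx (hyF q (hνF q x hx))⟩
      rw [map_sub, hy, hU, add_sub_cancel_right]
  let e : E ≃ₗ[R] E := LinearEquiv.ofBijective U
    ⟨(injective_iff_map_eq_zero U).2 hinj, fun x => (hsurj x).imp fun _ h => h.1⟩
  have heU : ∀ x, U (e.symm x) = x := fun x => e.apply_symm_apply x
  have heF : ∀ q, ∀ x ∈ F q, e.symm x ∈ F q := by
    intro q x hx
    obtain ⟨y, hy, hyF⟩ := hsurj x
    have : e.symm x = y := (LinearEquiv.symm_apply_eq e).2 hy.symm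
    rw [this]
    exact hyF q hx
  have hed : ∀ x, e.symm (d x) = d (e.symm x) := by
    intro x
    refine (LinearEquiv.symm_apply_eq e).2 ?_
    change d x = U (d (e.symm x))
    conv_lhs => rw [← heU x]
    rw [hU, hU, map_add, hdν]
  refine ⟨S ∘ₗ e.symm.toLinearMap, fun q x hx => hSF q _ (heF q x hx), fun x => ?_⟩
  change d (S (e.symm x)) + S (e.symm (d x)) = _
  have h1 := heU x
  rw [hU] at h1
  have h2 : ρ x = ρ (e.symm x) := by
    conv_lhs => rw [← h1]
    rw [map_add, hρν, add_zero]
  rw [hed, hν, h2, sub_add_eq_add_sub, h1]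

/-- The complex `Ω_n` is contractible relatively to its augmentation. -/
theorem Omega.exists_contraction (D : O.OrderDecomposition) (n : ℕ) :
    ∃ s : Omega O n →ₗ[R] Omega O n, (∀ q, ∀ x ∈ Omega.deg O n q, s x ∈ Omega.deg O n (q - 1)) ∧
      ∀ x, Omega.d O n (s x) + s (Omega.d O n x) = x - Omega.eval O n x • Omega.one O n := by
  obtain ⟨s, h1, h2⟩ := exists_homotopy_of_locally_nilpotent (Omega.deg O n) (Omega.d O n)
    (Omega.preHtpy D n) (Omega.base O n) (Omega.htpyErr D n) (Omega.d_d O)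
    (fun q x hx => Omega.d_mem O hx) (fun q x hx => Omega.preHtpy_mem D hx)
    (fun q x hx => Omega.map_mem _ hx) (Omega.d_base O n)
    (fun x => by rw [Omega.base_eq O n (Omega.base O n x), Omega.base_eq O n x, map_smul,
      Omega.eval_one, smul_eq_mul, mul_one])
    (Omega.base_preHtpy D)
    (fun x => by
      simp only [Omega.htpyErr, LinearMap.add_apply, LinearMap.sub_apply, LinearMap.comp_apply,
        LinearMap.id_apply]
      abel)
    (fun x => (Omega.exists_mem_dxFiltration x).imp' (· + 1) fun r hr =>
      Omega.htpyErr_pow_eq_zero D r x hr)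
  exact ⟨s, h1, fun x => by rw [h2, Omega.base_eq]⟩

end Contraction

/-! ### Null-homotopic maps between double complexes -/

section DoubleComplex

variable {C : Type*} [Category* C] [Preadditive C] {ι : Type*} {c : ComplexShape ι}

/-- If the rows of the double complex `P` are contractible and the columns of the double complex
`Q` are contractible, then a map `P ⟶ Q` is null-homotopic for the horizontal differentials, by
homotopies which commute with the vertical differentials. -/
theorem exists_homotopy_doubleComplex (P Q : ℕ → HomologicalComplex C c)
    (bP : ∀ k, P (k + 1) ⟶ P k) (bQ : ∀ k, Q (k + 1) ⟶ Q k) (f : ∀ k, P k ⟶ Q k)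
    (hb : ∀ k, bP (k + 1) ≫ bP k = 0) (hf : ∀ k, f (k + 1) ≫ bQ k = bP k ≫ f k)
    (s : ∀ k, Homotopy (𝟙 (P k)) 0) (t : ∀ k i, (Q k).X i ⟶ (Q (k + 1)).X i)
    (ht0 : ∀ i, t 0 i ≫ (bQ 0).f i = 𝟙 _)
    (ht : ∀ k i, t (k + 1) i ≫ (bQ (k + 1)).f i + (bQ k).f i ≫ t k i = 𝟙 _) :
    ∃ S : ∀ k, Homotopy (f k) 0, ∀ k i j,
      (S (k + 1)).hom i j ≫ (bQ k).f j = (bP k).f i ≫ (S k).hom i j := by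
  let S' : ∀ k, Homotopy (f k) 0 → ∀ i j, (P (k + 1)).X i ⟶ (Q (k + 1)).X j :=
    fun k S i j => (bP k).f i ≫ S.hom i j ≫ t k j
  have hS' : ∀ k S i j, ¬ c.Rel j i → S' k S i j = 0 := fun k S i j h => by
    simp only [S', S.zero i j h, Limits.zero_comp, Limits.comp_zero]
  let e : ∀ k, Homotopy (f k) 0 → (P (k + 1) ⟶ Q (k + 1)) := fun k S =>
    f (k + 1) - Homotopy.nullHomotopicMap (S' k S)
  let H : ∀ k S, Homotopy (e k S) 0 := fun k S =>
    (Homotopy.ofEq (Category.id_comp (e k S)).symm).trans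
      (((s (k + 1)).compRight (e k S)).trans (Homotopy.ofEq Limits.zero_comp))
  let next : ∀ k, Homotopy (f k) 0 → Homotopy (f (k + 1)) 0 := fun k S =>
    (Homotopy.ofEq (add_sub_cancel _ _).symm).trans
      (((Homotopy.nullHomotopy (S' k S) (hS' k S)).add (H k S)).trans
        (Homotopy.ofEq (add_zero _)))
  have next_hom : ∀ k S i j,
      (next k S).hom i j = S' k S i j + (s (k + 1)).hom i j ≫ (e k S).f j := by
    intro k S i j
    simp [next, H, Homotopy.nullHomotopy]
  have he : ∀ k S, (∀ i j, (bP k).f i ≫ S.hom i j ≫ t k j ≫ (bQ k).f j = (bP k).f i ≫ S.hom i j) →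
      e k S ≫ bQ k = 0 := by
    intro k S hS
    have h1 : f k = Homotopy.nullHomotopicMap S.hom := by
      ext i
      rw [S.comm i]
      simp [Homotopy.nullHomotopicMap]
    rw [Preadditive.sub_comp, hf, Homotopy.nullHomotopicMap_comp, h1,
      Homotopy.comp_nullHomotopicMap, sub_eq_zero]
    congr 1
    funext i j
    simp only [S', Category.assoc, hS]
  have hnext : ∀ k S,
      (∀ i j, (bP k).f i ≫ S.hom i j ≫ t k j ≫ (bQ k).f j = (bP k).f i ≫ S.hom i j) →
      ∀ i j, (next k S).hom i j ≫ (bQ k).f j = (bP k).f i ≫ S.hom i j := by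
    intro k S hS i j
    have h2 := HomologicalComplex.congr_hom (he k S hS) j
    rw [HomologicalComplex.comp_f, HomologicalComplex.zero_f] at h2
    rw [next_hom, Preadditive.add_comp, Category.assoc ((s (k + 1)).hom i j), h2, Limits.comp_zero,
      add_zero]
    simp only [S', Category.assoc, hS]
  have hnext' : ∀ k S,
      (∀ i j, (bP k).f i ≫ S.hom i j ≫ t k j ≫ (bQ k).f j = (bP k).f i ≫ S.hom i j) →
      ∀ i j, (bP (k + 1)).f i ≫ (next k S).hom i j ≫ t (k + 1) j ≫ (bQ (k + 1)).f j
        = (bP (k + 1)).f i ≫ (next k S).hom i j := by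
    intro k S hS i j
    have h3 := HomologicalComplex.congr_hom (hb k) i
    rw [HomologicalComplex.comp_f, HomologicalComplex.zero_f] at h3
    rw [eq_sub_of_add_eq (ht k j), Preadditive.comp_sub, Category.comp_id, Preadditive.comp_sub,
      reassoc_of% (hnext k S hS i j), reassoc_of% h3, Limits.zero_comp, sub_zero]
  let T : ∀ k, {S : Homotopy (f k) 0 // ∀ i j,
      (bP k).f i ≫ S.hom i j ≫ t k j ≫ (bQ k).f j = (bP k).f i ≫ S.hom i j} := fun k =>
    Nat.rec ⟨(Homotopy.ofEq (Category.id_comp (f 0)).symm).trans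
      (((s 0).compRight (f 0)).trans (Homotopy.ofEq Limits.zero_comp)), fun i j => by
        rw [ht0, Category.comp_id]⟩ (fun k S => ⟨next k S.1, hnext' k S.1 S.2⟩) k
  exact ⟨fun k => (T k).1, fun k i j => hnext k (T k).1 (T k).2 i j⟩

end DoubleComplex

/-! ### Maps between complexes of simplicial objects -/

section Simplicial

open AlgebraicTopology AlgebraicTopology.DoldKan

variable {A : Type*} [Category* A] [Abelian A]

instance : (normalizedMooreComplex A).Additive where
  map_add {X Y f g} := by
    rw [← cancel_mono (inclusionOfMooreComplexMap Y)]
    have h : ∀ f : X ⟶ Y, (normalizedMooreComplex A).map f ≫ inclusionOfMooreComplexMap Y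
        = inclusionOfMooreComplexMap X ≫ (alternatingFaceMapComplex A).map f := fun f =>
      ((inclusionOfMooreComplex A).naturality f)
    rw [Preadditive.add_comp, h, h, h]
    ext k
    simp

instance : (normalizedMooreComplex A).Full :=
  inferInstanceAs (Abelian.DoldKan.equivalence (A := A)).functor.Full

instance : (normalizedMooreComplex A).Faithful :=
  inferInstanceAs (Abelian.DoldKan.equivalence (A := A)).functor.Faithful

variable (A) in
/-- The functor of normalized `k`-chains of simplicial objects. -/
noncomputable abbrev normalizedChains (k : ℕ) : SimplicialObject A ⥤ A :=
  normalizedMooreComplex A ⋙ HomologicalComplex.eval A _ k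

variable (A) in
/-- The differential of normalized chains, as a natural transformation. -/
noncomputable def normalizedChainsD (k : ℕ) :
    normalizedChains A (k + 1) ⟶ normalizedChains A k where
  app X := ((normalizedMooreComplex A).obj X).d (k + 1) k
  naturality _ _ f := ((normalizedMooreComplex A).map f).comm (k + 1) k

variable (A) in
/-- The inclusion of normalized chains. -/
noncomputable def normalizedChainsι (k : ℕ) :
    normalizedChains A k ⟶ (evaluation SimplexCategoryᵒᵖ A).obj (op ⦋k⦌) where
  app X := (inclusionOfMooreComplexMap X).f k
  naturality _ _ f := HomologicalComplex.congr_hom ((inclusionOfMooreComplex A).naturality f) k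

variable (A) in
/-- The projection onto normalized chains. -/
noncomputable def normalizedChainsπ (k : ℕ) :
    (evaluation SimplexCategoryᵒᵖ A).obj (op ⦋k⦌) ⟶ normalizedChains A k where
  app X := (PInftyToNormalizedMooreComplex X).f k
  naturality _ _ f :=
    HomologicalComplex.congr_hom (PInftyToNormalizedMooreComplex_naturality f) k

theorem normalizedChainsι_π (k : ℕ) : normalizedChainsι A k ≫ normalizedChainsπ A k = 𝟙 _ := by
  ext X
  exact HomologicalComplex.congr_hom (splitMonoInclusionOfMooreComplexMap X).id k

/-- Let `U` and `W` be cochain complexes of simplicial objects. If `U` is contractible in each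
simplicial degree (not necessarily in a natural way) and the simplicial objects `W^q` have
contractible chain complexes, then every morphism `U ⟶ W` is null-homotopic. -/
theorem nonempty_homotopy_zero {U W : CochainComplex (SimplicialObject A) ℤ} (f : U ⟶ W)
    (s : ∀ k : ℕ, Homotopy (𝟙 ((((evaluation SimplexCategoryᵒᵖ A).obj
      (op ⦋k⦌)).mapHomologicalComplex (ComplexShape.up ℤ)).obj U)) 0)
    (t : ∀ q, Homotopy (𝟙 ((alternatingFaceMapComplex A).obj (W.X q))) 0) :
    Nonempty (Homotopy f 0) := by
  let c := ComplexShape.up ℤ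
  -- the contractions of the rows restrict to normalized chains, which are a natural summand
  have s' : ∀ k, Homotopy (𝟙 (((normalizedChains A k).mapHomologicalComplex c).obj U)) 0 := by
    intro k
    have h1 : (NatTrans.mapHomologicalComplex (normalizedChainsι A k) c).app U ≫
        (NatTrans.mapHomologicalComplex (normalizedChainsπ A k) c).app U = 𝟙 _ := by
      ext q
      exact NatTrans.congr_app (normalizedChainsι_π k) (U.X q)
    exact (Homotopy.ofEq (by rw [Category.comp_id, h1])).trans
      ((((s k).compLeft
        ((NatTrans.mapHomologicalComplex (normalizedChainsι A k) c).app U)).compRight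
          ((NatTrans.mapHomologicalComplex (normalizedChainsπ A k) c).app U)).trans
            (Homotopy.ofEq (by simp)))
  have t' : ∀ q, Homotopy (𝟙 ((normalizedMooreComplex A).obj (W.X q))) 0 := fun q =>
    (Homotopy.ofEq (by
      rw [Category.comp_id]
      exact (splitMonoInclusionOfMooreComplexMap (W.X q)).id.symm)).trans
      ((((t q).compLeft (inclusionOfMooreComplexMap (W.X q))).compRight
        (PInftyToNormalizedMooreComplex (W.X q))).trans (Homotopy.ofEq (by
          rw [Limits.comp_zero, Limits.zero_comp]
          rfl)))
  obtain ⟨S, hS⟩ := exists_homotopy_doubleComplex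
    (fun k => ((normalizedChains A k).mapHomologicalComplex c).obj U)
    (fun k => ((normalizedChains A k).mapHomologicalComplex c).obj W)
    (fun k => (NatTrans.mapHomologicalComplex (normalizedChainsD A k) c).app U)
    (fun k => (NatTrans.mapHomologicalComplex (normalizedChainsD A k) c).app W)
    (fun k => ((normalizedChains A k).mapHomologicalComplex c).map f)
    (fun k => by
      ext q
      exact ((normalizedMooreComplex A).obj (U.X q)).d_comp_d _ _ _)
    (fun k => (NatTrans.mapHomologicalComplex (normalizedChainsD A k) c).naturality f)
    s' (fun k q => (t' q).hom k (k + 1))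
    (fun q => by
      have h := (t' q).comm 0
      rw [dNext_eq_zero _ _ (by simp), prevD_eq _ (show (ComplexShape.down ℕ).Rel 1 0 from rfl),
        HomologicalComplex.zero_f, add_zero, zero_add] at h
      exact h.symm)
    (fun k q => by
      have h := (t' q).comm (k + 1)
      rw [dNext_eq _ (show (ComplexShape.down ℕ).Rel (k + 1) k from rfl),
        prevD_eq _ (show (ComplexShape.down ℕ).Rel (k + 1 + 1) (k + 1) from rfl),
        HomologicalComplex.zero_f, add_zero] at h
      exact (add_comm _ _).trans h.symm)
  let φ : ∀ i j, (normalizedMooreComplex A).obj (U.X i) ⟶ (normalizedMooreComplex A).obj (W.X j) :=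
    fun i j =>
      { f := fun k => (S k).hom i j
        comm' := by
          rintro _ k rfl
          exact hS k i j }
  refine ⟨{ hom := fun i j => (normalizedMooreComplex A).preimage (φ i j), zero := ?_, comm := ?_ }⟩
  · intro i j hij
    refine (normalizedMooreComplex A).map_injective ?_
    rw [Functor.map_preimage, Functor.map_zero]
    ext k
    exact (S k).zero i j hij
  · intro i
    refine (normalizedMooreComplex A).map_injective ?_
    rw [dNext_eq _ (show c.Rel i (i + 1) from rfl),
      prevD_eq _ (show c.Rel (i - 1) i from sub_add_cancel i 1)]
    simp only [Functor.map_add, Functor.map_comp, Functor.map_preimage, HomologicalComplex.zero_f,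
      add_zero]
    ext k
    have h := (S k).comm i
    rw [dNext_eq _ (show c.Rel i (i + 1) from rfl),
      prevD_eq _ (show c.Rel (i - 1) i from sub_add_cancel i 1), HomologicalComplex.zero_f,
      add_zero] at h
    exact h

end Simplicial

section HomotopyCategory

open AlgebraicTopology CochainComplex Pretriangulated

variable {A : Type*} [Category* A] [Abelian A]

noncomputable instance : Abelian (SimplicialObject A) :=
  inferInstanceAs (Abelian (SimplexCategoryᵒᵖ ⥤ A))

/-- The evaluation of complexes of simplicial objects in a simplicial degree. -/
noncomputable abbrev evalComplex (A : Type*) [Category* A] [Abelian A] (k : ℕ) :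
    CochainComplex (SimplicialObject A) ℤ ⥤ CochainComplex A ℤ :=
  ((evaluation SimplexCategoryᵒᵖ A).obj (op ⦋k⦌)).mapHomologicalComplex (ComplexShape.up ℤ)

instance (k : ℕ) : Functor.Additive (C := SimplicialObject A)
    ((evaluation SimplexCategoryᵒᵖ A).obj (op ⦋k⦌)) := inferInstance

theorem nonempty_contraction_mappingCone {B V : CochainComplex (SimplicialObject A) ℤ} (η : B ⟶ V)
    (k : ℕ) (h : IsIso ((HomotopyCategory.quotient A (ComplexShape.up ℤ)).map
      ((evalComplex A k).map η))) :
    Nonempty (Homotopy (𝟙 ((evalComplex A k).obj (mappingCone η))) 0) := by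
  let E : SimplicialObject A ⥤ A := (evaluation SimplexCategoryᵒᵖ A).obj (op ⦋k⦌)
  let F := E.mapHomotopyCategory (ComplexShape.up ℤ)
  have hT := F.map_distinguished _ (HomotopyCategory.mappingCone_triangleh_distinguished η)
  refine (HomotopyCategory.isZero_quotient_obj_iff _).1 (Triangle.isZero₃_of_isIso₁ _ hT ?_)
  exact h

/-- The simplicial objects `W^q` have contractible chain complexes. -/
def ColumnContractible (W : CochainComplex (SimplicialObject A) ℤ) : Prop :=
  ∀ q, Nonempty (Homotopy (𝟙 ((alternatingFaceMapComplex A).obj (W.X q))) 0)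

/-- `η` becomes a homotopy equivalence in each simplicial degree. -/
def RowEquivalence {B V : CochainComplex (SimplicialObject A) ℤ} (η : B ⟶ V) : Prop :=
  ∀ k, IsIso ((HomotopyCategory.quotient A (ComplexShape.up ℤ)).map ((evalComplex A k).map η))

variable {B V W : CochainComplex (SimplicialObject A) ℤ} {η : B ⟶ V}

theorem ColumnContractible.shift (hW : ColumnContractible W) : ColumnContractible (W⟦(1 : ℤ)⟧) :=
  fun q => hW (q + 1)

theorem RowEquivalence.hom_mappingCone_eq_zero (hη : RowEquivalence η) (hW : ColumnContractible W)
    (g : (HomotopyCategory.quotient (SimplicialObject A) (ComplexShape.up ℤ)).obj (mappingCone η) ⟶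
      (HomotopyCategory.quotient (SimplicialObject A) (ComplexShape.up ℤ)).obj W) : g = 0 := by
  obtain ⟨g, rfl⟩ := (HomotopyCategory.quotient _ _).map_surjective g
  obtain ⟨h⟩ := nonempty_homotopy_zero g
    (fun k => (nonempty_contraction_mappingCone η k (hη k)).some) (fun q => (hW q).some)
  rw [HomotopyCategory.eq_of_homotopy _ _ h, Functor.map_zero]

/-- Morphisms `V ⟶ W` up to homotopy are determined by their restrictions along `η`. -/
theorem RowEquivalence.eq_zero (hη : RowEquivalence η) (hW : ColumnContractible W)
    (a : (HomotopyCategory.quotient (SimplicialObject A) (ComplexShape.up ℤ)).obj V ⟶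
      (HomotopyCategory.quotient (SimplicialObject A) (ComplexShape.up ℤ)).obj W)
    (ha : (HomotopyCategory.quotient _ _).map η ≫ a = 0) : a = 0 := by
  obtain ⟨g, hg⟩ := Triangle.yoneda_exact₂ _
    (HomotopyCategory.mappingCone_triangleh_distinguished η) a ha
  exact hg.trans ((congrArg (_ ≫ ·) (hη.hom_mappingCone_eq_zero hW g)).trans Limits.comp_zero)

/-- Morphisms `B ⟶ W` up to homotopy extend along `η`. -/
theorem RowEquivalence.exists_extension (hη : RowEquivalence η) (hW : ColumnContractible W)
    (a : (HomotopyCategory.quotient (SimplicialObject A) (ComplexShape.up ℤ)).obj B ⟶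
      (HomotopyCategory.quotient (SimplicialObject A) (ComplexShape.up ℤ)).obj W) :
    ∃ b, (HomotopyCategory.quotient _ _).map η ≫ b = a := by
  let Q := HomotopyCategory.quotient (SimplicialObject A) (ComplexShape.up ℤ)
  have hT := rot_of_distTriang _ (HomotopyCategory.mappingCone_triangleh_distinguished η)
  have h0 : (mappingCone.triangleh η).rotate.mor₂ ≫ a⟦(1 : ℤ)⟧' = 0 := by
    rw [← cancel_mono ((Q.commShiftIso (1 : ℤ)).inv.app W), Limits.zero_comp]
    exact hη.hom_mappingCone_eq_zero hW.shift _
  obtain ⟨g, hg⟩ := Triangle.yoneda_exact₃ _ hT (a⟦(1 : ℤ)⟧') h0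
  let S := CategoryTheory.shiftFunctor (HomotopyCategory (SimplicialObject A)
    (ComplexShape.up ℤ)) (1 : ℤ)
  obtain ⟨b, hb⟩ : ∃ b : Q.obj V ⟶ Q.obj W, S.map b = g := S.map_surjective g
  refine ⟨-b, S.map_injective ?_⟩
  have h1 : S.map a = (-S.map (Q.map η)) ≫ S.map b := by
    rw [hb]
    exact hg
  change S.map (Q.map η ≫ (-b)) = S.map a
  rw [h1, Preadditive.comp_neg, Functor.map_neg, Functor.map_comp, Preadditive.neg_comp]

/-- Two complexes of simplicial objects with contractible columns which receive row equivalences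
from the same complex are homotopy equivalent. -/
theorem RowEquivalence.nonempty_homotopyEquiv (hη : RowEquivalence η) {θ : B ⟶ W}
    (hθ : RowEquivalence θ) (hV : ColumnContractible V) (hW : ColumnContractible W) :
    Nonempty (HomotopyEquiv V W) := by
  let Q := HomotopyCategory.quotient (SimplicialObject A) (ComplexShape.up ℤ)
  obtain ⟨a, ha⟩ := hη.exists_extension hW (Q.map θ)
  obtain ⟨b, hb⟩ := hθ.exists_extension hV (Q.map η)
  refine ⟨HomotopyCategory.homotopyEquivOfIso ⟨a, b, ?_, ?_⟩⟩
  · refine sub_eq_zero.1 (hη.eq_zero hV _ ?_)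
    rw [Preadditive.comp_sub, reassoc_of% ha, hb, Category.comp_id, sub_self]
  · refine sub_eq_zero.1 (hθ.eq_zero hW _ ?_)
    rw [Preadditive.comp_sub, reassoc_of% hb, ha, Category.comp_id, sub_self]

end HomotopyCategory

/-! ### Simplicial differential graded modules -/

/-- A simplicial differential graded module, with the components of given degree as submodules. -/
structure SimplicialDG (R : Type u) [CommRing R] where
  obj : SimplexCategory → Type u
  [addCommGroup : ∀ n, AddCommGroup (obj n)]
  [module : ∀ n, Module R (obj n)]
  deg : ∀ n, ℤ → Submodule R (obj n)
  d : ∀ n, obj n →ₗ[R] obj n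
  d_mem : ∀ {n} {q : ℤ} {x : obj n}, x ∈ deg n q → d n x ∈ deg n (q + 1)
  d_d : ∀ {n} (x : obj n), d n (d n x) = 0
  map : ∀ {m n : SimplexCategory} (_ : m ⟶ n), obj n →ₗ[R] obj m
  map_mem : ∀ {m n : SimplexCategory} (f : m ⟶ n) {q : ℤ} {x : obj n}, x ∈ deg n q →
    map f x ∈ deg m q
  map_id : ∀ {n} (x : obj n), map (𝟙 n) x = x
  map_comp : ∀ {l m n : SimplexCategory} (f : l ⟶ m) (g : m ⟶ n) (x : obj n),
    map (f ≫ g) x = map f (map g x)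
  d_map : ∀ {m n : SimplexCategory} (f : m ⟶ n) (x : obj n), d m (map f x) = map f (d n x)

attribute [instance] SimplicialDG.addCommGroup SimplicialDG.module

namespace SimplicialDG

variable {R : Type u} [CommRing R] (E : SimplicialDG R)

/-- The simplicial module of the elements of degree `q`. -/
def component (q : ℤ) : SimplicialObject (ModuleCat.{u} R) where
  obj n := ModuleCat.of R (E.deg n.unop q)
  map f := ModuleCat.ofHom ((E.map f.unop).restrict fun _ hx => E.map_mem f.unop hx)
  map_id n := by
    ext x
    exact E.map_id x.1
  map_comp f g := by
    ext x
    exact E.map_comp g.unop f.unop x.1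

/-- The differential, as a map of simplicial modules. -/
def componentD (q : ℤ) : E.component q ⟶ E.component (q + 1) where
  app n := ModuleCat.ofHom ((E.d n.unop).restrict fun _ hx => E.d_mem hx)
  naturality m n f := by
    ext x
    exact Subtype.ext (E.d_map f.unop x.1)

/-- The cochain complex of simplicial modules associated with a simplicial differential graded
module. -/
noncomputable def complex : CochainComplex (SimplicialObject (ModuleCat.{u} R)) ℤ :=
  CochainComplex.of E.component E.componentD fun q => by
    ext n x
    exact Subtype.ext (E.d_d x.1)

theorem complex_d (q : ℤ) : E.complex.d q (q + 1) = E.componentD q :=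
  CochainComplex.of_d _ _ _

/-- A map of simplicial differential graded modules given by linear maps induces a morphism of
complexes. -/
noncomputable def complexHom {E F : SimplicialDG R} (φ : ∀ n, E.obj n →ₗ[R] F.obj n)
    (hdeg : ∀ n q x, x ∈ E.deg n q → φ n x ∈ F.deg n q)
    (hd : ∀ n x, F.d n (φ n x) = φ n (E.d n x))
    (hmap : ∀ {m n : SimplexCategory} (f : m ⟶ n) (x), F.map f (φ n x) = φ m (E.map f x)) :
    E.complex ⟶ F.complex where
  f q :=
    { app := fun n => ModuleCat.ofHom ((φ n.unop).restrict fun x hx => hdeg n.unop q x hx)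
      naturality := fun m n f => by
        ext x
        exact Subtype.ext (hmap f.unop x.1).symm }
  comm' := by
    rintro q _ rfl
    rw [complex_d, complex_d]
    ext n x
    exact Subtype.ext (hd n.unop x.1)

/-- The ground ring, as a constant simplicial differential graded module. -/
def base (R : Type u) [CommRing R] : SimplicialDG R where
  obj _ := R
  deg _ := (DGModule.unit R).deg
  d _ := 0
  d_mem _ := Submodule.zero_mem _
  d_d _ := rfl
  map _ := LinearMap.id
  map_mem _ _ _ h := h
  map_id _ := rfl
  map_comp _ _ _ := rfl
  d_map _ _ := rfl

/-- A unit of a simplicial differential graded module `E` and, in each simplicial degree `n`, an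
augmentation of `E_n` and a contraction of `E_n` relatively to it. Only the unit is natural
in `n`. -/
structure RowContraction (E : SimplicialDG R) where
  one : ∀ n, E.obj n
  one_mem : ∀ n, one n ∈ E.deg n 0
  d_one : ∀ n, E.d n (one n) = 0
  map_one : ∀ {m n : SimplexCategory} (f : m ⟶ n), E.map f (one n) = one m
  eval : ∀ n, E.obj n →ₗ[R] R
  eval_of_mem : ∀ n {q : ℤ} (_ : q ≠ 0) {x : E.obj n}, x ∈ E.deg n q → eval n x = 0
  eval_d : ∀ n (x : E.obj n), eval n (E.d n x) = 0
  eval_one : ∀ n, eval n (one n) = 1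
  htpy : ∀ n, E.obj n →ₗ[R] E.obj n
  htpy_mem : ∀ n (q : ℤ) (x : E.obj n), x ∈ E.deg n q → htpy n x ∈ E.deg n (q - 1)
  d_htpy : ∀ n (x : E.obj n), E.d n (htpy n x) + htpy n (E.d n x) = x - eval n x • one n

namespace RowContraction

variable {E} (S : RowContraction E)

/-- The inclusion of constants. -/
noncomputable def unit : (base R).complex ⟶ E.complex :=
  complexHom (E := base R) (fun n => LinearMap.toSpanSingleton R (E.obj n) (S.one n))
    (fun n q x hx => by
      change R at x
      change x • S.one n ∈ E.deg n q
      by_cases hq : q = 0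
      · subst hq
        exact Submodule.smul_mem _ _ (S.one_mem n)
      · have hx0 : x = 0 := (DGModule.mem_unit_deg (R := R)).1 hx hq
        rw [hx0, zero_smul]
        exact Submodule.zero_mem _)
    (fun n x => by
      change R at x
      change E.d n (x • S.one n) = (0 : R) • S.one n
      rw [map_smul, S.d_one, smul_zero, zero_smul])
    (fun {m n} f x => by
      change R at x
      change E.map f (x • S.one n) = x • S.one m
      rw [map_smul, S.map_one])

/-- The augmentation in a simplicial degree. -/
noncomputable def counit (k : ℕ) :
    (evalComplex (ModuleCat.{u} R) k).obj E.complex ⟶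
      (evalComplex (ModuleCat.{u} R) k).obj (base R).complex where
  f q := ModuleCat.ofHom (LinearMap.restrict (p := E.deg ⦋k⦌ q) (q := (DGModule.unit R).deg q)
    (S.eval ⦋k⦌) fun _ hx => (DGModule.mem_unit_deg (R := R)).2 fun hq => S.eval_of_mem _ hq hx)
  comm' := by
    rintro q _ rfl
    change _ ≫ ((base R).complex.d q (q + 1)).app (op ⦋k⦌)
      = (E.complex.d q (q + 1)).app (op ⦋k⦌) ≫ _
    rw [complex_d, complex_d]
    ext x
    exact Subtype.ext (S.eval_d ⦋k⦌ x.1).symm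

/-- The components of the contraction in a simplicial degree. -/
noncomputable def htpyHom (k : ℕ) (i j : ℤ) :
    ((evalComplex (ModuleCat.{u} R) k).obj E.complex).X i ⟶
      ((evalComplex (ModuleCat.{u} R) k).obj E.complex).X j :=
  if h : j + 1 = i then
    ModuleCat.ofHom (LinearMap.restrict (p := E.deg ⦋k⦌ i) (q := E.deg ⦋k⦌ j) (S.htpy ⦋k⦌)
      fun x hx => by
        have h1 := S.htpy_mem ⦋k⦌ i x hx
        rwa [← h, add_sub_cancel_right] at h1)
  else 0

theorem htpyHom_apply (k : ℕ) (q : ℤ) (x : E.deg ⦋k⦌ (q + 1)) :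
    (show E.deg ⦋k⦌ q from S.htpyHom k (q + 1) q x).1 = S.htpy ⦋k⦌ x.1 := by
  have h : S.htpyHom k (q + 1) q = ModuleCat.ofHom (LinearMap.restrict (p := E.deg ⦋k⦌ (q + 1))
      (q := E.deg ⦋k⦌ q) (S.htpy ⦋k⦌) fun x hx => by
        simpa using S.htpy_mem ⦋k⦌ (q + 1) x hx) := dif_pos rfl
  exact congrArg (fun g : ((evalComplex (ModuleCat.{u} R) k).obj E.complex).X (q + 1) ⟶ _ =>
    (show E.deg ⦋k⦌ q from g x).1) h

/-- The contraction in a simplicial degree, as a homotopy. -/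
noncomputable def homotopy (k : ℕ) :
    Homotopy (𝟙 ((evalComplex (ModuleCat.{u} R) k).obj E.complex))
      (S.counit k ≫ (evalComplex (ModuleCat.{u} R) k).map S.unit) where
  hom i j := S.htpyHom k i j
  zero i j hij := dif_neg hij
  comm q := by
    obtain ⟨q, rfl⟩ : ∃ q', q = q' + 1 := ⟨q - 1, (sub_add_cancel q 1).symm⟩
    rw [dNext_eq _ (show (ComplexShape.up ℤ).Rel (q + 1) (q + 1 + 1) from rfl),
      prevD_eq _ (show (ComplexShape.up ℤ).Rel q (q + 1) from rfl)]
    have hd (j : ℤ) : ((evalComplex (ModuleCat.{u} R) k).obj E.complex).d j (j + 1)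
        = (E.componentD j).app (op ⦋k⦌) :=
      congrArg (fun g => NatTrans.app g (op ⦋k⦌)) (E.complex_d j)
    rw [hd, hd]
    ext x
    refine Subtype.ext ?_
    have h := S.d_htpy ⦋k⦌ x.1
    change x.1 = (show E.deg ⦋k⦌ (q + 1) from S.htpyHom k (q + 1 + 1) (q + 1)
        (show E.deg ⦋k⦌ (q + 1 + 1) from ⟨E.d ⦋k⦌ x.1, E.d_mem x.2⟩)).1
      + E.d ⦋k⦌ (show E.deg ⦋k⦌ q from S.htpyHom k (q + 1) q x).1 + S.eval ⦋k⦌ x.1 • S.one ⦋k⦌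
    rw [S.htpyHom_apply, S.htpyHom_apply k q x]
    dsimp only
    rw [add_comm (S.htpy ⦋k⦌ (E.d ⦋k⦌ x.1)), h, sub_add_cancel]

theorem rowEquivalence : RowEquivalence S.unit := by
  intro k
  let Q := HomotopyCategory.quotient (ModuleCat.{u} R) (ComplexShape.up ℤ)
  refine ⟨Q.map (S.counit k), ?_, ?_⟩
  · refine (Q.map_comp _ _).symm.trans ((congrArg Q.map ?_).trans (Q.map_id _))
    ext q x
    refine Subtype.ext ?_
    change S.eval ⦋k⦌ ((show R from x.1) • S.one ⦋k⦌) = x.1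
    rw [map_smul, S.eval_one]
    exact mul_one (M := R) _
  · exact (Q.map_comp _ _).symm.trans
      ((HomotopyCategory.eq_of_homotopy _ _ (S.homotopy k)).symm.trans (Q.map_id _))

end RowContraction

/-- Multiplications of the elements of `E_n` by functions on the vertices of the simplex, natural
in the simplex. -/
structure VertexMul (E : SimplicialDG R) where
  mul : ∀ {n : SimplexCategory}, (Fin (n.len + 1) → R) → E.obj n →ₗ[R] E.obj n
  mul_mem : ∀ {n : SimplexCategory} (φ : Fin (n.len + 1) → R) {q : ℤ} {x : E.obj n},
    x ∈ E.deg n q → mul φ x ∈ E.deg n q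
  map_mul : ∀ {m n : SimplexCategory} (f : m ⟶ n) (φ : Fin (n.len + 1) → R) (x : E.obj n),
    E.map f (mul φ x) = mul (fun i => φ (f.toOrderHom i)) (E.map f x)
  one_mul : ∀ {n : SimplexCategory} (x : E.obj n), mul (fun _ => 1) x = x
  zero_mul : ∀ {n : SimplexCategory} (x : E.obj n), mul (fun _ => 0) x = 0

namespace VertexMul

variable {E} (M : VertexMul E)

/-- The indicator function of the vertices of `⦋n + 1⦌` after the vertex `i`. -/
def cut (R : Type u) [CommRing R] {n : ℕ} (i : Fin (n + 1)) : Fin (n + 2) → R :=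
  fun j => if (i : ℕ) < j then 1 else 0

/-- The operators `w ↦ φᵢ · sᵢ w` of a simplicial homotopy, with `φᵢ` the indicator function of
the vertices after `i`. -/
def cutHom (q : ℤ) {n : ℕ} (i : Fin (n + 1)) :
    (E.component q) _⦋n⦌ ⟶ (E.component q) _⦋n + 1⦌ :=
  ModuleCat.ofHom (LinearMap.restrict (p := E.deg ⦋n⦌ q) (q := E.deg ⦋n + 1⦌ q)
    (M.mul (n := ⦋n + 1⦌) (cut R i) ∘ₗ E.map (SimplexCategory.σ i))
      fun _ hx => M.mul_mem _ (E.map_mem _ hx))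

theorem cutHom_map (q : ℤ) {n m : ℕ} (i : Fin (n + 1)) (f : ⦋m⦌ ⟶ ⦋n + 1⦌)
    (x : E.deg ⦋n⦌ q) :
    ((M.cutHom q i ≫ (E.component q).map f.op) x).1
      = M.mul (n := ⦋m⦌) (fun j => cut R i (f.toOrderHom j))
          (E.map (f ≫ SimplexCategory.σ i) x.1) := by
  rw [E.map_comp, ← M.map_mul]
  rfl

theorem map_cutHom (q : ℤ) {n m : ℕ} (i : Fin (n + 1)) (f : ⦋n⦌ ⟶ ⦋m⦌) (x : E.deg ⦋m⦌ q) :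
    (((E.component q).map f.op ≫ M.cutHom q i) x).1
      = M.mul (n := ⦋n + 1⦌) (cut R i) (E.map (SimplexCategory.σ i ≫ f) x.1) := by
  rw [E.map_comp]
  rfl

/-- The identity of `E^q` is simplicially homotopic to zero. -/
def simplicialHomotopy (q : ℤ) : SimplicialObject.Homotopy (0 : E.component q ⟶ E.component q)
    (𝟙 (E.component q)) where
  h i := M.cutHom q i
  h_zero_comp_δ_zero n := by
    ext x
    refine Subtype.ext ((M.cutHom_map q _ _ x).trans ?_)
    rw [show SimplexCategory.δ 0 ≫ SimplexCategory.σ 0 = 𝟙 ⦋n⦌ from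
      SimplexCategory.δ_comp_σ_self (i := 0), E.map_id]
    refine Eq.trans (congrArg (fun φ => M.mul (n := ⦋n⦌) φ x.1) (funext fun j => ?_))
      (M.one_mul x.1)
    simp [cut, SimplexCategory.δ]
  h_last_comp_δ_last n := by
    ext x
    refine Subtype.ext ((M.cutHom_map q _ _ x).trans ?_)
    refine Eq.trans (congrArg (fun φ => M.mul (n := ⦋n⦌) φ _) (funext fun j => ?_)) (M.zero_mul _)
    have hj := j.2
    change (if n < ((Fin.last (n + 1)).succAbove j : ℕ) then (1 : R) else 0) = 0
    rw [if_neg]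
    simp only [Fin.succAbove_last, Fin.val_castSucc, SimplexCategory.len_mk] at hj ⊢
    omega
  h_succ_comp_δ_castSucc_of_lt i j hij := by
    ext x
    refine Subtype.ext ((M.cutHom_map q _ _ x).trans (Eq.trans ?_ (M.map_cutHom q _ _ x).symm))
    rw [SimplexCategory.δ_comp_σ_of_le hij]
    refine congrArg (fun φ => M.mul (n := ⦋_⦌) φ _) (funext fun k => if_congr ?_ rfl rfl)
    change _ < ((Fin.succAbove _ k : Fin _) : ℕ) ↔ _
    simp only [Fin.succAbove, Fin.lt_def, Fin.le_def, Fin.val_castSucc, Fin.val_succ] at hij ⊢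
    split_ifs <;> simp
    omega
  h_succ_comp_δ_castSucc_succ j := by
    ext x
    refine Subtype.ext ((M.cutHom_map q _ _ x).trans (Eq.trans ?_ (M.cutHom_map q _ _ x).symm))
    rw [show SimplexCategory.δ j.castSucc.succ ≫ SimplexCategory.σ j.castSucc = 𝟙 _ from
      SimplexCategory.δ_comp_σ_succ, show SimplexCategory.δ j.castSucc.succ ≫
      SimplexCategory.σ j.succ = 𝟙 _ from SimplexCategory.δ_comp_σ_self (i := j.succ)]
    refine congrArg (fun φ => M.mul (n := ⦋_⦌) φ _) (funext fun k => if_congr ?_ rfl rfl)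
    change _ < ((Fin.succAbove _ k : Fin _) : ℕ) ↔ _ < ((Fin.succAbove _ k : Fin _) : ℕ)
    simp only [Fin.succAbove, Fin.lt_def, Fin.val_castSucc, Fin.val_succ]
    split_ifs <;> simp <;> omega
  h_castSucc_comp_δ_succ_of_lt i j hji := by
    ext x
    refine Subtype.ext ((M.cutHom_map q _ _ x).trans (Eq.trans ?_ (M.map_cutHom q _ _ x).symm))
    rw [SimplexCategory.δ_comp_σ_of_gt hji]
    refine congrArg (fun φ => M.mul (n := ⦋_⦌) φ _) (funext fun k => if_congr ?_ rfl rfl)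
    change _ < ((Fin.succAbove _ k : Fin _) : ℕ) ↔ _
    simp only [Fin.succAbove, Fin.lt_def, Fin.val_castSucc, Fin.val_succ] at hji ⊢
    split_ifs <;> simp
    omega
  h_comp_σ_castSucc_of_le i j hij := by
    ext x
    refine Subtype.ext ((M.cutHom_map q _ _ x).trans (Eq.trans ?_ (M.map_cutHom q _ _ x).symm))
    rw [SimplexCategory.σ_comp_σ hij]
    refine congrArg (fun φ => M.mul (n := ⦋_⦌) φ _) (funext fun k => if_congr ?_ rfl rfl)
    change _ < ((Fin.predAbove _ k : Fin _) : ℕ) ↔ _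
    simp only [Fin.predAbove, Fin.lt_def, Fin.le_def, Fin.val_castSucc, Fin.val_succ] at hij ⊢
    split_ifs <;> simp <;> omega
  h_comp_σ_succ_of_lt i j hji := by
    ext x
    refine Subtype.ext ((M.cutHom_map q _ _ x).trans (Eq.trans ?_ (M.map_cutHom q _ _ x).symm))
    rw [← SimplexCategory.σ_comp_σ hji]
    refine congrArg (fun φ => M.mul (n := ⦋_⦌) φ _) (funext fun k => if_congr ?_ rfl rfl)
    change _ < ((Fin.predAbove _ k : Fin _) : ℕ) ↔ _
    simp only [Fin.predAbove, Fin.lt_def, Fin.le_def, Fin.val_castSucc, Fin.val_succ] at hji ⊢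
    split_ifs <;> simp
    omega

theorem columnContractible (M : VertexMul E) : ColumnContractible E.complex := fun q =>
  ⟨(Homotopy.ofEq ((AlgebraicTopology.alternatingFaceMapComplex _).map_id _).symm).trans
    ((M.simplicialHomotopy q).toChainHomotopy.symm.trans
      (Homotopy.ofEq (by
        ext k
        rfl)))⟩

end VertexMul

end SimplicialDG

/-! ### Multiplication of forms by functions on the vertices -/

section VertexMul

variable {R : Type u} [CommRing R]

theorem koszul_decomposeFin {p : ℕ} (σ : Equiv.Perm (Fin p)) (e : Fin p → ℤ) :
    koszul R (Equiv.Perm.decomposeFin.symm (0, σ)) (Fin.cons 0 e : Fin (p + 1) → ℤ)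
      = koszul R σ e := by
  simp [koszul, Fin.prod_univ_succ]

theorem comp_decomposeFin_symm {α : Type*} {p : ℕ} (σ : Equiv.Perm (Fin p)) (w : α)
    (v : Fin p → α) :
    (Fin.cons w v : Fin (p + 1) → α) ∘ ⇑(Equiv.Perm.decomposeFin.symm (0, σ)).symm
      = Fin.cons w (v ∘ ⇑σ.symm) := by
  rw [Equiv.comp_symm_eq]
  funext j
  refine Fin.cases ?_ (fun j => ?_) j <;> simp

theorem cons_insertNth {α : Type*} {p : ℕ} (w s : α) (i : Fin (p + 1)) (v : Fin p → α) :
    (Fin.cons w (i.insertNth s v : Fin (p + 1) → α) : Fin (p + 2) → α)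
      = (i.succ.insertNth s (Fin.cons w v : Fin (p + 1) → α) : Fin (p + 2) → α) := by
  rw [Fin.eq_insertNth_iff]
  refine ⟨by simp, ?_⟩
  funext j
  refine Fin.cases ?_ (fun j => ?_) j <;> simp [Fin.removeNth]

variable (O : UAOperad.{u} R)

/-- The function `φ` on the vertices, as the element `∑ φᵢ xᵢ` of the module of generators. -/
def gensFun {n : ℕ} (φ : Fin (n + 1) → R) : gens R n :=
  ((φ, 0) : (Fin (n + 1) → R) × (Fin (n + 1) → R))

theorem gensFun_mem {n : ℕ} (φ : Fin (n + 1) → R) : gensFun φ ∈ (gens R n).deg 0 :=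
  ⟨fun h => absurd rfl h, fun _ => rfl⟩

theorem slot_eq {p : ℕ} : 2 + p = p + 1 + 1 := by omega

/-- The multilinear maps `o(v₁, …, v_p) ↦ (μ ∘₂ o)(∑ φᵢ xᵢ, v₁, …, v_p)`. -/
noncomputable def mulFamily {n : ℕ} (μ : O.obj 2) (φ : Fin (n + 1) → R) (p : ℕ) :
    O.obj p →ₗ[R] MultilinearMap R (fun _ : Fin p => gens R n) (Omega O n) where
  toFun o := (Omega.mkMul O n (p + 1) (O.comp slot_eq 1 μ o)).curryLeft (gensFun φ)
  map_add' o o' := by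
    ext v
    simp
  map_smul' r o := by
    ext v
    simp

variable {O}

theorem mulFamily_apply {n : ℕ} (μ : O.obj 2) (φ : Fin (n + 1) → R) {p : ℕ} (o : O.obj p)
    (v : Fin p → gens R n) : mulFamily O μ φ p o v
      = Omega.mk O (O.comp slot_eq 1 μ o) (Fin.cons (gensFun φ) v : Fin (p + 1) → gens R n) := rfl

theorem innerSlot_one {p : ℕ} (t : Fin p) : innerSlot (slot_eq (p := p)) 1 t = t.succ :=
  Fin.ext (Nat.add_comm 1 t)

theorem comp_act_one (μ : O.obj 2) {p : ℕ} (σ : Equiv.Perm (Fin p)) (o : O.obj p) :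
    O.comp slot_eq 1 μ ((O.act σ).toLin o)
      = (O.act (Equiv.Perm.decomposeFin.symm (0, σ))).toLin (O.comp slot_eq 1 μ o) := by
  have h := O.comp_act (slot_eq (p := p)) 1 1 σ (Equiv.Perm.decomposeFin.symm (0, σ))
    (fun k hk => by
      obtain rfl : k = 0 := by omega
      exact Equiv.Perm.decomposeFin_symm_apply_zero _ _)
    (fun t => by
      simp [innerSlot_one]) μ o
  rw [O.act_one] at h
  exact h

theorem comp_comp_unitZero (μ : O.obj 2) {p : ℕ} (i : Fin (p + 1)) (o : O.obj (p + 1)) :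
    O.comp (n := 0) (r := p + 1) rfl i.succ (O.comp slot_eq 1 μ o) O.unitZero
      = O.comp slot_eq 1 μ (O.comp (n := 0) (r := p) rfl i o O.unitZero) := by
  rw [← innerSlot_one]
  exact O.comp_comp (n := 0) slot_eq rfl rfl slot_eq 1 i μ o O.unitZero

/-- The multiplication `x ↦ μ(∑ φᵢ xᵢ, x)` of `Ω_n`. -/
noncomputable def Omega.vertexMul {n : ℕ} (μ : O.obj 2) (φ : Fin (n + 1) → R) :
    Omega O n →ₗ[R] Omega O n :=
  Omega.lift (mulFamily O μ φ)
    (fun p o σ e v hv => by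
      rw [mulFamily_apply, mulFamily_apply, comp_act_one, Omega.mk_act _ _ (Fin.cons 0 e),
        koszul_decomposeFin, comp_decomposeFin_symm]
      exact Fin.cases (gensFun_mem φ) hv)
    (fun p i o v => by
      rw [mulFamily_apply, mulFamily_apply, cons_insertNth, Omega.mk_insertNth_genX,
        comp_comp_unitZero])
    (fun p i o v => by
      rw [mulFamily_apply, cons_insertNth, Omega.mk_insertNth_genDX])

theorem Omega.vertexMul_mk {n : ℕ} (μ : O.obj 2) (φ : Fin (n + 1) → R) {p : ℕ} (o : O.obj p)
    (v : Fin p → gens R n) : Omega.vertexMul μ φ (Omega.mk O o v)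
      = Omega.mk O (O.comp slot_eq 1 μ o) (Fin.cons (gensFun φ) v : Fin (p + 1) → gens R n) :=
  Omega.lift_mk _ _ _ _ o v

/-- An operation of augmentation `1` has the left unit `1₀`. -/
theorem comp_comp_unitZero_zero {μ : O.obj 2} (hμ : O.augR μ = 1) {p : ℕ} (o : O.obj p) :
    O.comp (n := 0) (r := p) rfl 0 (O.comp slot_eq 1 μ o) O.unitZero = o := by
  have h1 : O.comp (n := 0) (r := 1) rfl 0 μ O.unitZero = O.one := by
    refine O.aug_one.1 ?_
    exact ((O.augR_comp_unitZero (p := 1) 0 μ).trans hμ).trans O.aug.map_one.symm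
  have h : (O.comp (n := 0) (r := p) rfl 0).flip O.unitZero ∘ₗ O.comp slot_eq 1 μ
      = LinearMap.id := DGModule.hom_ext fun q x hx => by
    have h2 := O.comp_comm (n := 0) (slot_eq (p := p)) rfl (t := 1) rfl (Nat.add_comm 1 p) 1 0
      one_ne_zero q 0 μ x O.unitZero hx O.unitZero_mem
    rw [h1, mul_zero, sgn_zero, one_smul] at h2
    exact h2.trans (O.one_comp (Nat.add_comm 1 p) x)
  exact LinearMap.congr_fun h o

end VertexMul

/-! ### The simplicial differential graded module of forms -/

section OmegaDG

variable {R : Type u} [CommRing R] (O : UAOperad.{u} R)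

/-- `Ω_*` as a simplicial differential graded module. -/
noncomputable def omegaDG : SimplicialDG R where
  obj n := Omega O n.len
  deg n := Omega.deg O n.len
  d n := Omega.d O n.len
  d_mem := Omega.d_mem O
  d_d := Omega.d_d O
  map := Omega.map O
  map_mem := Omega.map_mem
  map_id {n} x := by
    have h : Omega.map O (𝟙 n) = LinearMap.id := Omega.hom_ext fun p o v => Omega.map_mk _ o v
    exact LinearMap.congr_fun h x
  map_comp f g x := by
    have h : Omega.map O (f ≫ g) = Omega.map O f ∘ₗ Omega.map O g := Omega.hom_ext fun p o v => by
      rw [LinearMap.comp_apply, Omega.map_mk, Omega.map_mk, Omega.map_mk]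
      rfl
    exact LinearMap.congr_fun h x
  d_map := Omega.d_map O

variable {O}

theorem UAOperad.OrderDecomposition.nonempty_rowContraction (D : O.OrderDecomposition) :
    Nonempty (SimplicialDG.RowContraction (omegaDG O)) := by
  choose s hs hds using fun n => Omega.exists_contraction D n
  exact ⟨{
    one := fun n => Omega.one O n.len
    one_mem := fun n => Omega.one_mem O n.len
    d_one := fun n => Omega.d_one O n.len
    map_one := Omega.map_one O
    eval := fun n => Omega.eval O n.len
    eval_of_mem := fun n q hq x hx => Omega.eval_of_mem O n.len hq hx
    eval_d := fun n => Omega.eval_d O n.len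
    eval_one := fun n => Omega.eval_one O n.len
    htpy := fun n => s n.len
    htpy_mem := fun n => hs n.len
    d_htpy := fun n => hds n.len }⟩

/-- The multiplication of forms by functions on the vertices, given by an operation `μ`. -/
noncomputable def omegaVertexMul {μ : O.obj 2} (hμ0 : μ ∈ (O.obj 2).deg 0) (hμ : O.augR μ = 1) :
    SimplicialDG.VertexMul (omegaDG O) where
  mul φ := Omega.vertexMul μ φ
  mul_mem {n} φ q x hx := by
    have h : Omega.deg O n.len q ≤ (Omega.deg O n.len q).comap (Omega.vertexMul μ φ) := by
      refine Submodule.span_le.2 ?_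
      rintro _ ⟨p, a, e, o, v, ho, hv, hq, rfl⟩
      change Omega.vertexMul μ φ _ ∈ Omega.deg O n.len q
      rw [Omega.vertexMul_mk]
      exact Omega.mk_mem (O.comp_mem _ _ _ _ _ _ hμ0 ho) (e := Fin.cons 0 e)
        (Fin.cases (gensFun_mem φ) hv) (by simpa [Fin.sum_univ_succ] using hq)
    exact h hx
  map_mul {m n} f φ x := by
    have h : Omega.map O f ∘ₗ Omega.vertexMul μ φ
        = Omega.vertexMul μ (fun i => φ (f.toOrderHom i)) ∘ₗ Omega.map O f :=
      Omega.hom_ext fun p o v => by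
        rw [LinearMap.comp_apply, LinearMap.comp_apply, Omega.vertexMul_mk, Omega.map_mk,
          Omega.map_mk, Omega.vertexMul_mk]
        congr 1
        funext j
        exact Fin.cases rfl (fun _ => rfl) j
    exact LinearMap.congr_fun h x
  one_mul {n} x := by
    have h : Omega.vertexMul (n := n.len) μ (fun _ => 1) = LinearMap.id :=
      Omega.hom_ext fun p o v => by
        have h1 : (gensFun fun _ => 1 : gens R n.len) = ∑ i, genX R n.len i :=
          (sum_genX R n.len).symm
        rw [Omega.vertexMul_mk, h1, ← Fin.insertNth_zero', Omega.mk_insertNth_genX,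
          comp_comp_unitZero_zero hμ]
        rfl
    exact LinearMap.congr_fun h x
  zero_mul {n} x := by
    have h : Omega.vertexMul (n := n.len) μ (fun _ => 0) = 0 :=
      Omega.hom_ext fun p o v => by
        rw [Omega.vertexMul_mk, ← Omega.mkMul_apply]
        exact MultilinearMap.map_coord_zero _ 0 rfl
    exact LinearMap.congr_fun h x

theorem UAOperad.exists_mul (hsurj : Function.Surjective (O.aug.app 2).toLin) :
    ∃ μ ∈ (O.obj 2).deg 0, O.augR μ = 1 := by
  obtain ⟨μ, hμ⟩ := hsurj (1 : R)
  refine ⟨(O.obj 2).proj 0 μ, (O.obj 2).proj_mem 0 μ, ?_⟩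
  have h : O.augR ∘ₗ (O.obj 2).proj 0 = O.augR := DGModule.hom_ext fun q x hx => by
    by_cases hq : q = 0
    · subst hq
      rw [LinearMap.comp_apply, DGModule.proj_of_mem _ hx]
    · rw [LinearMap.comp_apply, DGModule.proj_of_mem_ne _ hq hx, map_zero,
        UAOperad.augR_of_mem hq hx]
  exact (LinearMap.congr_fun h μ).trans hμ

end OmegaDG

/-! ### The simplicial differential graded module of cochains -/

section CochainDG

variable (R : Type u) [CommRing R]

/-- The map induced on functions on the simplices by `φ : X ⟶ Y`. -/
def cochainPull {X Y : SSet.{u}} (φ : X ⟶ Y) :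
    (∀ n : ℕ, Y _⦋n⦌ → R) →ₗ[R] (∀ n : ℕ, X _⦋n⦌ → R) where
  toFun c n x := c n (φ.app (op ⦋n⦌) x)
  map_add' _ _ := rfl
  map_smul' _ _ := rfl

variable {R}

theorem cochainPull_mem {X Y : SSet.{u}} (φ : X ⟶ Y) {q : ℤ} {c : ∀ n : ℕ, Y _⦋n⦌ → R}
    (hc : c ∈ cochains R Y q) : cochainPull R φ c ∈ cochains R X q :=
  (cochainsMap R φ q ⟨c, hc⟩).2

theorem coboundary_cochainPull {X Y : SSet.{u}} (φ : X ⟶ Y) (c : ∀ n : ℕ, Y _⦋n⦌ → R) :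
    coboundary R X (cochainPull R φ c) = cochainPull R φ (coboundary R Y c) := by
  funext n x
  match n with
  | 0 => rfl
  | n + 1 =>
    change ∑ i : Fin (n + 2), (-1 : R) ^ (i : ℕ) * c n (φ.app _ (X.δ i x))
      = ∑ i : Fin (n + 2), (-1 : R) ^ (i : ℕ) * c n (Y.δ i (φ.app _ x))
    simp only [SSet.δ_naturality_apply]

variable (R) in
/-- The normalized cochains of the standard simplices, as a simplicial differential graded
module. -/
def cochainDG : SimplicialDG R where
  obj n := ∀ k : ℕ, (SSet.stdSimplex.{u}.obj n) _⦋k⦌ → R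
  deg n := cochains R (SSet.stdSimplex.obj n)
  d n := coboundary R (SSet.stdSimplex.obj n)
  d_mem := coboundary_mem R
  d_d := coboundary_coboundary R
  map f := cochainPull R (SSet.stdSimplex.map f)
  map_mem f := cochainPull_mem (SSet.stdSimplex.map f)
  map_id {n} x :=
    congrArg (fun φ => cochainPull R φ x) (CategoryTheory.Functor.map_id SSet.stdSimplex n)
  map_comp f g x :=
    congrArg (fun φ => cochainPull R φ x) (CategoryTheory.Functor.map_comp SSet.stdSimplex f g)
  d_map f := coboundary_cochainPull (SSet.stdSimplex.map f)

/-- The image of the vertex `0`. -/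
def firstVertex {n : SimplexCategory} {k : ℕ} (x : (SSet.stdSimplex.{u}.obj n) _⦋k⦌) :
    Fin (n.len + 1) :=
  (SSet.stdSimplex.objEquiv x).toOrderHom 0

variable (R) in
/-- The multiplication of cochains by functions on the vertices, `(φ c)(x) = φ(x₀) c(x)`. -/
def cochainVertexMul : SimplicialDG.VertexMul (cochainDG R) where
  mul {n} φ :=
    { toFun := fun c k x => φ (firstVertex x) * c k x
      map_add' := fun c c' => by
        funext k x
        exact mul_add _ _ _
      map_smul' := fun r c => by
        funext k x
        exact mul_left_comm _ _ _ }
  mul_mem φ q c hc k x h := by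
    change _ * c k x = 0
    rw [hc k x h, mul_zero]
  map_mul _ _ _ := rfl
  one_mul c := by
    funext k x
    exact one_mul _
  zero_mul c := by
    funext k x
    exact zero_mul _

/-- The cone over a simplex with apex the vertex `0`. -/
def cone {n : SimplexCategory} {k : ℕ} (x : (SSet.stdSimplex.{u}.obj n) _⦋k⦌) :
    (SSet.stdSimplex.{u}.obj n) _⦋k + 1⦌ :=
  SSet.stdSimplex.objEquiv.symm
    (SSet.Augmented.StandardSimplex.shift (SSet.stdSimplex.objEquiv x))

/-- The vertex `0` of a simplex. -/
def apex (n : SimplexCategory) : (SSet.stdSimplex.{u}.obj n) _⦋0⦌ :=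
  SSet.stdSimplex.objMk (OrderHom.const _ 0)

variable {n : SimplexCategory}

theorem δ_zero_cone {k : ℕ} (x : (SSet.stdSimplex.{u}.obj n) _⦋k⦌) :
    (SSet.stdSimplex.obj n).δ 0 (cone x) = x :=
  ConcreteCategory.congr_hom ((SSet.Augmented.StandardSimplex.extraDegeneracy n).s_comp_δ₀ k) x

theorem δ_one_cone (x : (SSet.stdSimplex.{u}.obj n) _⦋0⦌) :
    (SSet.stdSimplex.obj n).δ 1 (cone x) = apex n :=
  ConcreteCategory.congr_hom (SSet.Augmented.StandardSimplex.extraDegeneracy n).s₀_comp_δ₁ x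

theorem δ_succ_cone {k : ℕ} (i : Fin (k + 2)) (x : (SSet.stdSimplex.{u}.obj n) _⦋k + 1⦌) :
    (SSet.stdSimplex.obj n).δ i.succ (cone x) = cone ((SSet.stdSimplex.obj n).δ i x) :=
  ConcreteCategory.congr_hom ((SSet.Augmented.StandardSimplex.extraDegeneracy n).s_comp_δ k i) x

theorem cone_σ {k : ℕ} (i : Fin (k + 1)) (x : (SSet.stdSimplex.{u}.obj n) _⦋k⦌) :
    cone ((SSet.stdSimplex.obj n).σ i x) = (SSet.stdSimplex.obj n).σ i.succ (cone x) :=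
  (ConcreteCategory.congr_hom
    ((SSet.Augmented.StandardSimplex.extraDegeneracy n).s_comp_σ k i) x).symm

theorem coboundary_one_cone (c : ∀ k : ℕ, (SSet.stdSimplex.{u}.obj n) _⦋k⦌ → R)
    (x : (SSet.stdSimplex.{u}.obj n) _⦋0⦌) :
    coboundary R _ c 1 (cone x) = c 0 x - c 0 (apex n) := by
  rw [coboundary_succ, Fin.sum_univ_two, δ_zero_cone, δ_one_cone]
  simp [sub_eq_add_neg]

theorem coboundary_succ_cone (c : ∀ k : ℕ, (SSet.stdSimplex.{u}.obj n) _⦋k⦌ → R) (k : ℕ)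
    (x : (SSet.stdSimplex.{u}.obj n) _⦋k + 1⦌) :
    coboundary R _ c (k + 2) (cone x) = c (k + 1) x
      - ∑ i : Fin (k + 2),
        (-1 : R) ^ (i : ℕ) * c (k + 1) (cone ((SSet.stdSimplex.obj n).δ i x)) := by
  rw [coboundary_succ, Fin.sum_univ_succ, δ_zero_cone]
  simp [δ_succ_cone, pow_succ, sub_eq_add_neg]

variable (R) in
/-- The cochains of a simplex are contracted by `c ↦ (x ↦ c(cone x))` onto the multiples of the
unit. -/
def cochainRowContraction : SimplicialDG.RowContraction (cochainDG R) where
  one _ k _ := if k = 0 then 1 else 0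
  one_mem n k x h := by
    rcases h with h | h
    · exact if_neg fun hk => h (by rw [hk]; rfl)
    · refine if_neg fun hk => ?_
      subst hk
      rw [SSet.degenerate_zero] at h
      exact h
  d_one n := by
    funext k x
    match k with
    | 0 => rfl
    | 1 =>
      refine (coboundary_succ R _ 0 x).trans ?_
      rw [Fin.sum_univ_two]
      simp
      rfl
    | k + 2 =>
      exact (coboundary_succ R _ (k + 1) x).trans (Finset.sum_eq_zero fun _ _ => mul_zero _)
  map_one _ := rfl
  eval n :=
    { toFun := fun c => c 0 (apex n)
      map_add' := fun _ _ => rfl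
      map_smul' := fun _ _ => rfl }
  eval_of_mem n q hq c hc := hc 0 _ (Or.inl fun h => hq h.symm)
  eval_d _ _ := rfl
  eval_one _ := rfl
  htpy n :=
    { toFun := fun c k x => c (k + 1) (cone x)
      map_add' := fun _ _ => rfl
      map_smul' := fun _ _ => rfl }
  htpy_mem n q c hc k x h := by
    refine hc (k + 1) (cone x) (h.imp (fun h h' => h (by push_cast at h'; omega)) fun h => ?_)
    cases k with
    | zero =>
      rw [SSet.degenerate_zero] at h
      exact h.elim
    | succ k =>
      rw [SSet.degenerate_eq_iUnion_range_σ, Set.mem_iUnion] at h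
      obtain ⟨j, y, rfl⟩ := h
      rw [cone_σ]
      exact SSet.σ_mem_degenerate _ _ _
  d_htpy n c := by
    funext k x
    match k with
    | 0 =>
      change (0 : R) + coboundary R _ c 1 (cone x) = c 0 x - c 0 (apex n) * 1
      rw [zero_add, mul_one]
      exact coboundary_one_cone c x
    | k + 1 =>
      change (∑ i : Fin (k + 2), (-1 : R) ^ (i : ℕ) * _)
        + coboundary R _ c (k + 2) (cone x) = c (k + 1) x - c 0 (apex n) * 0
      rw [mul_zero, sub_zero]
      exact (add_comm _ _).trans (eq_sub_iff_add_eq.1 (coboundary_succ_cone c k x))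

end CochainDG

/-! ### Simplicial maps into a simplicial module -/

section Families

variable {R : Type u} [CommRing R]

/-- The module of simplicial maps from `X` to `A`. -/
def simplicialMaps (X : SSet.{u}) (A : SimplicialObject (ModuleCat.{u} R)) :
    Submodule R (∀ n : SimplexCategory, X.obj (op n) → A.obj (op n)) where
  carrier := {c | ∀ (m n : SimplexCategory) (f : m ⟶ n) (x : X.obj (op n)),
    c m (X.map f.op x) = A.map f.op (c n x)}
  add_mem' {c c'} hc hc' m n f x := by
    simp only [Pi.add_apply, hc m n f x, hc' m n f x, map_add]
  zero_mem' m n f x := by simp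
  smul_mem' r c hc m n f x := by
    simp only [Pi.smul_apply, hc m n f x, map_smul]

variable (R) in
/-- The functor `X ↦ Hom(X, -)` from simplicial sets to functors on simplicial modules. -/
def simplicialMapsFunctor :
    SSet.{u}ᵒᵖ ⥤ SimplicialObject (ModuleCat.{u} R) ⥤ ModuleCat.{u} R where
  obj X :=
    { obj := fun A => ModuleCat.of R (simplicialMaps X.unop A)
      map := fun {A B} α => ModuleCat.ofHom
        { toFun := fun c => ⟨fun n x => α.app (op n) (c.1 n x), fun m n f x => by
            dsimp only
            rw [c.2 m n f x, NatTrans.naturality_apply]⟩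
          map_add' := fun c c' => by
            ext n x
            exact map_add (α.app (op n)).hom _ _
          map_smul' := fun r c => by
            ext n x
            exact map_smul (α.app (op n)).hom _ _ } }
  map {X Y} φ :=
    { app := fun A => ModuleCat.ofHom
        { toFun := fun c => ⟨fun n x => c.1 n (φ.unop.app (op n) x), fun m n f x => by
            dsimp only
            rw [← c.2 m n f, NatTrans.naturality_apply]⟩
          map_add' := fun _ _ => rfl
          map_smul' := fun _ _ => rfl } }

instance (X : SSet.{u}ᵒᵖ) : ((simplicialMapsFunctor R).obj X).Additive where
  map_add := rfl

/-- The functor `X ↦ Hom(X, V)`, for a complex of simplicial modules `V`. -/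
noncomputable def sections (V : CochainComplex (SimplicialObject (ModuleCat.{u} R)) ℤ) :
    SSet.{u}ᵒᵖ ⥤ CochainComplex (ModuleCat.{u} R) ℤ where
  obj X := (((simplicialMapsFunctor R).obj X).mapHomologicalComplex (ComplexShape.up ℤ)).obj V
  map φ := (NatTrans.mapHomologicalComplex ((simplicialMapsFunctor R).map φ)
    (ComplexShape.up ℤ)).app V

end Families

/-! ### Natural homotopy equivalences -/

section NaturalHomotopyEquivalence

variable {R : Type u} [CommRing R] {C : Type*} [Category* C]

/-- Two functors with values in complexes are homotopy equivalent by natural chain maps and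
natural homotopies. -/
def NaturallyHomotopyEquivalent (P Q : C ⥤ CochainComplex (ModuleCat.{u} R) ℤ) : Prop :=
  ∃ (f : P ⟶ Q) (g : Q ⟶ P)
    (h : ∀ X, Homotopy (f.app X ≫ g.app X) (𝟙 (P.obj X)))
    (k : ∀ X, Homotopy (g.app X ≫ f.app X) (𝟙 (Q.obj X))),
    (∀ (X Y : C) (φ : X ⟶ Y) (i j : ℤ),
      (h X).hom i j ≫ (P.map φ).f j = (P.map φ).f i ≫ (h Y).hom i j) ∧
    (∀ (X Y : C) (φ : X ⟶ Y) (i j : ℤ),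
      (k X).hom i j ≫ (Q.map φ).f j = (Q.map φ).f i ≫ (k Y).hom i j)

/-- The transport of a homotopy along isomorphisms of complexes. -/
def homotopyConj {K L M : CochainComplex (ModuleCat.{u} R) ℤ} (e : K ≅ L) {a : L ⟶ M} {b : M ⟶ L}
    (h : Homotopy (a ≫ b) (𝟙 L)) {M' : CochainComplex (ModuleCat.{u} R) ℤ} (e' : M' ≅ M) :
    Homotopy ((e.hom ≫ a ≫ e'.inv) ≫ e'.hom ≫ b ≫ e.inv) (𝟙 K) :=
  (Homotopy.ofEq (by simp)).trans (((h.compLeft e.hom).compRight e.inv).trans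
    (Homotopy.ofEq (by simp)))

theorem homotopyConj_hom {K L M : CochainComplex (ModuleCat.{u} R) ℤ} (e : K ≅ L) {a : L ⟶ M}
    {b : M ⟶ L} (h : Homotopy (a ≫ b) (𝟙 L)) {M' : CochainComplex (ModuleCat.{u} R) ℤ}
    (e' : M' ≅ M) (i j : ℤ) :
    (homotopyConj e h e').hom i j = e.hom.f i ≫ h.hom i j ≫ e.inv.f j := by
  simp [homotopyConj]

theorem NaturallyHomotopyEquivalent.of_iso {P P' Q Q' : C ⥤ CochainComplex (ModuleCat.{u} R) ℤ}
    (H : NaturallyHomotopyEquivalent P Q) (α : P' ≅ P) (β : Q' ≅ Q) :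
    NaturallyHomotopyEquivalent P' Q' := by
  obtain ⟨f, g, h, k, hh, hk⟩ := H
  refine ⟨α.hom ≫ f ≫ β.inv, β.hom ≫ g ≫ α.inv,
    fun X => homotopyConj (α.app X) (h X) (β.app X),
    fun X => homotopyConj (β.app X) (k X) (α.app X), fun X Y φ i j => ?_, fun X Y φ i j => ?_⟩
  · have h1 := congrArg (fun t => HomologicalComplex.Hom.f t i) (α.hom.naturality φ)
    have h2 := congrArg (fun t => HomologicalComplex.Hom.f t j) (α.inv.naturality φ)
    simp only [HomologicalComplex.comp_f] at h1 h2
    rw [homotopyConj_hom, homotopyConj_hom]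
    simp only [Iso.app_hom, Iso.app_inv, Category.assoc]
    rw [← h2, reassoc_of% (hh X Y φ i j), reassoc_of% h1]
  · have h1 := congrArg (fun t => HomologicalComplex.Hom.f t i) (β.hom.naturality φ)
    have h2 := congrArg (fun t => HomologicalComplex.Hom.f t j) (β.inv.naturality φ)
    simp only [HomologicalComplex.comp_f] at h1 h2
    rw [homotopyConj_hom, homotopyConj_hom]
    simp only [Iso.app_hom, Iso.app_inv, Category.assoc]
    rw [← h2, reassoc_of% (hk X Y φ i j), reassoc_of% h1]

theorem NaturallyHomotopyEquivalent.nonempty_homology_iso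
    {P Q : C ⥤ CochainComplex (ModuleCat.{u} R) ℤ} (H : NaturallyHomotopyEquivalent P Q) (n : ℤ) :
    Nonempty (P ⋙ HomologicalComplex.homologyFunctor (ModuleCat.{u} R) (ComplexShape.up ℤ) n
      ≅ Q ⋙ HomologicalComplex.homologyFunctor (ModuleCat.{u} R) (ComplexShape.up ℤ) n) := by
  obtain ⟨f, g, h, k, -, -⟩ := H
  refine ⟨⟨Functor.whiskerRight f _, Functor.whiskerRight g _, ?_, ?_⟩⟩
  · ext1
    funext X
    have h1 := (h X).homologyMap_eq n
    rw [HomologicalComplex.homologyMap_comp, HomologicalComplex.homologyMap_id] at h1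
    exact h1
  · ext1
    funext X
    have h1 := (k X).homologyMap_eq n
    rw [HomologicalComplex.homologyMap_comp, HomologicalComplex.homologyMap_id] at h1
    exact h1

/-- The image of a homotopy under an additive functor. -/
def mapHomotopyId {A : Type*} [Category* A] [Preadditive A] (F : A ⥤ ModuleCat.{u} R) [F.Additive]
    {V W : CochainComplex A ℤ} {a : V ⟶ W} {b : W ⟶ V} (h : Homotopy (a ≫ b) (𝟙 V)) :
    Homotopy ((F.mapHomologicalComplex (ComplexShape.up ℤ)).map a ≫
      (F.mapHomologicalComplex (ComplexShape.up ℤ)).map b)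
      (𝟙 ((F.mapHomologicalComplex (ComplexShape.up ℤ)).obj V)) :=
  (Homotopy.ofEq ((F.mapHomologicalComplex _).map_comp a b).symm).trans
    ((F.mapHomotopy h).trans (Homotopy.ofEq ((F.mapHomologicalComplex _).map_id V)))

theorem mapHomotopyId_hom {A : Type*} [Category* A] [Preadditive A] (F : A ⥤ ModuleCat.{u} R)
    [F.Additive] {V W : CochainComplex A ℤ} {a : V ⟶ W} {b : W ⟶ V} (h : Homotopy (a ≫ b) (𝟙 V))
    (i j : ℤ) : (mapHomotopyId F h).hom i j = F.map (h.hom i j) :=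
  (zero_add _).trans (add_zero (F.map (h.hom i j)))

/-- A homotopy equivalence of complexes of simplicial modules induces homotopy equivalences
of the complexes of simplicial maps into them. -/
theorem naturallyHomotopyEquivalent_sections
    {V W : CochainComplex (SimplicialObject (ModuleCat.{u} R)) ℤ} (e : HomotopyEquiv V W) :
    NaturallyHomotopyEquivalent (sections V) (sections W) := by
  let F (X : SSet.{u}ᵒᵖ) := ((simplicialMapsFunctor R).obj X).mapHomologicalComplex
    (ComplexShape.up ℤ)
  refine ⟨⟨fun X => (F X).map e.hom, fun X Y φ => ?_⟩, ⟨fun X => (F X).map e.inv, fun X Y φ => ?_⟩,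
    fun X => mapHomotopyId _ e.homotopyHomInvId, fun X => mapHomotopyId _ e.homotopyInvHomId,
    fun X Y φ i j => ?_, fun X Y φ i j => ?_⟩
  · exact ((NatTrans.mapHomologicalComplex ((simplicialMapsFunctor R).map φ)
      (ComplexShape.up ℤ)).naturality e.hom).symm
  · exact ((NatTrans.mapHomologicalComplex ((simplicialMapsFunctor R).map φ)
      (ComplexShape.up ℤ)).naturality e.inv).symm
  · rw [mapHomotopyId_hom, mapHomotopyId_hom]
    exact ((simplicialMapsFunctor R).map φ).naturality (e.homotopyHomInvId.hom i j)
  · rw [mapHomotopyId_hom, mapHomotopyId_hom]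
    exact ((simplicialMapsFunctor R).map φ).naturality (e.homotopyInvHomId.hom i j)

end NaturalHomotopyEquivalence

/-! ### Forms and cochains as simplicial maps -/

section Comparison

variable {R : Type u} [CommRing R]

/-- Forms of degree `q` on `X` are the simplicial maps from `X` to `Ω_*^q`. -/
noncomputable def formsEquiv (O : UAOperad.{u} R) (X : SSet.{u}) (q : ℤ) :
    forms O X q ≃ₗ[R] simplicialMaps X ((omegaDG O).component q) where
  toFun c := ⟨fun n x => ⟨c.1 n x, c.2.1 n x⟩, fun m n f x => Subtype.ext (c.2.2 m n f x)⟩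
  map_add' _ _ := rfl
  map_smul' _ _ := rfl
  invFun c := ⟨fun n x => (c.1 n x).1, fun n x => (c.1 n x).2,
    fun m n f x => congrArg Subtype.val (c.2 m n f x)⟩
  left_inv _ := rfl
  right_inv _ := rfl

/-- Forms on `X` are the simplicial maps from `X` to `Ω_*`, as complexes and naturally in `X`. -/
noncomputable def formsIso (O : UAOperad.{u} R) : formsFunctor O ≅ sections (omegaDG O).complex :=
  NatIso.ofComponents (fun X => HomologicalComplex.Hom.isoOfComponents
    (fun q => (formsEquiv O X.unop q).toModuleIso) (by
      rintro q _ rfl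
      have h1 : ((formsFunctor O).obj X).d q (q + 1) = ModuleCat.ofHom (formsD O X.unop q) :=
        CochainComplex.of_d (fun q => ModuleCat.of R (forms O X.unop q))
          (fun q => ModuleCat.ofHom (formsD O X.unop q)) q
      have h2 : ((sections (omegaDG O).complex).obj X).d q (q + 1)
          = ((simplicialMapsFunctor R).obj X).map ((omegaDG O).componentD q) :=
        congrArg ((simplicialMapsFunctor R).obj X).map ((omegaDG O).complex_d q)
      rw [h1, h2]
      rfl))
    (fun φ => by
      ext q x
      rfl)

/-- The `k`-simplex of `Δ[k]` given by the identity. -/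
def idSimplex (k : ℕ) : (SSet.stdSimplex.{u}.obj ⦋k⦌) _⦋k⦌ :=
  SSet.stdSimplex.objEquiv.symm (𝟙 ⦋k⦌)

/-- Cochains of degree `q` on `X` are the simplicial maps from `X` to the cochains of degree `q` of
the standard simplices, by the Yoneda lemma: a simplicial map is evaluated on the identity
simplices, and the map given by a cochain pulls it back along the maps `Δ[n] ⟶ X`. -/
def cochainsEquiv (X : SSet.{u}) (q : ℤ) :
    cochains R X q ≃ₗ[R] simplicialMaps X ((cochainDG R).component q) where
  toFun c := ⟨fun n x => ⟨cochainPull R (SSet.yonedaEquiv.symm x) c.1, cochainPull_mem _ c.2⟩,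
    fun m n f x => Subtype.ext (by
      funext k y
      change c.1 k (X.map _ (X.map _ x)) = c.1 k (X.map _ x)
      rw [← Functor.map_comp_apply]
      rfl)⟩
  map_add' _ _ := rfl
  map_smul' _ _ := rfl
  invFun c := ⟨fun k x => (c.1 ⦋k⦌ x).1 k (idSimplex k), fun k x h => by
    rcases h with h | h
    · exact (c.1 ⦋k⦌ x).2 k _ (Or.inl h)
    · cases k with
      | zero =>
        rw [SSet.degenerate_zero] at h
        exact h.elim
      | succ k =>
        rw [SSet.degenerate_eq_iUnion_range_σ, Set.mem_iUnion] at h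
        obtain ⟨j, y, rfl⟩ := h
        have h1 := c.2 _ _ (SimplexCategory.σ j) y
        exact (congrArg (fun t => t.1 (k + 1) (idSimplex (k + 1))) h1).trans
          ((c.1 ⦋k⦌ y).2 (k + 1) _ (Or.inr (SSet.σ_mem_degenerate _ j (idSimplex k))))⟩
  left_inv c := by
    ext k x
    change c.1 k (X.map (𝟙 _) x) = c.1 k x
    rw [Functor.map_id_apply]
  right_inv c := by
    refine Subtype.ext (funext fun n => funext fun x => Subtype.ext ?_)
    funext k y
    exact (congrArg (fun t => t.1 k (idSimplex k)) (c.2 _ _ (SSet.stdSimplex.objEquiv y) x)).trans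
      (congrArg ((c.1 n x).1 k) (SSet.stdSimplex.objEquiv.injective (Category.id_comp _)))

/-- Cochains on `X` are the simplicial maps from `X` to the cochains of the standard simplices, as
complexes and naturally in `X`. -/
noncomputable def cochainsIso : cochainFunctor R ≅ sections (cochainDG R).complex :=
  NatIso.ofComponents (fun X => HomologicalComplex.Hom.isoOfComponents
    (fun q => (cochainsEquiv X.unop q).toModuleIso) (by
      rintro q _ rfl
      have h1 : ((cochainFunctor R).obj X).d q (q + 1) = ModuleCat.ofHom (cochainsD R X.unop q) :=
        CochainComplex.of_d (fun q => ModuleCat.of R (cochains R X.unop q))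
          (fun q => ModuleCat.ofHom (cochainsD R X.unop q)) q
      have h2 : ((sections (cochainDG R).complex).obj X).d q (q + 1)
          = ((simplicialMapsFunctor R).obj X).map ((cochainDG R).componentD q) :=
        congrArg ((simplicialMapsFunctor R).obj X).map ((cochainDG R).complex_d q)
      rw [h1, h2]
      refine ModuleCat.hom_ext (LinearMap.ext fun c => Subtype.ext (funext fun n =>
        funext fun x => Subtype.ext ?_))
      exact coboundary_cochainPull (SSet.yonedaEquiv.symm x) c.1))
    (fun φ => by
      refine HomologicalComplex.hom_ext _ _ fun q => ?_
      refine ModuleCat.hom_ext (LinearMap.ext fun c => Subtype.ext (funext fun n =>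
        funext fun x => Subtype.ext ?_))
      funext k y
      exact congrArg (c.1 k) (NatTrans.naturality_apply φ.unop _ x))

theorem naturallyHomotopyEquivalent_forms_cochains {O : UAOperad.{u} R} (hO : O.IsCofibrant)
    (hsurj : Function.Surjective (O.aug.app 2).toLin) :
    NaturallyHomotopyEquivalent (formsFunctor O) (cochainFunctor R) := by
  obtain ⟨D⟩ := hO.exists_orderDecomposition
  obtain ⟨S⟩ := D.nonempty_rowContraction
  obtain ⟨μ, hμ0, hμ⟩ := UAOperad.exists_mul hsurj
  obtain ⟨e⟩ := S.rowEquivalence.nonempty_homotopyEquiv (cochainRowContraction R).rowEquivalence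
    (omegaVertexMul hμ0 hμ).columnContractible (cochainVertexMul R).columnContractible
  exact (naturallyHomotopyEquivalent_sections e).of_iso (formsIso O) cochainsIso

end Comparison

end GenForms

theorem mainTheorem1 {R : Type u} [CommRing R] (O : GenForms.UAOperad.{u} R)
    (hcof : O.IsCofibrant)
    (hsurj : ∀ n : ℕ, Function.Surjective (O.aug.app n).toLin)
    (hbdd : ∀ l : ℕ, ∃ b : ℤ, ∀ q : ℤ, b < q → (O.obj l).deg q = ⊥) :
    (∃ (f : GenForms.formsFunctor O ⟶ GenForms.cochainFunctor R)
      (g : GenForms.cochainFunctor R ⟶ GenForms.formsFunctor O)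
      (h : ∀ X : SSet.{u}ᵒᵖ, Homotopy (f.app X ≫ g.app X) (𝟙 ((GenForms.formsFunctor O).obj X)))
      (k : ∀ X : SSet.{u}ᵒᵖ, Homotopy (g.app X ≫ f.app X) (𝟙 ((GenForms.cochainFunctor R).obj X))),
      (∀ (X Y : SSet.{u}ᵒᵖ) (φ : X ⟶ Y) (i j : ℤ),
        (h X).hom i j ≫ ((GenForms.formsFunctor O).map φ).f j
          = ((GenForms.formsFunctor O).map φ).f i ≫ (h Y).hom i j) ∧
      (∀ (X Y : SSet.{u}ᵒᵖ) (φ : X ⟶ Y) (i j : ℤ),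
        (k X).hom i j ≫ ((GenForms.cochainFunctor R).map φ).f j
          = ((GenForms.cochainFunctor R).map φ).f i ≫ (k Y).hom i j)) ∧
    ∀ n : ℤ, Nonempty
      (GenForms.formsFunctor O ⋙
          HomologicalComplex.homologyFunctor (ModuleCat.{u} R) (ComplexShape.up ℤ) n
        ≅ GenForms.cohomologyFunctor R n) := by
  have H := GenForms.naturallyHomotopyEquivalent_forms_cochains hcof (hsurj 2)
  exact ⟨H, fun n => H.nonempty_homology_iso n⟩
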